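/- Let $0<s<1$, $\alpha>s-1$, $\beta>-1$, let $q(x)=\sum_{l=0}^{r}c_l x^l$ with real $c_0,\dots,c_r$, and let $n\ge 0$ be an integer. Put $\omega^{(a,b)}(x)=(1-x)^a(1+x)^b$, let $P_k^{(\alpha,\beta)}$ be the Jacobi polynomials, ${}^{+}J_k^{(-\alpha,\beta)}(x)=(1-x)^{\alpha}P_k^{(\alpha,\beta)}(x)$, and $$\Lambda_k=\frac{\Gamma(k+\alpha+1)\Gamma(k+\beta+s+1)}{\Gamma(k+\alpha-s+1)\Gamma(k+\beta+1)},\qquad k=0,1,2,\dots$$ With the left and right Riemann–Liouville derivatives on $(-1,1)$, $${}_{-1}D_x^s v(x)=\frac{1}{\Gamma(1-s)}\frac{d}{dx}\int_{-1}^x\frac{v(y)}{(x-y)^s}dy,\qquad {}_xD_1^s v(x)=-\frac{1}{\Gamma(1-s)}\frac{d}{dx}\int_x^1\frac{v(y)}{(y-x)^s}dy,$$ let $Lu=\omega^{(\alpha,-\beta)}\,{}_{-1}D_x^s\{\omega^{(-\alpha+s,\beta+s)}\,{}_xD_1^s u\}$. A solution of $Lu-\mu u=F$ means a function $u$ with $\int_{-1}^1u^2\omega^{(-\alpha,\beta)}dx<\infty$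 for which both fractional derivatives exist at every point of $(-1,1)$ (the integrals converging absolutely), which satisfies the equation at every point of $(-1,1)$ and the boundary conditions: $u$ is bounded near $-1$; and, as $x\to1^-$, $u(x)\to0$ if $\alpha>0$, $u$ is bounded near $1$ if $\alpha=0$, and $\omega^{(-\alpha+s,\beta+s)}\,{}_xD_1^su$ is bounded near $1$ if $\alpha<0$. FD-corrections of the $n$-th eigenpair are real numbers $\lambda_n^{(j)}$ and functions $u_n^{(j)}$ $(j\ge0)$ such that $\lambda_n^{(0)}=\Lambda_n$; $u_n^{(0)}$ is a solution of $Lu-\lambda_n^{(0)}u=0$, not identically zero on $(-1,1)$; and for every $j\ge 0$ the function $u_n^{(j+1)}$ is a solution of $$Lu-\lambda_n^{(0)}u=F_n^{(j+1)},\qquad F_n^{(j+1)}=\sum_{p=0}^{j}\lambda_n^{(j+1-p)}u_n^{(p)}-q\,u_n^{(j)},$$ with $\int_{-1}^1F_n^{(j+1)}u_n^{(0)}\omega^{(-\alpha,\beta)}dx=0$ (solvability condition) and $\int_{-1}^1u_n^{(0)}u_n^{(j+1)}\omega^{(-\alpha,\beta)}dx=0$ (orthogonality condition). Define numbers $b_{i,k,l}$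 by $b_{1,k,0}=1$; for $k\ge1$ $$b_{1,k,1}=\tfrac{2(k+1)(k+\alpha+\beta+1)}{(2k+\alpha+\beta+1)(2k+\alpha+\beta+2)},\quad b_{2,k,1}=\tfrac{\beta^2-\alpha^2}{(2k+\alpha+\beta)(2k+\alpha+\beta+2)},\quad b_{3,k,1}=\tfrac{2(k+\alpha)(k+\beta)}{(2k+\alpha+\beta+1)(2k+\alpha+\beta)};$$ $b_{1,0,1}=\frac{2}{\alpha+\beta+2}$, $b_{2,0,1}=\frac{\beta-\alpha}{\alpha+\beta+2}$; and, for $l\ge2$ and $\max(k-l,0)\le m\le k+l$, $$b_{k+l+1-m,k,l}=\sum_{t=\max(0,m-1,k-l+1)}^{\min(m+1,k+l-1)}b_{k+l-t,k,l-1}\,b_{t-m+2,t,1}.$$ Consider the following system for numbers $\lambda_n^{(j)}$ and $a_m^{(j)}$ $(j,m\ge0)$: $\lambda_n^{(0)}=\Lambda_n$; $a_n^{(0)}\ne0$; $a_n^{(j+1)}=0$ for all $j\ge 0$; $a_m^{(j)}=0$ unless $\max(0,n-rj)\le m\le n+rj$; and, for all $j\ge0$, $$\lambda_n^{(j+1)}=\bigl(a_n^{(0)}\bigr)^{-1}\sum_{t=\max(0,n-r)}^{n+r}a_t^{(j)}\sum_{l=|n-t|}^{r}c_l\,b_{t+l+1-n,t,l}$$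 and, writing $$Q_m^{(j)}=\sum_{l=0}^{r}c_l\sum_{k=\max(0,n-rj,m-l)}^{\min(n+rj,m+l)}a_k^{(j)}\,b_{k+l+1-m,k,l},$$ $$a_m^{(j+1)}=-\frac{Q_m^{(j)}}{\Lambda_m-\Lambda_n}\quad\text{for } n+rj+1\le m\le n+r(j+1)\ \text{ and for }\ \max(0,n-r(j+1))\le m\le n-rj-1,$$ $$a_m^{(j+1)}=\frac{1}{\Lambda_m-\Lambda_n}\Bigl(\sum_{p=\lfloor(|m-n|+r-1)/r\rfloor}^{\min(j,n+rj)}\lambda_n^{(j+1-p)}a_m^{(p)}-Q_m^{(j)}\Bigr)\quad\text{for }\max(0,n-rj)\le m\le n+rj,\ m\ne n$$ (ranges with no integers are void; the last range is void when $r=0$). Then: 1. $x^lP_k^{(\alpha,\beta)}(x)=\sum_{m=\max(k-l,0)}^{k+l}b_{k+l+1-m,k,l}P_m^{(\alpha,\beta)}(x)$ for all $k,l\ge0$ and all real $x$. 2. For every real $a_0\neq0$ the system has exactly one solution with $a_n^{(0)}=a_0$. 3. For every solution of the system, the numbers $\lambda_n^{(j)}$ together with the functions $$u_n^{(j)}(x)=\sum_{k=\max(0,n-rj)}^{n+rj}a_k^{(j)}\,{}^{+}J_k^{(-\alpha,\beta)}(x),\qquad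 j\ge0,\qquad(\ast)$$ are FD-corrections of the $n$-th eigenpair. 4. If $\alpha\ge0$, or $\alpha\ge2s-1$, or $\beta\ge s-1$, then conversely for all FD-corrections $\lambda_n^{(j)},u_n^{(j)}$ of the $n$-th eigenpair there are numbers $a_m^{(j)}$ that, together with the $\lambda_n^{(j)}$, solve the system and satisfy $(\ast)$ for all $j\ge 0$ and all $x\in(-1,1)$. In particular $u_n^{(j+1)}$ is a linear combination of ${}^{+}J_k^{(-\alpha,\beta)}$ with $\max(0,n-r(j+1))\le k\le n+r(j+1)$ whose coefficient of index $n$ vanishes. -/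

import Mathlib

open MeasureTheory Set Filter Topology

namespace FDMethod

noncomputable section

/-- The Jacobi weight `ω^{(a,b)}(x) = (1 - x)^a (1 + x)^b`. -/
def jacobiWeight (a b x : ℝ) : ℝ := (1 - x) ^ a * (1 + x) ^ b

/-- The classical Jacobi polynomial
`P_n^{(α,β)}(x) = (1/n!) ∑_k C(n,k) (n+α+β+1)_k (α+k+1)_{n-k} ((x-1)/2)^k`,
where `(z)_k` is the rising factorial. -/
def jacobiP (α β : ℝ) (n : ℕ) (x : ℝ) : ℝ :=
  (1 / (n.factorial : ℝ)) * ∑ k ∈ Finset.range (n + 1),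
    (n.choose k : ℝ) * (ascPochhammer ℝ k).eval (n + α + β + 1) *
      (ascPochhammer ℝ (n - k)).eval (α + k + 1) * ((x - 1) / 2) ^ k

/-- The generalized Jacobi function `⁺J_n^{(-α,β)}(x) = (1 - x)^α P_n^{(α,β)}(x)`. -/
def jacobiJ (α β : ℝ) (n : ℕ) (x : ℝ) : ℝ := (1 - x) ^ α * jacobiP α β n x

/-- `x ↦ ∫_{-1}^x v(y) (x - y)^{-s} dy`. -/
def leftKernelIntegral (s : ℝ) (v : ℝ → ℝ) (x : ℝ) : ℝ :=
  ∫ y in (-1 : ℝ)..x, v y / (x - y) ^ s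

/-- `x ↦ ∫_x^1 v(y) (y - x)^{-s} dy`. -/
def rightKernelIntegral (s : ℝ) (v : ℝ → ℝ) (x : ℝ) : ℝ :=
  ∫ y in x..(1 : ℝ), v y / (y - x) ^ s

/-- The left-sided Riemann-Liouville derivative of order `s` on `(-1,1)`. -/
def leftRL (s : ℝ) (v : ℝ → ℝ) (x : ℝ) : ℝ :=
  1 / Real.Gamma (1 - s) * deriv (leftKernelIntegral s v) x

/-- The right-sided Riemann-Liouville derivative of order `s` on `(-1,1)`. -/
def rightRL (s : ℝ) (v : ℝ → ℝ) (x : ℝ) : ℝ :=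
  -(1 / Real.Gamma (1 - s)) * deriv (rightKernelIntegral s v) x

/-- The left-sided derivative of order `s` exists at every point of `(-1,1)`: the integrals
converge absolutely and depend differentiably on the endpoint. -/
def HasLeftRL (s : ℝ) (v : ℝ → ℝ) : Prop :=
  ∀ x ∈ Ioo (-1 : ℝ) 1,
    IntervalIntegrable (fun y => v y / (x - y) ^ s) volume (-1) x ∧
      DifferentiableAt ℝ (leftKernelIntegral s v) x

/-- The right-sided derivative of order `s` exists at every point of `(-1,1)`. -/
def HasRightRL (s : ℝ) (v : ℝ → ℝ) : Prop :=
  ∀ x ∈ Ioo (-1 : ℝ) 1,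
    IntervalIntegrable (fun y => v y / (y - x) ^ s) volume x 1 ∧
      DifferentiableAt ℝ (rightKernelIntegral s v) x

/-- The inner expression `ω^{(-α+s,β+s)} ₓD₁ˢ u` of the operator. -/
def flux (s α β : ℝ) (u : ℝ → ℝ) (x : ℝ) : ℝ :=
  jacobiWeight (-α + s) (β + s) x * rightRL s u x

/-- The fractional Jacobi-type operator
`⁺L u = ω^{(α,-β)} ₋₁Dₓˢ { ω^{(-α+s,β+s)} ₓD₁ˢ u }`. -/
def fracJacobiOp (s α β : ℝ) (u : ℝ → ℝ) (x : ℝ) : ℝ :=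
  jacobiWeight α (-β) x * leftRL s (flux s α β u) x

/-- `g` remains bounded along the filter `l` (used for one-sided boundary conditions). -/
def BoundedNear (l : Filter ℝ) (g : ℝ → ℝ) : Prop := ∃ M : ℝ, ∀ᶠ x in l, |g x| ≤ M

/-- `u` belongs to the real Hilbert space `L²((-1,1), ω^{(-α,β)} dx)`. -/
def MemWeightedL2 (α β : ℝ) (u : ℝ → ℝ) : Prop :=
  AEStronglyMeasurable u (volume.restrict (Ioo (-1) 1)) ∧
    IntegrableOn (fun x => u x ^ 2 * jacobiWeight (-α) β x) (Ioo (-1) 1)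

/-- The scalar product `∫_{-1}^1 f g ω^{(-α,β)} dx`. -/
def weightedInner (α β : ℝ) (f g : ℝ → ℝ) : ℝ :=
  ∫ x in (-1 : ℝ)..1, f x * g x * jacobiWeight (-α) β x

/-- `u` is a solution, in the weighted `L²` space, of the boundary value problem
`⁺L u - μ u = F` on `(-1,1)` with `|u(-1)| < ∞` and, at `x = 1`: `u(1) = 0` if `α > 0`,
`|u(1)| < ∞` if `α = 0`, and `|ω^{(-α+s,β+s)} ₓD₁ˢ u|` finite at `1` if `α < 0`.
All boundary values are one-sided, from inside the interval. -/
structure IsBVPSolution (s α β μ : ℝ) (F u : ℝ → ℝ) : Prop where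
  memL2 : MemWeightedL2 α β u
  hasRight : HasRightRL s u
  hasLeft : HasLeftRL s (flux s α β u)
  equation : ∀ x ∈ Ioo (-1 : ℝ) 1, fracJacobiOp s α β u x - μ * u x = F x
  bc_left : BoundedNear (𝓝[>] (-1)) u
  bc_right_pos : 0 < α → Tendsto u (𝓝[<] 1) (𝓝 0)
  bc_right_zero : α = 0 → BoundedNear (𝓝[<] 1) u
  bc_right_neg : α < 0 → BoundedNear (𝓝[<] 1) (flux s α β u)

/-- The `n`-th eigenvalue of the base problem,
`Γ(n+α+1) Γ(n+β+s+1) / (Γ(n+α-s+1) Γ(n+β+1))`. -/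
def baseEigenvalue (s α β : ℝ) (n : ℕ) : ℝ :=
  Real.Gamma (n + α + 1) * Real.Gamma (n + β + s + 1) /
    (Real.Gamma (n + α - s + 1) * Real.Gamma (n + β + 1))

/-- The polynomial potential `q(x) = ∑_{l=0}^r c_l x^l`. -/
def potential (r : ℕ) (c : ℕ → ℝ) (x : ℝ) : ℝ := ∑ l ∈ Finset.range (r + 1), c l * x ^ l

/-- The right-hand side
`F^{(j+1)} = ∑_{p=0}^j λ^{(j+1-p)} u^{(p)} - q u^{(j)}` of the `(j+1)`-st problem. -/
def fdRhs (r : ℕ) (c : ℕ → ℝ) (lam : ℕ → ℝ) (u : ℕ → ℝ → ℝ) (j : ℕ) (x : ℝ) : ℝ :=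
  ∑ p ∈ Finset.range (j + 1), lam (j + 1 - p) * u p x - potential r c x * u j x

/-- `(lam j, u j)`, `j = 0, 1, …`, are the FD-corrections to the `n`-th eigenpair:
`u 0` is a nontrivial solution of the base problem for the `n`-th base eigenvalue, and
each `u (j+1)` solves the `(j+1)`-st problem, whose right-hand side satisfies the solvability
condition (it is orthogonal to `u 0`; this fixes `lam (j+1)`), and is orthogonal to `u 0`. -/
structure IsFDSequence (s α β : ℝ) (r : ℕ) (c : ℕ → ℝ) (n : ℕ)
    (lam : ℕ → ℝ) (u : ℕ → ℝ → ℝ) : Prop where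
  lam_zero : lam 0 = baseEigenvalue s α β n
  base : IsBVPSolution s α β (lam 0) (fun _ => 0) (u 0)
  base_ne : ∃ x ∈ Ioo (-1 : ℝ) 1, u 0 x ≠ 0
  step : ∀ j, IsBVPSolution s α β (lam 0) (fdRhs r c lam u j) (u (j + 1))
  solvable : ∀ j, weightedInner α β (fdRhs r c lam u j) (u 0) = 0
  orthogonal : ∀ j, weightedInner α β (u 0) (u (j + 1)) = 0

/-- The coefficients `b_{i,n,1}`, `i = 1, 2, 3`, of the three-term relation
`x P_n = b_{1,n,1} P_{n+1} + b_{2,n,1} P_n + b_{3,n,1} P_{n-1}`.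
For `n = 0` the common factors of numerators and denominators, which may vanish, are
cancelled, and the term with `P_{-1}` is absent. -/
def jacobiB1 (α β : ℝ) (n i : ℕ) : ℝ :=
  if n = 0 then
    if i = 1 then 2 / (α + β + 2)
    else if i = 2 then (β - α) / (α + β + 2)
    else 0
  else
    if i = 1 then
      2 * (n + 1) * (n + α + β + 1) / ((2 * n + α + β + 1) * (2 * n + α + β + 2))
    else if i = 2 then
      (β ^ 2 - α ^ 2) / ((2 * n + α + β) * (2 * n + α + β + 2))
    else if i = 3 then
      2 * (n + α) * (n + β) / ((2 * n + α + β + 1) * (2 * n + α + β))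
    else 0

/-- The connection coefficient `b_{i,n,l}`; the arguments come in the order `l`, `n`, `i`.
Here `b_{n+l+1-k,n,l}` multiplies `P_k` in the expansion of `x^l P_n`, so `k = n+l+1-i`, and
`b_{n+l+1-k,n,l} = ∑_{t = max(0,k-1,n-l+1)}^{min(k+1,n+l-1)} b_{n+l-t,n,l-1} b_{t-k+2,t,1}`
for `l ≥ 2`. Truncated subtraction supplies the maximum with `0`. -/
def jacobiB (α β : ℝ) : ℕ → ℕ → ℕ → ℝ
  | 0, _, i => if i = 1 then 1 else 0
  | 1, n, i => jacobiB1 α β n i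
  | l + 2, n, i =>
      let k := n + (l + 2) + 1 - i
      ∑ t ∈ Finset.Icc (max (k - 1) (n - (l + 1))) (min (k + 1) (n + (l + 1))),
        jacobiB α β (l + 1) n (n + (l + 2) - t) * jacobiB1 α β t (t + 2 - k)

/-- The coefficient of `⁺J_m` in `q ∑_k a_k ⁺J_k`, where `a_k` is supported in
`n - rj ≤ k ≤ n + rj`:
`∑_{l=0}^r c_l ∑_{k = max(0,n-rj,m-l)}^{min(n+rj,m+l)} a_k b_{k+l+1-m,k,l}`. -/
def potentialCoeff (α β : ℝ) (r : ℕ) (c : ℕ → ℝ) (n j : ℕ) (a : ℕ → ℝ) (m : ℕ) : ℝ :=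
  ∑ l ∈ Finset.range (r + 1), c l *
    ∑ k ∈ Finset.Icc (max (n - r * j) (m - l)) (min (n + r * j) (m + l)),
      a k * jacobiB α β l k (k + l + 1 - m)

/-- The recursions for the eigenvalue corrections `lam j` and the coefficients
`a j k = a_k^{(j)}`; coefficients outside the range `n - rj ≤ k ≤ n + rj` are zero. -/
structure IsFDCoeff (s α β : ℝ) (r : ℕ) (c : ℕ → ℝ) (n : ℕ)
    (lam : ℕ → ℝ) (a : ℕ → ℕ → ℝ) : Prop where
  lam_zero : lam 0 = baseEigenvalue s α β n
  lam_succ : ∀ j, lam (j + 1) = (a 0 n)⁻¹ *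
    ∑ t ∈ Finset.Icc (n - r) (n + r), a j t *
      ∑ l ∈ Finset.Icc (max (n - t) (t - n)) r, c l * jacobiB α β l t (t + l + 1 - n)
  start_ne : a 0 n ≠ 0
  diag : ∀ j, a (j + 1) n = 0
  support : ∀ j m, m < n - r * j ∨ n + r * j < m → a j m = 0
  upper : ∀ j m, n + r * j + 1 ≤ m → m ≤ n + r * (j + 1) →
    a (j + 1) m = -(baseEigenvalue s α β m - baseEigenvalue s α β n)⁻¹ *
      potentialCoeff α β r c n j (a j) m
  middle : ∀ j m, n - r * j ≤ m → m ≤ n + r * j → m ≠ n →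
    a (j + 1) m = (baseEigenvalue s α β m - baseEigenvalue s α β n)⁻¹ *
      (∑ p ∈ Finset.Icc ((((m : ℤ) - n).natAbs + r - 1) / r) (min j (n + r * j)),
          lam (j + 1 - p) * a p m
        - potentialCoeff α β r c n j (a j) m)
  lower : ∀ j m, n - r * (j + 1) ≤ m → m + r * j + 1 ≤ n →
    a (j + 1) m = -(baseEigenvalue s α β m - baseEigenvalue s α β n)⁻¹ *
      potentialCoeff α β r c n j (a j) m

/-- The finite linear combination
`∑_{k = max(0,n-rj)}^{n+rj} a_k^{(j)} ⁺J_k^{(-α,β)}(x)`. -/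
def fdExpansion (α β : ℝ) (r n : ℕ) (a : ℕ → ℕ → ℝ) (j : ℕ) (x : ℝ) : ℝ :=
  ∑ k ∈ Finset.Icc (n - r * j) (n + r * j), a j k * jacobiJ α β k x

end

end FDMethod

open FDMethod

namespace FDMethod

section

/-! ### Beta integrals -/

/-! Fractional integration and differentiation shift the parameters of Jacobi functions and keep `a
+ b` fixed. The right derivative sends `⁺J_k` to a multiple of `(1-x)^(α-s) P_k^{(α-s,β+s)}`. The
inner weight turns this into `(1+x)^(β+s) P_k^{(α-s,β+s)}`, the left derivative gives `(1+x)^β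
P_k^{(α,β)}`, and the outer weight restores `⁺J_k`. The constants multiply to `Λ_k`
(`fracJacobiOp_jacobiJ`).

Multiplication by `q` moves the index of `⁺J_k` by at most `r`, so on finite expansions each
correction problem is a comparison of coefficients. For `m ≠ n` one divides by `Λ_m - Λ_n`, nonzero
because `Λ` is strictly increasing. The equation at `m = n` is the solvability condition and fixes
the next eigenvalue correction. This gives existence (`IsFDCoeff.isFDSequence`).

The converse rests on one fact: the homogeneous problem for `Λ_n` has only the multiples of `⁺J_n`
as solutions (`IsBVPSolution.exists_eq_const_mul_jacobiJ`). Abel inversion writes `u` and its flux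
as fractional integrals plus singular terms `c₁ (1-x)^(s-1)` and `c₀ (1+x)^(s-1)`, up to constant
factors. Two fractional integrations by parts, each an instance of Fubini on a triangle, then give
`Γ(1-s) (Λ_m - μ) ⟨u, ⁺J_m⟩ = A_m c₁ + ⁺J_m(-1) c₀`, which is `IsBVPSolution.moment_identity`. For
`μ = Λ_n` and `m = n` the left side is zero and both coefficients on the right are nonzero, so if
one of `c₀`, `c₁` vanishes, both do. Each of the three alternatives kills one of them. If `α ≥ 0`,
then `u` is bounded near `1` and `c₁ = 0`. If `α ≥ 2s-1`, a nonzero `c₁` is incompatible with the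
weighted `L²` condition. If `β ≥ s-1`, a nonzero `c₀` makes `u` grow logarithmically at `-1`. Then
`u` is orthogonal to every `⁺J_m` with `m ≠ n`, completeness of the polynomials gives `u = a ⁺J_n`
almost everywhere, and the equation with `Λ_n > 0` gives it everywhere.

Given arbitrary corrections, induction compares them with those of the recursion that has the same
initial coefficient. Solvability forces equal eigenvalue corrections. The functions then differ by a
multiple of `⁺J_n`, which orthogonality removes. -/

theorem beta_integral_zero {a b c : ℝ} (ha : 0 < a) (hb : 0 < b) (hc : 0 < c) :
    ∫ x in (0 : ℝ)..c, x ^ (a - 1) * (c - x) ^ (b - 1) =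
      ProbabilityTheory.beta a b * c ^ (a + b - 1) := by
  have h := Complex.betaIntegral_scaled (a : ℂ) (b : ℂ) hc
  have h2 : Complex.betaIntegral a b = ((ProbabilityTheory.beta a b : ℝ) : ℂ) := by
    rw [Complex.betaIntegral_eq_Gamma_mul_div _ _ (by simpa) (by simpa), ProbabilityTheory.beta,
      ← Complex.ofReal_add]
    simp only [Complex.Gamma_ofReal]
    norm_cast
  have h3 : (∫ x in (0 : ℝ)..c, (x : ℂ) ^ ((a : ℂ) - 1) * ((c : ℂ) - x) ^ ((b : ℂ) - 1)) =
      ((∫ x in (0 : ℝ)..c, x ^ (a - 1) * (c - x) ^ (b - 1) : ℝ) : ℂ) := by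
    rw [← intervalIntegral.integral_ofReal]
    refine intervalIntegral.integral_congr fun x hx => ?_
    rw [uIcc_of_le hc.le] at hx
    have e1 := Complex.ofReal_cpow hx.1 (a - 1)
    have e2 := Complex.ofReal_cpow (sub_nonneg.2 hx.2) (b - 1)
    push_cast at e1 e2 ⊢
    rw [e1, e2]
  have e3 := Complex.ofReal_cpow hc.le (a + b - 1)
  push_cast at e3
  rw [h3, h2, ← e3] at h
  rw [mul_comm]
  exact_mod_cast h

theorem beta_integral {a b y z : ℝ} (ha : 0 < a) (hb : 0 < b) (hyz : y < z) :
    ∫ x in y..z, (x - y) ^ (a - 1) * (z - x) ^ (b - 1) =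
      ProbabilityTheory.beta a b * (z - y) ^ (a + b - 1) := by
  rw [← beta_integral_zero ha hb (sub_pos.2 hyz)]
  have := intervalIntegral.integral_comp_sub_right (a := y) (b := z)
    (fun x => x ^ (a - 1) * (z - y - x) ^ (b - 1)) y
  rw [sub_self] at this
  rw [← this]
  simp

/-- A non-integrable function would have integral zero by convention, whereas the Beta value is
positive. -/
theorem beta_intervalIntegrable {a b y z : ℝ} (ha : 0 < a) (hb : 0 < b) (hyz : y < z) :
    IntervalIntegrable (fun x => (x - y) ^ (a - 1) * (z - x) ^ (b - 1)) volume y z := by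
  by_contra h
  have h1 := beta_integral ha hb hyz
  rw [intervalIntegral.integral_undef h] at h1
  have : 0 < ProbabilityTheory.beta a b * (z - y) ^ (a + b - 1) :=
    mul_pos (ProbabilityTheory.beta_pos ha hb) (Real.rpow_pos_of_pos (sub_pos.2 hyz) _)
  exact this.ne h1

/-! ### Fubini's theorem on the triangle `a < y < x < b` -/

/-- Joint integrability of `k x * f y / (x - y) ^ t` on the triangle `a < y < x < b`. -/
def TriangleIntegrable (a b t : ℝ) (f k : ℝ → ℝ) : Prop :=
  Integrable (fun p : ℝ × ℝ => {q : ℝ × ℝ | q.2 < q.1}.indicator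
    (fun q => k q.1 * f q.2 / (q.1 - q.2) ^ t) p)
    ((volume.restrict (Ioo a b)).prod (volume.restrict (Ioo a b)))

section Triangle

variable {a b t : ℝ} {f k : ℝ → ℝ}

theorem triangle_aestronglyMeasurable
    (hf : AEStronglyMeasurable f (volume.restrict (Ioo a b)))
    (hk : AEStronglyMeasurable k (volume.restrict (Ioo a b))) :
    AEStronglyMeasurable (fun p : ℝ × ℝ => {q : ℝ × ℝ | q.2 < q.1}.indicator
      (fun q => k q.1 * f q.2 / (q.1 - q.2) ^ t) p)
      ((volume.restrict (Ioo a b)).prod (volume.restrict (Ioo a b))) := by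
  refine AEStronglyMeasurable.indicator ?_ (measurableSet_lt measurable_snd measurable_fst)
  have h : Measurable fun q : ℝ × ℝ => ((q.1 - q.2) ^ t)⁻¹ :=
    ((measurable_fst.sub measurable_snd).pow_const t).inv
  simp only [div_eq_mul_inv]
  exact (hk.comp_fst.mul hf.comp_snd).mul h.aestronglyMeasurable

theorem setIntegral_triangle_fst {y : ℝ} (hy : y ∈ Ioo a b) (g : ℝ × ℝ → ℝ) :
    ∫ x in Ioo a b, {q : ℝ × ℝ | q.2 < q.1}.indicator g (x, y) =
      ∫ x in y..b, g (x, y) := by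
  have : (fun x => {q : ℝ × ℝ | q.2 < q.1}.indicator g (x, y)) =
      (Ioi y).indicator fun x => g (x, y) := by
    ext x; simp [indicator]
  rw [this, setIntegral_indicator measurableSet_Ioi, intervalIntegral.integral_of_le hy.2.le,
    integral_Ioc_eq_integral_Ioo]
  congr 2
  ext x; simp only [mem_inter_iff, mem_Ioo, mem_Ioi]
  exact ⟨fun h => ⟨h.2, h.1.2⟩, fun h => ⟨⟨hy.1.trans h.1, h.2⟩, h.1⟩⟩

theorem integrableOn_triangle_fst {y : ℝ} (hy : y ∈ Ioo a b) (g : ℝ × ℝ → ℝ) :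
    IntegrableOn (fun x => {q : ℝ × ℝ | q.2 < q.1}.indicator g (x, y)) (Ioo a b) ↔
      IntervalIntegrable (fun x => g (x, y)) volume y b := by
  have : (fun x => {q : ℝ × ℝ | q.2 < q.1}.indicator g (x, y)) =
      (Ioi y).indicator fun x => g (x, y) := by
    ext x; simp [indicator]
  rw [this, integrableOn_indicator_iff measurableSet_Ioi,
    intervalIntegrable_iff_integrableOn_Ioo_of_le hy.2.le]
  have : Ioi y ∩ Ioo a b = Ioo y b := by
    ext x; simp only [mem_inter_iff, mem_Ioo, mem_Ioi]
    exact ⟨fun h => ⟨h.1, h.2.2⟩, fun h => ⟨h.1, hy.1.trans h.1, h.2⟩⟩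
  rw [this]

theorem setIntegral_triangle_snd {x : ℝ} (hx : x ∈ Ioo a b) (g : ℝ × ℝ → ℝ) :
    ∫ y in Ioo a b, {q : ℝ × ℝ | q.2 < q.1}.indicator g (x, y) =
      ∫ y in a..x, g (x, y) := by
  have : (fun y => {q : ℝ × ℝ | q.2 < q.1}.indicator g (x, y)) =
      (Iio x).indicator fun y => g (x, y) := by
    ext x; simp [indicator]
  rw [this, setIntegral_indicator measurableSet_Iio, intervalIntegral.integral_of_le hx.1.le,
    integral_Ioc_eq_integral_Ioo]
  congr 2
  ext y; simp only [mem_inter_iff, mem_Ioo, mem_Iio]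
  exact ⟨fun h => ⟨h.1.1, h.2⟩, fun h => ⟨⟨h.1, h.2.trans hx.2⟩, h.2⟩⟩

theorem integrableOn_triangle_snd {x : ℝ} (hx : x ∈ Ioo a b) (g : ℝ × ℝ → ℝ) :
    IntegrableOn (fun y => {q : ℝ × ℝ | q.2 < q.1}.indicator g (x, y)) (Ioo a b) ↔
      IntervalIntegrable (fun y => g (x, y)) volume a x := by
  have : (fun y => {q : ℝ × ℝ | q.2 < q.1}.indicator g (x, y)) =
      (Iio x).indicator fun y => g (x, y) := by
    ext x; simp [indicator]
  rw [this, integrableOn_indicator_iff measurableSet_Iio,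
    intervalIntegrable_iff_integrableOn_Ioo_of_le hx.1.le]
  have : Iio x ∩ Ioo a b = Ioo a x := by
    ext y; simp only [mem_inter_iff, mem_Ioo, mem_Iio]
    exact ⟨fun h => ⟨h.2.1, h.1⟩, fun h => ⟨h.2, h.1, h.2.trans hx.2⟩⟩
  rw [this]

/-- Tonelli's criterion with the inner integration over `x`. It is the convenient one when `k` is an
explicit power, whose inner integral is a Beta value. -/
theorem triangleIntegrable_of_right
    (hf : AEStronglyMeasurable f (volume.restrict (Ioo a b)))
    (hk : AEStronglyMeasurable k (volume.restrict (Ioo a b)))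
    (h1 : ∀ y ∈ Ioo a b, IntervalIntegrable (fun x => k x / (x - y) ^ t) volume y b)
    (h2 : IntegrableOn (fun y => |f y| * ∫ x in y..b, |k x / (x - y) ^ t|) (Ioo a b)) :
    TriangleIntegrable a b t f k := by
  rw [TriangleIntegrable, integrable_prod_iff' (triangle_aestronglyMeasurable hf hk)]
  constructor
  · refine (ae_restrict_mem measurableSet_Ioo).mono fun y hy => ?_
    refine (integrableOn_triangle_fst hy _).2 (((h1 y hy).const_mul (f y)).congr ?_)
    exact fun x _ => by ring
  · refine h2.congr ((ae_restrict_mem measurableSet_Ioo).mono fun y hy => ?_)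
    simp only [norm_indicator_eq_indicator_norm]
    rw [setIntegral_triangle_fst hy (fun q => ‖k q.1 * f q.2 / (q.1 - q.2) ^ t‖),
      ← intervalIntegral.integral_const_mul]
    refine intervalIntegral.integral_congr fun x _ => ?_
    simp only [Real.norm_eq_abs, ← abs_mul]
    congr 1; ring

/-- The companion criterion for an explicit `f`, with the inner integration over `y`. -/
theorem triangleIntegrable_of_left
    (hf : AEStronglyMeasurable f (volume.restrict (Ioo a b)))
    (hk : AEStronglyMeasurable k (volume.restrict (Ioo a b)))
    (h1 : ∀ x ∈ Ioo a b, IntervalIntegrable (fun y => f y / (x - y) ^ t) volume a x)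
    (h2 : IntegrableOn (fun x => |k x| * ∫ y in a..x, |f y / (x - y) ^ t|) (Ioo a b)) :
    TriangleIntegrable a b t f k := by
  rw [TriangleIntegrable, integrable_prod_iff (triangle_aestronglyMeasurable hf hk)]
  constructor
  · refine (ae_restrict_mem measurableSet_Ioo).mono fun x hx => ?_
    refine (integrableOn_triangle_snd hx _).2 (((h1 x hx).const_mul (k x)).congr ?_)
    exact fun x _ => by ring
  · refine h2.congr ((ae_restrict_mem measurableSet_Ioo).mono fun x hx => ?_)
    simp only [norm_indicator_eq_indicator_norm]
    rw [setIntegral_triangle_snd hx (fun q => ‖k q.1 * f q.2 / (q.1 - q.2) ^ t‖),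
      ← intervalIntegral.integral_const_mul]
    refine intervalIntegral.integral_congr fun x _ => ?_
    simp only [Real.norm_eq_abs, ← abs_mul]
    congr 1; ring

namespace TriangleIntegrable

variable (h : TriangleIntegrable a b t f k)
include h

theorem integrableOn_left :
    IntegrableOn (fun x => k x * ∫ y in a..x, f y / (x - y) ^ t) (Ioo a b) := by
  refine (Integrable.integral_prod_left h).congr
    ((ae_restrict_mem measurableSet_Ioo).mono fun x hx => ?_)
  simp only
  rw [setIntegral_triangle_snd hx, ← intervalIntegral.integral_const_mul]
  exact intervalIntegral.integral_congr fun y _ => by simp only; ring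

theorem integrableOn_right :
    IntegrableOn (fun y => f y * ∫ x in y..b, k x / (x - y) ^ t) (Ioo a b) := by
  refine (Integrable.integral_prod_right h).congr
    ((ae_restrict_mem measurableSet_Ioo).mono fun y hy => ?_)
  simp only
  rw [setIntegral_triangle_fst hy, ← intervalIntegral.integral_const_mul]
  exact intervalIntegral.integral_congr fun x _ => by simp only; ring

/-- This is fractional integration by parts: the left fractional integral of `f`, paired with `k`,
becomes the right fractional integral of `k`, paired with `f`. -/
theorem integral_eq (hab : a ≤ b) :
    ∫ y in a..b, f y * ∫ x in y..b, k x / (x - y) ^ t =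
      ∫ x in a..b, k x * ∫ y in a..x, f y / (x - y) ^ t := by
  have e := integral_integral_swap
    (f := fun x y => {q : ℝ × ℝ | q.2 < q.1}.indicator
      (fun q => k q.1 * f q.2 / (q.1 - q.2) ^ t) (x, y)) h
  simp only [intervalIntegral.integral_of_le hab, integral_Ioc_eq_integral_Ioo]
  convert e.symm using 1
  · refine setIntegral_congr_fun measurableSet_Ioo fun y hy => ?_
    rw [setIntegral_triangle_fst hy, ← intervalIntegral.integral_const_mul]
    exact intervalIntegral.integral_congr fun x _ => by simp only; ring
  · refine setIntegral_congr_fun measurableSet_Ioo fun x hx => ?_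
    rw [setIntegral_triangle_snd hx, ← intervalIntegral.integral_const_mul]
    exact intervalIntegral.integral_congr fun y _ => by simp only; ring

end TriangleIntegrable

end Triangle

end

section

/-! ### Inversion of Abel integrals -/

/-- Lebesgue differentiation applies on each `(a, q)` with `q` rational. Integrability up to `b`
itself is not assumed, and the countably many exceptional null sets can be united. -/
theorem ae_eq_zero_of_primitive_eq_zero {a b : ℝ} {D : ℝ → ℝ}
    (hD : ∀ X ∈ Ioo a b, IntervalIntegrable D volume a X)
    (h0 : ∀ X ∈ Ioo a b, ∫ x in a..X, D x = 0) :
    ∀ᵐ x, x ∈ Ioo a b → D x = 0 := by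
  have h : ∀ᵐ x, ∀ q : ℚ, (q : ℝ) ∈ Ioo a b → x ∈ Ioo a (q : ℝ) → D x = 0 := by
    rw [ae_all_iff]
    intro q
    by_cases hq : (q : ℝ) ∈ Ioo a b
    swap
    · exact ae_of_all _ fun x h => absurd h hq
    filter_upwards [(hD q hq).ae_hasDerivAt_integral] with x hx _ hxq
    rw [uIcc_of_le hq.1.le] at hx
    have h1 := hx ⟨hxq.1.le, hxq.2.le⟩ a ⟨le_rfl, hq.1.le⟩
    have h2 : HasDerivAt (fun x => ∫ t in a..x, D t) 0 x := by
      refine (hasDerivAt_const x (0 : ℝ)).congr_of_eventuallyEq ?_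
      filter_upwards [Ioo_mem_nhds hxq.1 hxq.2] with y hy
      exact h0 y ⟨hy.1, hy.2.trans hq.2⟩
    exact h1.unique h2
  filter_upwards [h] with x hx hxab
  obtain ⟨q, hq1, hq2⟩ := exists_rat_btwn hxab.2
  exact hx q ⟨hxab.1.trans hq1, hq2⟩ ⟨hxab.1, hq1⟩

theorem integral_rpow_sub_right {p y z : ℝ} (hp : 0 < p) :
    ∫ x in y..z, (z - x) ^ (p - 1) = (z - y) ^ p / p := by
  rw [intervalIntegral.integral_comp_sub_left (fun x => x ^ (p - 1)) z, sub_self,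
    integral_rpow (Or.inl (by linarith))]
  simp [Real.zero_rpow hp.ne']

theorem integral_rpow_sub_left {p y z : ℝ} (hp : 0 < p) :
    ∫ x in y..z, (x - y) ^ (p - 1) = (z - y) ^ p / p := by
  rw [intervalIntegral.integral_comp_sub_right (fun x => x ^ (p - 1)) y, sub_self,
    integral_rpow (Or.inl (by linarith))]
  simp [Real.zero_rpow hp.ne']

theorem intervalIntegrable_rpow_sub_right {p y z : ℝ} (hp : 0 < p) :
    IntervalIntegrable (fun x => (z - x) ^ (p - 1)) volume y z := by
  have := (intervalIntegral.intervalIntegrable_rpow' (a := 0) (b := z - y) (r := p - 1)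
    (by linarith)).comp_sub_left z
  simpa using this.symm

theorem intervalIntegrable_rpow_sub_left {p y z : ℝ} (hp : 0 < p) :
    IntervalIntegrable (fun x => (x - y) ^ (p - 1)) volume y z := by
  have := (intervalIntegral.intervalIntegrable_rpow' (a := 0) (b := z - y) (r := p - 1)
    (by linarith)).comp_sub_right y
  simpa using this

theorem mul_rpow_eq_div {z p q : ℝ} (hz : 0 ≤ z) (v : ℝ) (h : q = -p) : v * z ^ q = v / z ^ p := by
  rw [h, Real.rpow_neg hz, div_eq_mul_inv]

/-- A function with an absolutely convergent Abel integral is integrable. -/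
theorem intervalIntegrable_of_div_rpow {t a x : ℝ} (ht : 0 ≤ t) (hax : a ≤ x) {v : ℝ → ℝ}
    (hv : IntervalIntegrable (fun y => v y / (x - y) ^ t) volume a x) :
    IntervalIntegrable v volume a x := by
  have h1 : Continuous fun y : ℝ => (x - y) ^ t :=
    (continuous_const.sub continuous_id).rpow_const fun _ => Or.inr ht
  have h2 := hv.mul_continuousOn h1.continuousOn
  rw [intervalIntegrable_iff_integrableOn_Ioo_of_le hax] at h2 ⊢
  refine h2.congr_fun (fun y hy => ?_) measurableSet_Ioo
  have : (x - y) ^ t ≠ 0 := (Real.rpow_pos_of_pos (sub_pos.2 hy.2) _).ne'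
  field_simp

/-- Abel's classical argument. Integrating the transform of `v` against `(X - x)^(t-1)` gives a Beta
constant times `∫ v`, by Fubini. Writing the transform as `c + ∫ κ` and integrating against the same
kernel gives the primitive of the right-hand side. Equality of primitives yields equality of the
integrands almost everywhere, which is all one can expect since `v` is merely integrable. -/
theorem abel_inversion {t : ℝ} (ht0 : 0 < t) (ht1 : t < 1) {v κ : ℝ → ℝ}
    (hv : ∀ x ∈ Ioo (-1 : ℝ) 1, IntervalIntegrable (fun y => v y / (x - y) ^ t) volume (-1) x)
    (hG : ∀ x ∈ Ioo (-1 : ℝ) 1, HasDerivAt (leftKernelIntegral t v) (κ x) x)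
    (hκ : ∀ x ∈ Ioo (-1 : ℝ) 1, IntervalIntegrable κ volume (-1) x) :
    ∃ c : ℝ, Tendsto (leftKernelIntegral t v) (𝓝[>] (-1)) (𝓝 c) ∧
      ∀ᵐ x, x ∈ Ioo (-1 : ℝ) 1 → ProbabilityTheory.beta t (1 - t) * v x =
        c * (1 + x) ^ (t - 1) + leftKernelIntegral (1 - t) κ x := by
  set G := leftKernelIntegral t v with hGdef
  set B := ProbabilityTheory.beta t (1 - t) with hB
  have hvi : ∀ x ∈ Ioo (-1 : ℝ) 1, IntervalIntegrable v volume (-1) x := fun x hx =>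
    intervalIntegrable_of_div_rpow ht0.le hx.1.le (hv x hx)
  have hzero : (0 : ℝ) ∈ Ioo (-1 : ℝ) 1 := by constructor <;> norm_num
  -- `G` is a primitive of `κ` starting from its limit at `-1`
  obtain ⟨c, hc⟩ : ∃ c, c = G 0 - ∫ y in (-1 : ℝ)..0, κ y := ⟨_, rfl⟩
  have hGeq : ∀ x ∈ Ioo (-1 : ℝ) 1, G x = c + ∫ y in (-1 : ℝ)..x, κ y := by
    intro x hx
    have h1 : IntervalIntegrable κ volume 0 x := (hκ 0 hzero).symm.trans (hκ x hx)
    have h2 := intervalIntegral.integral_eq_sub_of_hasDerivAt (f := G) (f' := κ) (a := 0) (b := x)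
      (fun y hy => hG y ((ordConnected_Ioo.uIcc_subset hzero hx) hy)) h1
    have h3 := intervalIntegral.integral_add_adjacent_intervals (hκ 0 hzero) h1
    rw [hc]; linarith
  have hlim : Tendsto G (𝓝[>] (-1)) (𝓝 c) := by
    have h1 : ContinuousOn (fun x => ∫ y in (-1 : ℝ)..x, κ y) (Icc (-1) 0) :=
      intervalIntegral.continuousOn_primitive_interval' (hκ 0 hzero)
        (left_mem_uIcc) |>.mono (by rw [uIcc_of_le (by norm_num)])
    have h2 : Tendsto (fun x => ∫ y in (-1 : ℝ)..x, κ y) (𝓝[>] (-1)) (𝓝 0) := by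
      have := h1 (-1) (by constructor <;> norm_num)
      rw [ContinuousWithinAt, intervalIntegral.integral_same] at this
      refine this.mono_left ?_
      rw [← nhdsWithin_Ioo_eq_nhdsGT (show (-1 : ℝ) < 0 by norm_num)]
      exact nhdsWithin_mono _ Ioo_subset_Icc_self
    have h3 := h2.const_add c
    rw [add_zero] at h3
    refine h3.congr' ?_
    rw [← nhdsWithin_Ioo_eq_nhdsGT (show (-1 : ℝ) < 1 by norm_num)]
    filter_upwards [self_mem_nhdsWithin] with x hx using (hGeq x hx).symm
  refine ⟨c, hlim, ?_⟩
  -- It suffices that the difference of the two sides has vanishing primitive.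
  have key : ∀ X ∈ Ioo (-1 : ℝ) 1,
      IntervalIntegrable (fun x => B * v x -
        (c * (1 + x) ^ (t - 1) + leftKernelIntegral (1 - t) κ x)) volume (-1) X ∧
      ∫ x in (-1 : ℝ)..X, (B * v x -
        (c * (1 + x) ^ (t - 1) + leftKernelIntegral (1 - t) κ x)) = 0 := by
    intro X hX
    have hsub : ∀ y ∈ Ioo (-1) X, y ∈ Ioo (-1 : ℝ) 1 := fun y hy => ⟨hy.1, hy.2.trans hX.2⟩
    have mv : AEStronglyMeasurable v (volume.restrict (Ioo (-1) X)) :=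
      ((intervalIntegrable_iff_integrableOn_Ioo_of_le hX.1.le).1 (hvi X hX)).aestronglyMeasurable
    have iκ := (intervalIntegrable_iff_integrableOn_Ioo_of_le hX.1.le).1 (hκ X hX)
    have mκ : AEStronglyMeasurable κ (volume.restrict (Ioo (-1) X)) := iκ.aestronglyMeasurable
    have mp : AEStronglyMeasurable (fun x => (X - x) ^ (t - 1))
        (volume.restrict (Ioo (-1) X)) :=
      ((measurable_const.sub measurable_id).pow_const (t - 1)).aestronglyMeasurable
    have hbeta : ∀ y ∈ Ioo (-1) X, ∫ x in y..X, (X - x) ^ (t - 1) / (x - y) ^ t = B := by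
      intro y hy
      have := beta_integral (a := 1 - t) (b := t) (by linarith) ht0 hy.2
      rw [show 1 - t + t - 1 = 0 by ring, Real.rpow_zero, mul_one, ProbabilityTheory.beta,
        mul_comm, add_comm, ← ProbabilityTheory.beta] at this
      rw [hB, ← this]
      refine intervalIntegral.integral_congr fun x hx => ?_
      rw [uIcc_of_le hy.2.le] at hx
      rw [mul_comm, mul_rpow_eq_div (sub_nonneg.2 hx.1) _ (show 1 - t - 1 = -t by ring)]
    have hbeta_int : ∀ y ∈ Ioo (-1) X,
        IntervalIntegrable (fun x => (X - x) ^ (t - 1) / (x - y) ^ t) volume y X := by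
      intro y hy
      have := beta_intervalIntegrable (a := 1 - t) (b := t) (by linarith) ht0 hy.2
      refine this.congr fun x hx => ?_
      rw [uIoc_of_le hy.2.le] at hx
      rw [mul_comm, mul_rpow_eq_div (sub_nonneg.2 hx.1.le) _ (show 1 - t - 1 = -t by ring)]
    -- The inner integral over `x` is the constant `B`, independent of `y` and `X`; this is why the
    -- exponents `t - 1` and `-t` are paired.
    have T1 : TriangleIntegrable (-1) X t v (fun x => (X - x) ^ (t - 1)) := by
      refine triangleIntegrable_of_right mv mp hbeta_int ?_
      have : IntegrableOn (fun y => |v y| * B) (Ioo (-1) X) :=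
        ((intervalIntegrable_iff_integrableOn_Ioo_of_le hX.1.le).1 (hvi X hX)).abs.mul_const B
      refine this.congr_fun (fun y hy => ?_) measurableSet_Ioo
      simp only
      rw [← hbeta y hy]
      congr 1
      refine intervalIntegral.integral_congr fun x hx => ?_
      rw [uIcc_of_le hy.2.le] at hx
      exact (abs_of_nonneg (div_nonneg (Real.rpow_nonneg (sub_nonneg.2 hx.2) _)
        (Real.rpow_nonneg (sub_nonneg.2 hx.1) _))).symm
    -- Exponent `0` makes the kernel trivial, so this triangle encodes the iterated integral of the
    -- primitive of `κ`.
    have T2 : TriangleIntegrable (-1) X 0 κ (fun x => (X - x) ^ (t - 1)) := by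
      refine triangleIntegrable_of_right mκ mp (fun y hy => ?_) ?_
      · simpa using intervalIntegrable_rpow_sub_right ht0
      · have hcont : ContinuousOn (fun y => (X - y) ^ t / t) (uIcc (-1) X) :=
          (((continuous_const.sub continuous_id).rpow_const fun _ => Or.inr ht0.le).div_const
            t).continuousOn
        have := (hκ X hX).abs.mul_continuousOn hcont
        rw [intervalIntegrable_iff_integrableOn_Ioo_of_le hX.1.le] at this
        refine this.congr_fun (fun y hy => ?_) measurableSet_Ioo
        simp only
        rw [← integral_rpow_sub_right ht0]
        congr 1
        refine intervalIntegral.integral_congr fun x hx => ?_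
        rw [uIcc_of_le hy.2.le] at hx
        simp [abs_of_nonneg (Real.rpow_nonneg (sub_nonneg.2 hx.2) _)]
    have hone : ∀ y ∈ Ioo (-1) X, ∫ x in y..X, 1 / (x - y) ^ (1 - t) = (X - y) ^ t / t := by
      intro y hy
      rw [← integral_rpow_sub_left ht0]
      refine intervalIntegral.integral_congr fun x hx => ?_
      rw [uIcc_of_le hy.2.le] at hx
      rw [← mul_rpow_eq_div (sub_nonneg.2 hx.1) 1 (show t - 1 = -(1 - t) by ring), one_mul]
    have T3 : TriangleIntegrable (-1) X (1 - t) κ (fun _ => 1) := by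
      refine triangleIntegrable_of_right mκ aestronglyMeasurable_const (fun y hy => ?_) ?_
      · refine (intervalIntegrable_rpow_sub_left ht0).congr fun x hx => ?_
        rw [uIoc_of_le hy.2.le] at hx
        rw [← mul_rpow_eq_div (sub_nonneg.2 hx.1.le) 1 (show t - 1 = -(1 - t) by ring), one_mul]
      · have hcont : ContinuousOn (fun y => (X - y) ^ t / t) (uIcc (-1) X) :=
          (((continuous_const.sub continuous_id).rpow_const fun _ => Or.inr ht0.le).div_const
            t).continuousOn
        have := (hκ X hX).abs.mul_continuousOn hcont
        rw [intervalIntegrable_iff_integrableOn_Ioo_of_le hX.1.le] at this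
        refine this.congr_fun (fun y hy => ?_) measurableSet_Ioo
        simp only
        rw [← hone y hy]
        congr 1
        refine intervalIntegral.integral_congr fun x hx => ?_
        rw [uIcc_of_le hy.2.le] at hx
        exact (abs_of_nonneg (div_nonneg zero_le_one
          (Real.rpow_nonneg (sub_nonneg.2 hx.1) _))).symm
    have I3 : IntervalIntegrable (fun x => leftKernelIntegral (1 - t) κ x) volume (-1) X := by
      rw [intervalIntegrable_iff_integrableOn_Ioo_of_le hX.1.le]
      refine T3.integrableOn_left.congr_fun (fun x _ => ?_) measurableSet_Ioo
      simp [leftKernelIntegral]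
    have I4 : IntervalIntegrable (fun x => c * (1 + x) ^ (t - 1)) volume (-1) X := by
      have := (intervalIntegrable_rpow_sub_left (y := -1) (z := X) ht0).const_mul c
      simpa [add_comm] using this
    have e1 := T1.integral_eq hX.1.le
    have e2 := T2.integral_eq hX.1.le
    have e3 := T3.integral_eq hX.1.le
    have f1 : ∫ y in (-1 : ℝ)..X, v y * ∫ x in y..X, (X - x) ^ (t - 1) / (x - y) ^ t =
        B * ∫ y in (-1 : ℝ)..X, v y := by
      rw [← intervalIntegral.integral_const_mul]
      refine intervalIntegral.integral_congr_Ioo_of_le hX.1.le fun y hy => ?_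
      rw [hbeta y hy, mul_comm]
    -- Both inner integrals equal `(X - y)^t / t`.
    have f23 : ∫ y in (-1 : ℝ)..X, κ y * ∫ x in y..X, (X - x) ^ (t - 1) / (x - y) ^ (0 : ℝ) =
        ∫ y in (-1 : ℝ)..X, κ y * ∫ x in y..X, 1 / (x - y) ^ (1 - t) := by
      refine intervalIntegral.integral_congr_Ioo_of_le hX.1.le fun y hy => ?_
      rw [hone y hy, ← integral_rpow_sub_right ht0]
      simp
    have f4 : ∫ x in (-1 : ℝ)..X, (X - x) ^ (t - 1) * ∫ y in (-1 : ℝ)..x, v y / (x - y) ^ t =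
        c * (∫ x in (-1 : ℝ)..X, (X - x) ^ (t - 1)) +
        ∫ x in (-1 : ℝ)..X, (X - x) ^ (t - 1) * ∫ y in (-1 : ℝ)..x, κ y / (x - y) ^ (0 : ℝ) := by
      rw [← intervalIntegral.integral_const_mul, ← intervalIntegral.integral_add]
      · refine intervalIntegral.integral_congr_Ioo_of_le hX.1.le fun x hx => ?_
        have := hGeq x (hsub x hx)
        rw [hGdef, leftKernelIntegral] at this
        simp only [this, Real.rpow_zero, div_one]
        ring
      · exact (intervalIntegrable_rpow_sub_right ht0).const_mul c
      · exact (intervalIntegrable_iff_integrableOn_Ioo_of_le hX.1.le).2 T2.integrableOn_left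
    have f5 : ∫ x in (-1 : ℝ)..X, c * (1 + x) ^ (t - 1) =
        c * ∫ x in (-1 : ℝ)..X, (X - x) ^ (t - 1) := by
      rw [intervalIntegral.integral_const_mul, integral_rpow_sub_right ht0,
        ← integral_rpow_sub_left ht0]
      simp [add_comm]
    refine ⟨((hvi X hX).const_mul B).sub (I4.add I3), ?_⟩
    rw [intervalIntegral.integral_sub ((hvi X hX).const_mul B) (I4.add I3),
      intervalIntegral.integral_add I4 I3, intervalIntegral.integral_const_mul, ← f1, e1, f4, f5,
      ← e2, f23, e3]
    simp [leftKernelIntegral]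
  filter_upwards [ae_eq_zero_of_primitive_eq_zero (fun X hX => (key X hX).1)
    (fun X hX => (key X hX).2)] with x hx hxm
  linarith [hx hxm]

/-! ### Reflection -/

theorem leftKernelIntegral_comp_neg (t : ℝ) (v : ℝ → ℝ) (x : ℝ) :
    leftKernelIntegral t (fun y => v (-y)) x = rightKernelIntegral t v (-x) := by
  rw [leftKernelIntegral, rightKernelIntegral]
  have := intervalIntegral.integral_comp_neg (a := -1) (b := x) (fun y => v y / (y - -x) ^ t)
  rw [neg_neg] at this
  rw [← this]
  refine intervalIntegral.integral_congr fun y _ => ?_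
  congr 2
  ring

theorem neg_mem_Ioo_neg_one_one {x : ℝ} : -x ∈ Ioo (-1 : ℝ) 1 ↔ x ∈ Ioo (-1 : ℝ) 1 := by
  constructor <;> rintro ⟨h1, h2⟩ <;> constructor <;> linarith

theorem intervalIntegrable_comp_neg {f : ℝ → ℝ} {a b : ℝ} :
    IntervalIntegrable (fun x => f (-x)) volume (-a) (-b) ↔ IntervalIntegrable f volume a b := by
  have := IntervalIntegrable.iff_comp_neg (a := a) (b := b) (f := f)
    (by simp [enorm_eq_nnnorm])
  exact this.symm

theorem intervalIntegrable_div_rpow_neg {t : ℝ} {v : ℝ → ℝ} {x : ℝ} :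
    IntervalIntegrable (fun y => v (-y) / (-x - y) ^ t) volume (-1) (-x) ↔
      IntervalIntegrable (fun y => v y / (y - x) ^ t) volume x 1 := by
  have e : (fun y => v (-y) / (-x - y) ^ t) = fun y => (fun z => v z / (z - x) ^ t) (-y) := by
    ext y
    simp only
    congr 2; ring
  rw [e]
  have := intervalIntegrable_comp_neg (f := fun z => v z / (z - x) ^ t) (a := 1) (b := x)
  exact this.trans ⟨fun h => h.symm, fun h => h.symm⟩

theorem ae_comp_neg {p : ℝ → Prop} (h : ∀ᵐ x, p x) : ∀ᵐ x, p (-x) :=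
  (Measure.measurePreserving_neg (volume : Measure ℝ)).quasiMeasurePreserving.ae h

/-- The reflection `x ↦ -x` reduces this to `abel_inversion`. It reverses the sign of derivatives,
whence `-κ x` in the hypothesis. -/
theorem abel_inversion_right {t : ℝ} (ht0 : 0 < t) (ht1 : t < 1) {v κ : ℝ → ℝ}
    (hv : ∀ x ∈ Ioo (-1 : ℝ) 1, IntervalIntegrable (fun y => v y / (y - x) ^ t) volume x 1)
    (hG : ∀ x ∈ Ioo (-1 : ℝ) 1, HasDerivAt (rightKernelIntegral t v) (-κ x) x)
    (hκ : ∀ x ∈ Ioo (-1 : ℝ) 1, IntervalIntegrable κ volume x 1) :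
    ∃ c : ℝ, Tendsto (rightKernelIntegral t v) (𝓝[<] 1) (𝓝 c) ∧
      ∀ᵐ x, x ∈ Ioo (-1 : ℝ) 1 → ProbabilityTheory.beta t (1 - t) * v x =
        c * (1 - x) ^ (t - 1) + rightKernelIntegral (1 - t) κ x := by
  have hv' : ∀ x ∈ Ioo (-1 : ℝ) 1,
      IntervalIntegrable (fun y => v (-y) / (x - y) ^ t) volume (-1) x := fun x hx => by
    have := intervalIntegrable_div_rpow_neg.2 (hv (-x) (neg_mem_Ioo_neg_one_one.2 hx))
    simpa using this
  have hG' : ∀ x ∈ Ioo (-1 : ℝ) 1,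
      HasDerivAt (leftKernelIntegral t fun y => v (-y)) (κ (-x)) x := fun x hx => by
    have h1 := hG (-x) (neg_mem_Ioo_neg_one_one.2 hx)
    have h2 := h1.comp x (hasDerivAt_neg x)
    simp only [mul_neg, mul_one, neg_neg] at h2
    refine h2.congr_of_eventuallyEq (Eventually.of_forall fun y => ?_)
    simp [leftKernelIntegral_comp_neg]
  have hκ' : ∀ x ∈ Ioo (-1 : ℝ) 1, IntervalIntegrable (fun y => κ (-y)) volume (-1) x :=
    fun x hx => by
    have := intervalIntegrable_comp_neg.2 (hκ (-x) (neg_mem_Ioo_neg_one_one.2 hx))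
    simpa using this.symm
  obtain ⟨c, hc, h⟩ := abel_inversion ht0 ht1 hv' hG' hκ'
  refine ⟨c, ?_, ?_⟩
  · have h1 : Tendsto (fun x : ℝ => -x) (𝓝[<] 1) (𝓝[>] (-1)) := tendsto_neg_nhdsLT
    refine (hc.comp h1).congr fun x => ?_
    simp [leftKernelIntegral_comp_neg]
  · filter_upwards [ae_comp_neg h] with x hx hxm
    have := hx (neg_mem_Ioo_neg_one_one.2 hxm)
    have e := leftKernelIntegral_comp_neg (1 - t) κ (-x)
    rw [neg_neg] at e this
    rw [e] at this
    simpa [sub_eq_add_neg] using this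

end

section

/-! ### Jacobi polynomials -/

/-- The coefficient of `((x - 1) / 2) ^ k` in `P_n^{(a,b)}`. -/
noncomputable def jacobiCoeff (a b : ℝ) (n k : ℕ) : ℝ :=
  if k ≤ n then (ascPochhammer ℝ k).eval (n + a + b + 1) *
    (ascPochhammer ℝ (n - k)).eval (a + k + 1) / (k.factorial * (n - k).factorial) else 0

theorem jacobiP_eq_sum (a b : ℝ) (n : ℕ) (x : ℝ) :
    jacobiP a b n x = ∑ k ∈ Finset.range (n + 1), jacobiCoeff a b n k * ((x - 1) / 2) ^ k := by
  rw [jacobiP, Finset.mul_sum]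
  refine Finset.sum_congr rfl fun k hk => ?_
  have hk' : k ≤ n := Nat.lt_succ_iff.1 (Finset.mem_range.1 hk)
  rw [jacobiCoeff, if_pos hk', Nat.cast_choose ℝ hk']
  have := n.factorial_ne_zero
  field_simp

/-- Coefficients beyond the degree are zero, so polynomials of different degrees can be compared
over one common range. -/
theorem jacobiP_eq_sum_of_lt (a b : ℝ) {n N : ℕ} (h : n < N) (x : ℝ) :
    jacobiP a b n x = ∑ k ∈ Finset.range N, jacobiCoeff a b n k * ((x - 1) / 2) ^ k := by
  rw [jacobiP_eq_sum]
  refine Finset.sum_subset (Finset.range_subset_range.2 h) fun k _ hk => ?_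
  rw [jacobiCoeff, if_neg (by simpa using hk), zero_mul]

theorem jacobiP_zero (a b x : ℝ) : jacobiP a b 0 x = 1 := by
  simp [jacobiP]

theorem jacobiP_one (a b x : ℝ) : jacobiP a b 1 x = a + 1 + (a + b + 2) * ((x - 1) / 2) := by
  simp [jacobiP, Finset.sum_range_succ, Polynomial.eval_X]
  left; ring

theorem continuous_jacobiP (a b : ℝ) (n : ℕ) : Continuous (jacobiP a b n) := by
  unfold jacobiP; fun_prop

theorem ascPochhammer_eval_succ_left (z : ℝ) (k : ℕ) :
    (ascPochhammer ℝ (k + 1)).eval z = z * (ascPochhammer ℝ k).eval (z + 1) := by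
  rw [ascPochhammer_succ_left]; simp [Polynomial.eval_comp]

theorem ascPochhammer_eval_pos {z : ℝ} (hz : 0 < z) (k : ℕ) :
    0 < (ascPochhammer ℝ k).eval z := ascPochhammer_pos k z hz

/-- With `D` in place of `b` the denominators become products of `D`, `D + 1` and `D + 2`, which are
positive when `a + b > -2`. -/
theorem jacobiB1_succ {a b D : ℝ} (n : ℕ) (hD : D = 2 * (n + 1) + a + b) :
    jacobiB1 a b (n + 1) 1 =
      2 * (n + 2) * (D - (n + 1) + 1) / ((D + 1) * (D + 2)) ∧
    jacobiB1 a b (n + 1) 2 =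
      (D - 2 * (n + 1) - 2 * a) * (D - 2 * (n + 1)) / (D * (D + 2)) ∧
    jacobiB1 a b (n + 1) 3 =
      2 * (n + 1 + a) * (D - (n + 1) - a) / ((D + 1) * D) := by
  subst hD
  refine ⟨?_, ?_, ?_⟩ <;> simp only [jacobiB1, Nat.add_eq_zero_iff, one_ne_zero, and_false,
    if_false, if_true, OfNat.ofNat_ne_one, Nat.reduceEqDiff] <;>
    push_cast <;> congr 1 <;> ring

/-- Comparison of coefficients in the three-term recurrence. -/
theorem jacobiCoeff_recurrence {a b : ℝ} (hab : -2 < a + b) (n k : ℕ) :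
    jacobiCoeff a b (n + 1) k + 2 * (if k = 0 then 0 else jacobiCoeff a b (n + 1) (k - 1)) =
      jacobiB1 a b (n + 1) 1 * jacobiCoeff a b (n + 2) k +
      jacobiB1 a b (n + 1) 2 * jacobiCoeff a b (n + 1) k +
      jacobiB1 a b (n + 1) 3 * jacobiCoeff a b n k := by
  have hn : (0 : ℝ) ≤ n := n.cast_nonneg
  obtain ⟨D, hD⟩ : ∃ D, D = 2 * ((n : ℝ) + 1) + a + b := ⟨_, rfl⟩
  have h0 : D ≠ 0 := (by linarith : 0 < D).ne'
  have h1 : D + 1 ≠ 0 := (by linarith : 0 < D + 1).ne'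
  have h2 : D + 2 ≠ 0 := (by linarith : 0 < D + 2).ne'
  obtain ⟨e1, e2, e3⟩ := jacobiB1_succ n hD
  rw [e1, e2, e3]
  have hb : b = D - 2 * (n + 1) - a := by linarith
  clear e1 e2 e3
  rcases Nat.eq_zero_or_pos k with rfl | hk
  · have f := n.factorial_ne_zero
    have g1 : (ascPochhammer ℝ (n + 1)).eval (a + 1) =
      (ascPochhammer ℝ n).eval (a + 1) * (a + 1 + n) := ascPochhammer_succ_eval n _
    have g2 : (ascPochhammer ℝ (n + 2)).eval (a + 1) =
      (ascPochhammer ℝ n).eval (a + 1) * (a + 1 + n) * (a + 1 + (n + 1)) := by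
      rw [ascPochhammer_succ_eval, g1]; push_cast; ring
    simp only [jacobiCoeff, zero_le, if_true, ascPochhammer_zero, Polynomial.eval_one, Nat.sub_zero,
      Nat.cast_zero, add_zero, g1, g2, Nat.factorial_succ, Nat.factorial_zero]
    push_cast
    field_simp
    subst hb
    ring
  obtain ⟨j, rfl⟩ : ∃ j, k = j + 1 := ⟨k - 1, by omega⟩
  clear hk
  have jf := j.factorial_ne_zero
  have hj : (0 : ℝ) ≤ j := j.cast_nonneg
  simp only [Nat.add_eq_zero_iff, one_ne_zero, and_false, if_false, Nat.add_sub_cancel]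
  -- For `j < n` all terms are present. For `j = n` the contribution of `P_n` drops out, for `j = n
  -- + 1` only the leading coefficients remain, and beyond that everything is zero.
  rcases lt_trichotomy j n with hjn | hjn | hjn
  · obtain ⟨d, rfl⟩ : ∃ d, n = j + 1 + d := ⟨n - (j + 1), by omega⟩
    have df := d.factorial_ne_zero
    have hd : (0 : ℝ) ≤ d := d.cast_nonneg
    simp only [jacobiCoeff, show j + 1 ≤ j + 1 + d + 2 by omega, show j + 1 ≤ j + 1 + d + 1 by omega,
      show j ≤ j + 1 + d + 1 by omega, show j + 1 ≤ j + 1 + d by omega, if_true,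
      show j + 1 + d + 2 - (j + 1) = d + 2 by omega, show j + 1 + d + 1 - (j + 1) = d + 1 by omega,
      show j + 1 + d - (j + 1) = d by omega, show j + 1 + d + 1 - j = d + 2 by omega]
    push_cast at hb ⊢
    -- The shift relations reduce all rising factorials to one in `a + b` and one in `a`. Here the
    -- extra factor on the left is the one in the numerator of `b_1`, so nothing has to be divided
    -- out.
    have X1 : (ascPochhammer ℝ (j + 1)).eval ((j : ℝ) + 1 + d + 2 + a + b + 1) *
        (D - (j + 1 + d + 1) + 1) = (ascPochhammer ℝ j).eval ((j : ℝ) + 1 + d + 1 + a + b + 1) *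
          (D - (j + 1 + d + 1) + j + 1) * (D - (j + 1 + d + 1) + j + 2) := by
      have := ascPochhammer_eval_succ_left ((j : ℝ) + 1 + d + 1 + a + b + 1) (j + 1)
      rw [ascPochhammer_succ_eval, ascPochhammer_succ_eval] at this
      rw [show (j : ℝ) + 1 + d + 2 + a + b + 1 = (j : ℝ) + 1 + d + 1 + a + b + 1 + 1 by ring]
      rw [show D - ((j : ℝ) + 1 + d + 1) + 1 = (j : ℝ) + 1 + d + 1 + a + b + 1 by rw [hb]; ring,
        mul_comm, ← this, hb]
      push_cast; ring
    have X2 : (ascPochhammer ℝ (j + 1)).eval ((j : ℝ) + 1 + d + 1 + a + b + 1) =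
        (ascPochhammer ℝ j).eval ((j : ℝ) + 1 + d + 1 + a + b + 1) *
          (D - (j + 1 + d + 1) + j + 1) := by
      rw [ascPochhammer_succ_eval, hb]; ring
    have X3 : (ascPochhammer ℝ (j + 1)).eval ((j : ℝ) + 1 + d + a + b + 1) =
        (D - (j + 1 + d + 1)) * (ascPochhammer ℝ j).eval ((j : ℝ) + 1 + d + 1 + a + b + 1) := by
      rw [ascPochhammer_eval_succ_left,
        show (j : ℝ) + 1 + d + a + b + 1 + 1 = (j : ℝ) + 1 + d + 1 + a + b + 1 by ring, hb]; ring
    have Y1 : (ascPochhammer ℝ (d + 1)).eval (a + (j + 1) + 1) =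
        (ascPochhammer ℝ d).eval (a + (j + 1) + 1) * (a + j + 2 + d) := by
      rw [ascPochhammer_succ_eval]; ring
    have Y2 : (ascPochhammer ℝ (d + 2)).eval (a + (j + 1) + 1) =
        (ascPochhammer ℝ d).eval (a + (j + 1) + 1) * (a + j + 2 + d) * (a + j + 3 + d) := by
      rw [ascPochhammer_succ_eval, Y1]; push_cast; ring
    have Y3 : (ascPochhammer ℝ (d + 2)).eval (a + j + 1) =
        (a + j + 1) * ((ascPochhammer ℝ d).eval (a + (j + 1) + 1) * (a + j + 2 + d)) := by
      rw [ascPochhammer_eval_succ_left, ← Y1]; ring_nf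
    rw [X2, X3, Y1, Y2, Y3]
    generalize (ascPochhammer ℝ (j + 1)).eval ((j : ℝ) + 1 + d + 2 + a + b + 1) = Z at X1 ⊢
    generalize (ascPochhammer ℝ j).eval ((j : ℝ) + 1 + d + 1 + a + b + 1) = X at X1 ⊢
    generalize (ascPochhammer ℝ d).eval (a + (j + 1) + 1) = Y at *
    simp only [Nat.factorial_succ]
    push_cast
    have e : ∀ W M : ℝ, 2 * ((j : ℝ) + 1 + d + 2) * (D - (j + 1 + d + 1) + 1) /
        ((D + 1) * (D + 2)) * (Z * W / M) = 2 * ((j : ℝ) + 1 + d + 2) /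
        ((D + 1) * (D + 2)) * ((Z * (D - (j + 1 + d + 1) + 1)) * W / M) := fun W M => by ring
    rw [e, X1]
    clear e X1 X2 X3 Y1 Y2 Y3
    field_simp
    subst hb
    ring
  · subst hjn
    simp only [jacobiCoeff, show j + 1 ≤ j + 2 by omega, le_refl, if_true,
      show j ≤ j + 1 by omega, show ¬ (j + 1 ≤ j) by omega, if_false,
      show j + 2 - (j + 1) = 1 by omega, Nat.sub_self, show j + 1 - j = 1 by omega]
    push_cast at hb ⊢
    have X1 : (ascPochhammer ℝ (j + 1)).eval ((j : ℝ) + 2 + a + b + 1) *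
        (D - (j + 1) + 1) = (ascPochhammer ℝ j).eval ((j : ℝ) + 1 + a + b + 1) *
          D * (D + 1) := by
      have := ascPochhammer_eval_succ_left ((j : ℝ) + 1 + a + b + 1) (j + 1)
      rw [ascPochhammer_succ_eval, ascPochhammer_succ_eval] at this
      rw [show (j : ℝ) + 2 + a + b + 1 = (j : ℝ) + 1 + a + b + 1 + 1 by ring]
      rw [show D - ((j : ℝ) + 1) + 1 = (j : ℝ) + 1 + a + b + 1 by rw [hb]; ring,
        mul_comm, ← this, hb]
      push_cast; ring
    have X2 : (ascPochhammer ℝ (j + 1)).eval ((j : ℝ) + 1 + a + b + 1) =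
        (ascPochhammer ℝ j).eval ((j : ℝ) + 1 + a + b + 1) * D := by
      rw [ascPochhammer_succ_eval, hb]; ring
    rw [X2]
    generalize (ascPochhammer ℝ (j + 1)).eval ((j : ℝ) + 2 + a + b + 1) = Z at X1 ⊢
    generalize (ascPochhammer ℝ j).eval ((j : ℝ) + 1 + a + b + 1) = X at X1 ⊢
    simp only [Nat.factorial_succ, Nat.factorial_zero, ascPochhammer_zero, ascPochhammer_one,
      Polynomial.eval_one, Polynomial.eval_X]
    push_cast
    have e : ∀ W M : ℝ, 2 * ((j : ℝ) + 2) * (D - (j + 1) + 1) /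
        ((D + 1) * (D + 2)) * (Z * W / M) = 2 * ((j : ℝ) + 2) /
        ((D + 1) * (D + 2)) * ((Z * (D - (j + 1) + 1)) * W / M) := fun W M => by ring
    rw [e, X1]
    clear e X1 X2
    field_simp
    subst hb
    ring
  · rcases eq_or_lt_of_le (Nat.succ_le_of_lt hjn) with h | h
    · obtain rfl : j = n + 1 := h.symm
      simp only [jacobiCoeff, show n + 1 + 1 ≤ n + 2 by omega, le_refl, if_true,
        show ¬ (n + 1 + 1 ≤ n + 1) by omega, show ¬ (n + 1 + 1 ≤ n) by omega, if_false,
        show n + 2 - (n + 1 + 1) = 0 by omega, Nat.sub_self]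
      push_cast at hb ⊢
      have X1 : (ascPochhammer ℝ (n + 1 + 1)).eval ((n : ℝ) + 2 + a + b + 1) *
          (D - (n + 1) + 1) = (ascPochhammer ℝ (n + 1)).eval ((n : ℝ) + 1 + a + b + 1) *
            (D + 1) * (D + 2) := by
        have := ascPochhammer_eval_succ_left ((n : ℝ) + 1 + a + b + 1) (n + 1 + 1)
        rw [ascPochhammer_succ_eval, ascPochhammer_succ_eval] at this
        rw [show (n : ℝ) + 2 + a + b + 1 = (n : ℝ) + 1 + a + b + 1 + 1 by ring]
        rw [show D - ((n : ℝ) + 1) + 1 = (n : ℝ) + 1 + a + b + 1 by rw [hb]; ring,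
          mul_comm, ← this, hb]
        push_cast; ring
      generalize (ascPochhammer ℝ (n + 1 + 1)).eval ((n : ℝ) + 2 + a + b + 1) = Z at X1 ⊢
      generalize (ascPochhammer ℝ (n + 1)).eval ((n : ℝ) + 1 + a + b + 1) = X at X1 ⊢
      have hf := n.factorial_ne_zero
      simp only [Nat.factorial_succ, Nat.factorial_zero, ascPochhammer_zero, Polynomial.eval_one]
      push_cast
      have e : ∀ W M : ℝ, 2 * ((n : ℝ) + 2) * (D - (n + 1) + 1) /
          ((D + 1) * (D + 2)) * (Z * W / M) = 2 * ((n : ℝ) + 2) /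
          ((D + 1) * (D + 2)) * ((Z * (D - (n + 1) + 1)) * W / M) := fun W M => by ring
      rw [e, X1]
      field_simp
      ring
    · simp [jacobiCoeff, show ¬ (j + 1 ≤ n + 2) by omega, show ¬ (j + 1 ≤ n + 1) by omega,
        show ¬ (j + 1 ≤ n) by omega, show ¬ (j ≤ n + 1) by omega]

/-- The three-term recurrence of the Jacobi polynomials. -/
theorem mul_jacobiP_succ {a b : ℝ} (hab : -2 < a + b) (n : ℕ) (x : ℝ) :
    x * jacobiP a b (n + 1) x = jacobiB1 a b (n + 1) 1 * jacobiP a b (n + 2) x +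
      jacobiB1 a b (n + 1) 2 * jacobiP a b (n + 1) x + jacobiB1 a b (n + 1) 3 * jacobiP a b n x := by
  obtain ⟨y, hy⟩ : ∃ y, y = (x - 1) / 2 := ⟨_, rfl⟩
  have hx : x = 1 + 2 * y := by rw [hy]; ring
  rw [jacobiP_eq_sum_of_lt a b (show n + 2 < n + 3 by omega),
    jacobiP_eq_sum_of_lt a b (show n < n + 3 by omega)]
  have h1 : x * jacobiP a b (n + 1) x = ∑ k ∈ Finset.range (n + 3),
      (jacobiCoeff a b (n + 1) k + 2 * (if k = 0 then 0 else jacobiCoeff a b (n + 1) (k - 1))) *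
        ((x - 1) / 2) ^ k := by
    simp only [add_mul, Finset.sum_add_distrib]
    rw [← jacobiP_eq_sum_of_lt a b (show n + 1 < n + 3 by omega), Finset.sum_range_succ']
    simp only [Nat.add_eq_zero_iff, one_ne_zero, and_false, if_false, if_true,
      Nat.add_sub_cancel, mul_zero, zero_mul, add_zero]
    have : ∑ k ∈ Finset.range (n + 2), 2 * jacobiCoeff a b (n + 1) k * ((x - 1) / 2) ^ (k + 1) =
        2 * y * jacobiP a b (n + 1) x := by
      rw [jacobiP_eq_sum, Finset.mul_sum]
      refine Finset.sum_congr rfl fun k _ => ?_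
      rw [← hy]; ring
    rw [this, hx]; ring
  rw [h1, jacobiP_eq_sum_of_lt a b (show n + 1 < n + 3 by omega), Finset.mul_sum, Finset.mul_sum,
    Finset.mul_sum, ← Finset.sum_add_distrib, ← Finset.sum_add_distrib]
  refine Finset.sum_congr rfl fun k _ => ?_
  rw [jacobiCoeff_recurrence hab]
  ring

theorem mul_jacobiP_zero {a b : ℝ} (hab : -2 < a + b) (x : ℝ) :
    x * jacobiP a b 0 x = jacobiB1 a b 0 1 * jacobiP a b 1 x +
      jacobiB1 a b 0 2 * jacobiP a b 0 x := by
  have h : a + b + 2 ≠ 0 := (by linarith : 0 < a + b + 2).ne'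
  simp only [jacobiP_zero, jacobiP_one, jacobiB1, if_true, OfNat.ofNat_ne_one, if_false]
  field_simp
  ring

theorem mul_jacobiP {a b : ℝ} (hab : -2 < a + b) (n : ℕ) (x : ℝ) :
    x * jacobiP a b n x =
      ∑ m ∈ Finset.Icc (n - 1) (n + 1), jacobiB1 a b n (n + 2 - m) * jacobiP a b m x := by
  rcases n with _ | n
  · rw [mul_jacobiP_zero hab, show Finset.Icc (0 - 1) (0 + 1) = {0, 1} from rfl,
      Finset.sum_pair (by norm_num)]
    simp [add_comm]
  · rw [mul_jacobiP_succ hab, show Finset.Icc (n + 1 - 1) (n + 1 + 1) = {n, n + 1, n + 2} by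
      ext; simp only [Finset.mem_Icc, Finset.mem_insert, Finset.mem_singleton]; omega,
      Finset.sum_insert (by simp), Finset.sum_pair (by simp)]
    rw [show n + 1 + 2 - n = 3 by omega, show n + 1 + 2 - (n + 1) = 2 by omega,
      show n + 1 + 2 - (n + 2) = 1 by omega]
    ring

/-- The connection coefficients of `x ^ l * P_k`. -/
theorem pow_mul_jacobiP {a b : ℝ} (hab : -2 < a + b) (l k : ℕ) (x : ℝ) :
    x ^ l * jacobiP a b k x =
      ∑ m ∈ Finset.Icc (k - l) (k + l), jacobiB a b l k (k + l + 1 - m) * jacobiP a b m x := by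
  induction l with
  | zero => simp [jacobiB]
  | succ l ih =>
    rcases l with _ | l
    · simpa [jacobiB] using mul_jacobiP hab k x
    · rw [pow_succ', mul_assoc, ih, Finset.mul_sum]
      simp_rw [mul_left_comm x, mul_jacobiP hab, Finset.mul_sum]
      rw [Finset.sum_comm' (t' := Finset.Icc (k - (l + 1 + 1)) (k + (l + 1 + 1)))
        (s' := fun m => Finset.Icc (max (m - 1) (k - (l + 1))) (min (m + 1) (k + (l + 1))))]
      · refine Finset.sum_congr rfl fun m hm => ?_
        rw [Finset.mem_Icc] at hm
        -- `jacobiB` recovers the degree `m` from its last argument by truncated subtraction, which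
        -- is exact because `m ≤ k + l + 2`.
        rw [jacobiB, show k + (l + 2) + 1 - (k + (l + 1 + 1) + 1 - m) = m by omega, Finset.sum_mul]
        refine Finset.sum_congr rfl fun t ht => ?_
        rw [show k + (l + 1) + 1 - t = k + (l + 2) - t by omega]
        ring
      · intro t m
        simp only [Finset.mem_Icc]
        omega

/-- Interchanging `a` and `b` preserves the outer coefficients of the three-term recurrence and
changes the sign of the middle one. The symmetry thus propagates by induction, the coefficient of
`P_{n+2}` being nonzero. -/
theorem jacobiP_neg {a b : ℝ} (hab : -2 < a + b) (n : ℕ) (x : ℝ) :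
    jacobiP a b n (-x) = (-1) ^ n * jacobiP b a n x := by
  induction n using Nat.strong_induction_on with
  | _ n ih =>
    rcases n with _ | _ | n
    · simp [jacobiP_zero]
    · simp only [zero_add, jacobiP_one, pow_one]; ring
    · have h1 := mul_jacobiP_succ hab n (-x)
      have h2 := mul_jacobiP_succ (a := b) (b := a) (by linarith) n x
      rw [ih n (by omega), ih (n + 1) (by omega)] at h1
      obtain ⟨e1, e2, e3⟩ := jacobiB1_succ (a := a) (b := b) n rfl
      obtain ⟨f1, f2, f3⟩ := jacobiB1_succ (a := b) (b := a) n rfl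
      have g1 : jacobiB1 b a (n + 1) 1 = jacobiB1 a b (n + 1) 1 := by
        rw [e1, f1]; congr 1 <;> ring
      have g2 : jacobiB1 b a (n + 1) 2 = -jacobiB1 a b (n + 1) 2 := by
        rw [e2, f2, ← neg_div]; congr 1 <;> ring
      have g3 : jacobiB1 b a (n + 1) 3 = jacobiB1 a b (n + 1) 3 := by
        rw [e3, f3]; congr 1 <;> ring
      rw [g1, g2, g3] at h2
      have hn : (0 : ℝ) ≤ n := n.cast_nonneg
      have hne : jacobiB1 a b (n + 1) 1 ≠ 0 := by
        rw [e1]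
        have p1 : 0 < 2 * ((n : ℝ) + 1) + a + b - (n + 1) + 1 := by linarith
        have p2 : 0 < 2 * ((n : ℝ) + 1) + a + b + 1 := by linarith
        have p3 : 0 < 2 * ((n : ℝ) + 1) + a + b + 2 := by linarith
        positivity
      refine mul_left_cancel₀ hne ?_
      rw [pow_succ, pow_succ] at *
      linear_combination (-1 : ℝ) * h1 + (-1) ^ n * h2

theorem jacobiP_apply_one (a b : ℝ) (n : ℕ) :
    jacobiP a b n 1 = (ascPochhammer ℝ n).eval (a + 1) / n.factorial := by
  rw [jacobiP_eq_sum, Finset.sum_eq_single 0]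
  · simp [jacobiCoeff]
  · intro k _ hk; simp [hk]
  · simp

theorem jacobiP_apply_one_ne_zero {a : ℝ} (ha : -1 < a) (b : ℝ) (n : ℕ) : jacobiP a b n 1 ≠ 0 := by
  rw [jacobiP_apply_one]
  have := ascPochhammer_eval_pos (show 0 < a + 1 by linarith) n
  positivity

theorem jacobiP_apply_neg_one_ne_zero {a b : ℝ} (hab : -2 < a + b) (hb : -1 < b) (n : ℕ) :
    jacobiP a b n (-1) ≠ 0 := by
  rw [jacobiP_neg hab]
  exact mul_ne_zero (pow_ne_zero _ (by norm_num)) (jacobiP_apply_one_ne_zero hb _ _)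

end

section

/-! ### Fractional integrals and derivatives of Jacobi functions -/

theorem ascPochhammer_mul_Gamma {z : ℝ} (hz : 0 < z) (m : ℕ) :
    (ascPochhammer ℝ m).eval z * Real.Gamma z = Real.Gamma (z + m) := by
  induction m with
  | zero => simp
  | succ m ih =>
    have h : z + m ≠ 0 := by positivity
    rw [ascPochhammer_succ_eval, Nat.cast_succ, ← add_assoc, Real.Gamma_add_one h, ← ih]
    ring

theorem rightKernel_rpow {c t x : ℝ} (hc : -1 < c) (ht : t < 1) (hx : x < 1) :
    IntervalIntegrable (fun y => (1 - y) ^ c / (y - x) ^ t) volume x 1 ∧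
      rightKernelIntegral t (fun y => (1 - y) ^ c) x =
        ProbabilityTheory.beta (1 - t) (c + 1) * (1 - x) ^ (c + 1 - t) := by
  have e : ∀ y ∈ uIcc x 1, (y - x) ^ (1 - t - 1) * (1 - y) ^ (c + 1 - 1) =
      (1 - y) ^ c / (y - x) ^ t := by
    intro y hy
    rw [uIcc_of_le hx.le] at hy
    rw [mul_comm, mul_rpow_eq_div (sub_nonneg.2 hy.1) _ (show 1 - t - 1 = -t by ring),
      add_sub_cancel_right]
  constructor
  · exact (beta_intervalIntegrable (a := 1 - t) (b := c + 1) (by linarith) (by linarith) hx).congr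
      fun y hy => e y (uIoc_subset_uIcc hy)
  · rw [rightKernelIntegral, ← intervalIntegral.integral_congr e,
      beta_integral (by linarith) (by linarith) hx]
    congr 2; ring

theorem jacobiJ_eq_sum (a b : ℝ) (n : ℕ) {x : ℝ} (hx : x < 1) :
    jacobiJ a b n x =
      ∑ k ∈ Finset.range (n + 1), jacobiCoeff a b n k * (-1 / 2) ^ k * (1 - x) ^ (a + k) := by
  rw [jacobiJ, jacobiP_eq_sum, Finset.mul_sum]
  refine Finset.sum_congr rfl fun k _ => ?_
  rw [Real.rpow_add_natCast (sub_pos.2 hx).ne', show (x - 1) / 2 = -1 / 2 * (1 - x) by ring, mul_pow]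
  ring

/-- Integrate termwise in powers of `1 - y`. Each Beta value turns `(a+k+1)_{n-k}` into
`(a+k+2-t)_{n-k}` times a factor independent of `k`, while `a + b`, and with it `(n+a+b+1)_k`, is
unchanged. Hence the result is again a single Jacobi function. -/
theorem rightKernel_jacobiJ {a b t x : ℝ} (ha : -1 < a) (ht : t < 1) (n : ℕ) (hx : x < 1) :
    IntervalIntegrable (fun y => jacobiJ a b n y / (y - x) ^ t) volume x 1 ∧
      rightKernelIntegral t (jacobiJ a b n) x =
        Real.Gamma (1 - t) * Real.Gamma (n + a + 1) / Real.Gamma (n + a + 2 - t) *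
          jacobiJ (a + 1 - t) (b - 1 + t) n x := by
  have hk : ∀ k : ℕ, -1 < a + k := fun k => by have := k.cast_nonneg (α := ℝ); linarith
  have e : ∀ y ∈ Ioo x 1, jacobiJ a b n y / (y - x) ^ t =
      ∑ k ∈ Finset.range (n + 1), jacobiCoeff a b n k * (-1 / 2) ^ k *
        ((1 - y) ^ (a + k) / (y - x) ^ t) := by
    intro y hy
    rw [jacobiJ_eq_sum a b n hy.2, Finset.sum_div]
    exact Finset.sum_congr rfl fun k _ => by ring
  have hi : ∀ k ∈ Finset.range (n + 1), IntervalIntegrable (fun y => jacobiCoeff a b n k *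
      (-1 / 2) ^ k * ((1 - y) ^ (a + k) / (y - x) ^ t)) volume x 1 :=
    fun k _ => (rightKernel_rpow (hk k) ht hx).1.const_mul _
  constructor
  · have := IntervalIntegrable.sum (Finset.range (n + 1)) hi
    rw [intervalIntegrable_iff_integrableOn_Ioo_of_le hx.le] at this ⊢
    refine this.congr_fun (fun y hy => ?_) measurableSet_Ioo
    rw [e y hy, Finset.sum_apply]
  · rw [rightKernelIntegral, intervalIntegral.integral_congr_Ioo_of_le hx.le e,
      intervalIntegral.integral_finsetSum hi, jacobiJ_eq_sum _ _ _ hx, Finset.mul_sum]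
    refine Finset.sum_congr rfl fun k hkn => ?_
    have hkn' : k ≤ n := Nat.lt_succ_iff.1 (Finset.mem_range.1 hkn)
    have h1 := (rightKernel_rpow (hk k) ht hx).2
    rw [rightKernelIntegral] at h1
    rw [intervalIntegral.integral_const_mul, h1, ProbabilityTheory.beta, jacobiCoeff,
      if_pos hkn', jacobiCoeff, if_pos hkn']
    have g1 := ascPochhammer_mul_Gamma (show 0 < a + k + 1 by linarith [hk k]) (n - k)
    have g2 := ascPochhammer_mul_Gamma (show 0 < a + 1 - t + k + 1 by linarith [hk k]) (n - k)
    have hc : ((n - k : ℕ) : ℝ) = n - k := Nat.cast_sub hkn'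
    rw [hc, show a + k + 1 + ((n : ℝ) - k) = n + a + 1 by ring] at g1
    rw [hc, show a + 1 - t + k + 1 + ((n : ℝ) - k) = n + a + 2 - t by ring] at g2
    have p1 : Real.Gamma (a + 1 - t + k + 1) ≠ 0 :=
      (Real.Gamma_pos_of_pos (by linarith [hk k])).ne'
    have p2 : (ascPochhammer ℝ (n - k)).eval (a + 1 - t + k + 1) ≠ 0 :=
      (ascPochhammer_eval_pos (by linarith [hk k]) _).ne'
    rw [← g1, ← g2, show 1 - t + (a + k + 1) = a + 1 - t + k + 1 by ring,
      show (n : ℝ) + (a + 1 - t) + (b - 1 + t) + 1 = n + a + b + 1 by ring,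
      show a + (k : ℝ) + 1 - t = a + 1 - t + k by ring]
    field_simp

/-- Termwise differentiation, with `(a+k+2)_{n-k} (a+1+k) = (a+k+1)_{n-k} (n+a+1)`; the sum of the
two parameters is again preserved. -/
theorem hasDerivAt_jacobiJ (a b : ℝ) (n : ℕ) {x : ℝ} (hx : x < 1) :
    HasDerivAt (jacobiJ (a + 1) (b - 1) n) (-((n + a + 1) * jacobiJ a b n x)) x := by
  have h : HasDerivAt (fun x => ∑ k ∈ Finset.range (n + 1),
      jacobiCoeff (a + 1) (b - 1) n k * (-1 / 2) ^ k * (1 - x) ^ (a + 1 + k))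
      (∑ k ∈ Finset.range (n + 1), jacobiCoeff (a + 1) (b - 1) n k * (-1 / 2) ^ k *
        (-1 * (a + 1 + k) * (1 - x) ^ (a + 1 + k - 1))) x := by
    refine HasDerivAt.fun_sum fun k _ => HasDerivAt.const_mul _ ?_
    exact ((hasDerivAt_id x).const_sub 1).rpow_const (Or.inl (sub_pos.2 hx).ne')
  refine (h.congr_of_eventuallyEq ?_).congr_deriv ?_
  · filter_upwards [Iio_mem_nhds hx] with y hy using jacobiJ_eq_sum _ _ _ hy
  · rw [jacobiJ_eq_sum _ _ _ hx, Finset.mul_sum, ← Finset.sum_neg_distrib]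
    refine Finset.sum_congr rfl fun k hkn => ?_
    have hkn' : k ≤ n := Nat.lt_succ_iff.1 (Finset.mem_range.1 hkn)
    have g : (ascPochhammer ℝ (n - k)).eval (a + 1 + k + 1) * (a + 1 + k) =
        (ascPochhammer ℝ (n - k)).eval (a + k + 1) * (n + a + 1) := by
      have := ascPochhammer_eval_succ_left (a + k + 1) (n - k)
      rw [ascPochhammer_succ_eval, Nat.cast_sub hkn'] at this
      rw [show a + 1 + (k : ℝ) + 1 = a + k + 1 + 1 by ring, mul_comm,
        show a + 1 + (k : ℝ) = a + k + 1 by ring, ← this]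
      ring
    rw [jacobiCoeff, if_pos hkn', jacobiCoeff, if_pos hkn',
      show (n : ℝ) + (a + 1) + (b - 1) + 1 = n + a + b + 1 by ring,
      show a + 1 + (k : ℝ) - 1 = a + k by ring]
    linear_combination (-(ascPochhammer ℝ k).eval ((n : ℝ) + a + b + 1) /
      (k.factorial * (n - k).factorial) * (-1 / 2) ^ k * (1 - x) ^ (a + k)) * g

/-- The mirror image `(1 + x) ^ b * P_n^{(a,b)}` of the generalized Jacobi functions. -/
noncomputable def jacobiK (a b : ℝ) (n : ℕ) (x : ℝ) : ℝ := (1 + x) ^ b * jacobiP a b n x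

theorem jacobiK_eq {a b : ℝ} (hab : -2 < a + b) (n : ℕ) (x : ℝ) :
    jacobiK a b n x = (-1) ^ n * jacobiJ b a n (-x) := by
  have h : (-1 : ℝ) ^ n * (-1) ^ n = 1 := by rw [← mul_pow]; simp
  rw [jacobiK, jacobiJ, jacobiP_neg (by linarith), sub_neg_eq_add]
  linear_combination (-(1 + x) ^ b * jacobiP a b n x) * h

theorem leftKernelIntegral_const_mul (t c : ℝ) (v : ℝ → ℝ) (x : ℝ) :
    leftKernelIntegral t (fun y => c * v y) x = c * leftKernelIntegral t v x := by
  simp only [leftKernelIntegral, mul_div_assoc, intervalIntegral.integral_const_mul]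

theorem leftKernel_jacobiK {a b t x : ℝ} (hab : -2 < a + b) (hb : -1 < b) (ht : t < 1) (n : ℕ)
    (hx : -1 < x) :
    IntervalIntegrable (fun y => jacobiK a b n y / (x - y) ^ t) volume (-1) x ∧
      leftKernelIntegral t (jacobiK a b n) x =
        Real.Gamma (1 - t) * Real.Gamma (n + b + 1) / Real.Gamma (n + b + 2 - t) *
          jacobiK (a - 1 + t) (b + 1 - t) n x := by
  have h := rightKernel_jacobiJ (b := a) hb ht n (show -x < 1 by linarith)
  have e : jacobiK a b n = fun y => (-1) ^ n * jacobiJ b a n (-y) := by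
    ext y; exact jacobiK_eq hab n y
  constructor
  · have h1 := (intervalIntegrable_div_rpow_neg.2 h.1).const_mul ((-1) ^ n)
    rw [neg_neg] at h1
    refine h1.congr fun y _ => ?_
    rw [e, mul_div_assoc]
  · rw [e, leftKernelIntegral_const_mul, leftKernelIntegral_comp_neg, h.2,
      jacobiK_eq (by linarith)]
    ring

theorem hasDerivAt_jacobiK {a b : ℝ} (hab : -2 < a + b) (n : ℕ) {x : ℝ} (hx : -1 < x) :
    HasDerivAt (jacobiK (a - 1) (b + 1) n) ((n + b + 1) * jacobiK a b n x) x := by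
  have h := ((hasDerivAt_jacobiJ b a n (show -x < 1 by linarith)).comp x
    (hasDerivAt_neg x)).const_mul ((-1 : ℝ) ^ n)
  refine (h.congr_of_eventuallyEq (Eventually.of_forall fun y => ?_)).congr_deriv ?_
  · rw [jacobiK_eq (by linarith)]; rfl
  · rw [jacobiK_eq hab]; ring

section Basic

variable {s α β : ℝ}

/-- Fractional integration raises `a` by `1 - s` and differentiation lowers it by one. The factor `n
+ a - s + 1` from the derivative is absorbed into the Gamma function. -/
theorem hasDerivAt_rightKernelIntegral_jacobiJ {a b : ℝ} (hs1 : s < 1) (ha : s - 1 < a)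
    (ha1 : -1 < a) (n : ℕ) {x : ℝ} (hx : x < 1) :
    HasDerivAt (rightKernelIntegral s (jacobiJ a b n)) (-(Real.Gamma (1 - s) *
      (Real.Gamma (n + a + 1) / Real.Gamma (n + a - s + 1) * jacobiJ (a - s) (b + s) n x))) x := by
  have hn : (0 : ℝ) ≤ n := n.cast_nonneg
  have h := (hasDerivAt_jacobiJ (a - s) (b + s) n hx).const_mul
    (Real.Gamma (1 - s) * Real.Gamma (n + a + 1) / Real.Gamma (n + a + 2 - s))
  refine (h.congr_of_eventuallyEq ?_).congr_deriv ?_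
  · filter_upwards [Iio_mem_nhds hx] with y hy
    rw [(rightKernel_jacobiJ ha1 hs1 n hy).2, show a + 1 - s = a - s + 1 by ring,
      show b - 1 + s = b + s - 1 by ring]
  · have p : (n : ℝ) + a - s + 1 ≠ 0 := (by linarith : 0 < (n : ℝ) + a - s + 1).ne'
    have p2 : Real.Gamma (n + a - s + 1) ≠ 0 := (Real.Gamma_pos_of_pos (by linarith)).ne'
    rw [show (n : ℝ) + a + 2 - s = n + a - s + 1 + 1 by ring, Real.Gamma_add_one p,
      show (n : ℝ) + (a - s) + 1 = n + a - s + 1 by ring]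
    field_simp

theorem hasDerivAt_leftKernelIntegral_jacobiK {a b : ℝ} (hs1 : s < 1) (hab : -2 < a + b)
    (hb : s - 1 < b) (hb1 : -1 < b) (n : ℕ) {x : ℝ} (hx : -1 < x) :
    HasDerivAt (leftKernelIntegral s (jacobiK a b n)) (Real.Gamma (1 - s) *
      (Real.Gamma (n + b + 1) / Real.Gamma (n + b - s + 1) * jacobiK (a + s) (b - s) n x)) x := by
  have hn : (0 : ℝ) ≤ n := n.cast_nonneg
  have h := (hasDerivAt_jacobiK (a := a + s) (b := b - s) (by linarith) n hx).const_mul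
    (Real.Gamma (1 - s) * Real.Gamma (n + b + 1) / Real.Gamma (n + b + 2 - s))
  refine (h.congr_of_eventuallyEq ?_).congr_deriv ?_
  · filter_upwards [Ioi_mem_nhds hx] with y hy
    rw [(leftKernel_jacobiK hab hb1 hs1 n hy).2, show b + 1 - s = b - s + 1 by ring,
      show a - 1 + s = a + s - 1 by ring]
  · have p : (n : ℝ) + b - s + 1 ≠ 0 := (by linarith : 0 < (n : ℝ) + b - s + 1).ne'
    have p2 : Real.Gamma (n + b - s + 1) ≠ 0 := (Real.Gamma_pos_of_pos (by linarith)).ne'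
    rw [show (n : ℝ) + b + 2 - s = n + b - s + 1 + 1 by ring, Real.Gamma_add_one p,
      show (n : ℝ) + (b - s) + 1 = n + b - s + 1 by ring]
    field_simp

/-! ### Linearity and locality of the fractional derivatives -/

theorem leftKernelIntegral_congr {t : ℝ} {v w : ℝ → ℝ} (h : ∀ x ∈ Ioo (-1 : ℝ) 1, v x = w x)
    {x : ℝ} (hx : x ∈ Ioo (-1 : ℝ) 1) : leftKernelIntegral t v x = leftKernelIntegral t w x :=
  intervalIntegral.integral_congr_Ioo_of_le hx.1.le fun y hy => by
    rw [h y ⟨hy.1, hy.2.trans hx.2⟩]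

theorem leftRL_congr {t : ℝ} {v w : ℝ → ℝ} (h : ∀ x ∈ Ioo (-1 : ℝ) 1, v x = w x)
    {x : ℝ} (hx : x ∈ Ioo (-1 : ℝ) 1) : leftRL t v x = leftRL t w x := by
  rw [leftRL, leftRL]
  congr 1
  refine EventuallyEq.deriv_eq ?_
  filter_upwards [Ioo_mem_nhds hx.1 hx.2] with y hy using leftKernelIntegral_congr h hy

theorem HasLeftRL.congr {t : ℝ} {v w : ℝ → ℝ} (hv : HasLeftRL t v)
    (h : ∀ x ∈ Ioo (-1 : ℝ) 1, v x = w x) : HasLeftRL t w := by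
  intro x hx
  obtain ⟨h1, h2⟩ := hv x hx
  constructor
  · rw [intervalIntegrable_iff_integrableOn_Ioo_of_le hx.1.le] at h1 ⊢
    exact h1.congr_fun (fun y hy => by
      simp only [h y ⟨hy.1, hy.2.trans hx.2⟩]) measurableSet_Ioo
  · refine h2.congr_of_eventuallyEq ?_
    filter_upwards [Ioo_mem_nhds hx.1 hx.2] with y hy using (leftKernelIntegral_congr h hy).symm

theorem HasLeftRL.hasDerivAt {t : ℝ} (ht : t < 1) {v : ℝ → ℝ} (hv : HasLeftRL t v) {x : ℝ}
    (hx : x ∈ Ioo (-1 : ℝ) 1) :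
    HasDerivAt (leftKernelIntegral t v) (Real.Gamma (1 - t) * leftRL t v x) x := by
  refine (hv x hx).2.hasDerivAt.congr_deriv ?_
  have := (Real.Gamma_pos_of_pos (sub_pos.2 ht)).ne'
  rw [leftRL]; field_simp

theorem HasRightRL.hasDerivAt {t : ℝ} (ht : t < 1) {v : ℝ → ℝ} (hv : HasRightRL t v) {x : ℝ}
    (hx : x ∈ Ioo (-1 : ℝ) 1) :
    HasDerivAt (rightKernelIntegral t v) (-(Real.Gamma (1 - t) * rightRL t v x)) x := by
  refine (hv x hx).2.hasDerivAt.congr_deriv ?_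
  have := (Real.Gamma_pos_of_pos (sub_pos.2 ht)).ne'
  rw [rightRL]; field_simp

theorem leftRL_eq_of_hasDerivAt {t d : ℝ} (ht : t < 1) {v : ℝ → ℝ} {x : ℝ}
    (h : HasDerivAt (leftKernelIntegral t v) (Real.Gamma (1 - t) * d) x) : leftRL t v x = d := by
  have := (Real.Gamma_pos_of_pos (sub_pos.2 ht)).ne'
  rw [leftRL, h.deriv]; field_simp

theorem rightRL_eq_of_hasDerivAt {t d : ℝ} (ht : t < 1) {v : ℝ → ℝ} {x : ℝ}
    (h : HasDerivAt (rightKernelIntegral t v) (-(Real.Gamma (1 - t) * d)) x) :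
    rightRL t v x = d := by
  have := (Real.Gamma_pos_of_pos (sub_pos.2 ht)).ne'
  rw [rightRL, h.deriv]; field_simp

theorem HasLeftRL.linear {t p q : ℝ} {v w : ℝ → ℝ} (ht : t < 1) (hv : HasLeftRL t v)
    (hw : HasLeftRL t w) :
    HasLeftRL t (fun x => p * v x + q * w x) ∧ ∀ x ∈ Ioo (-1 : ℝ) 1,
      leftRL t (fun x => p * v x + q * w x) x = p * leftRL t v x + q * leftRL t w x := by
  have e : ∀ x y : ℝ, (p * v y + q * w y) / (x - y) ^ t =
      p * (v y / (x - y) ^ t) + q * (w y / (x - y) ^ t) := fun x y => by ring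
  have hi : ∀ x ∈ Ioo (-1 : ℝ) 1,
      leftKernelIntegral t (fun x => p * v x + q * w x) x =
        p * leftKernelIntegral t v x + q * leftKernelIntegral t w x := by
    intro x hx
    simp only [leftKernelIntegral, e]
    rw [intervalIntegral.integral_add ((hv x hx).1.const_mul p) ((hw x hx).1.const_mul q)]
    simp only [intervalIntegral.integral_const_mul]
  have hd : ∀ x ∈ Ioo (-1 : ℝ) 1,
      HasDerivAt (leftKernelIntegral t (fun x => p * v x + q * w x))
        (Real.Gamma (1 - t) * (p * leftRL t v x + q * leftRL t w x)) x := by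
    intro x hx
    have := ((hv.hasDerivAt ht hx).const_mul p).add ((hw.hasDerivAt ht hx).const_mul q)
    refine (this.congr_of_eventuallyEq ?_).congr_deriv (by ring)
    filter_upwards [Ioo_mem_nhds hx.1 hx.2] with y hy using hi y hy
  refine ⟨fun x hx => ⟨?_, (hd x hx).differentiableAt⟩,
    fun x hx => leftRL_eq_of_hasDerivAt ht (hd x hx)⟩
  simp only [e]
  exact ((hv x hx).1.const_mul p).add ((hw x hx).1.const_mul q)

theorem HasRightRL.linear {t p q : ℝ} {v w : ℝ → ℝ} (ht : t < 1) (hv : HasRightRL t v)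
    (hw : HasRightRL t w) :
    HasRightRL t (fun x => p * v x + q * w x) ∧ ∀ x ∈ Ioo (-1 : ℝ) 1,
      rightRL t (fun x => p * v x + q * w x) x = p * rightRL t v x + q * rightRL t w x := by
  have e : ∀ x y : ℝ, (p * v y + q * w y) / (y - x) ^ t =
      p * (v y / (y - x) ^ t) + q * (w y / (y - x) ^ t) := fun x y => by ring
  have hi : ∀ x ∈ Ioo (-1 : ℝ) 1,
      rightKernelIntegral t (fun x => p * v x + q * w x) x =
        p * rightKernelIntegral t v x + q * rightKernelIntegral t w x := by
    intro x hx
    simp only [rightKernelIntegral, e]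
    rw [intervalIntegral.integral_add ((hv x hx).1.const_mul p) ((hw x hx).1.const_mul q)]
    simp only [intervalIntegral.integral_const_mul]
  have hd : ∀ x ∈ Ioo (-1 : ℝ) 1,
      HasDerivAt (rightKernelIntegral t (fun x => p * v x + q * w x))
        (-(Real.Gamma (1 - t) * (p * rightRL t v x + q * rightRL t w x))) x := by
    intro x hx
    have := ((hv.hasDerivAt ht hx).const_mul p).add ((hw.hasDerivAt ht hx).const_mul q)
    refine (this.congr_of_eventuallyEq ?_).congr_deriv (by ring)
    filter_upwards [Ioo_mem_nhds hx.1 hx.2] with y hy using hi y hy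
  refine ⟨fun x hx => ⟨?_, (hd x hx).differentiableAt⟩,
    fun x hx => rightRL_eq_of_hasDerivAt ht (hd x hx)⟩
  simp only [e]
  exact ((hv x hx).1.const_mul p).add ((hw x hx).1.const_mul q)

theorem BoundedNear.linear {l : Filter ℝ} {p q : ℝ} {v w : ℝ → ℝ} (hv : BoundedNear l v)
    (hw : BoundedNear l w) : BoundedNear l (fun x => p * v x + q * w x) := by
  obtain ⟨M, hM⟩ := hv
  obtain ⟨N, hN⟩ := hw
  refine ⟨|p| * M + |q| * N, ?_⟩
  filter_upwards [hM, hN] with x h1 h2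
  refine (abs_add_le _ _).trans ?_
  rw [abs_mul, abs_mul]
  gcongr

theorem BoundedNear.congr {l : Filter ℝ} {v w : ℝ → ℝ} (hv : BoundedNear l v)
    (h : v =ᶠ[l] w) : BoundedNear l w := by
  obtain ⟨M, hM⟩ := hv
  refine ⟨M, ?_⟩
  filter_upwards [hM, h] with x h1 h2
  rwa [← h2]

theorem _root_.ContinuousAt.boundedNear {l : Filter ℝ} {v : ℝ → ℝ} {x : ℝ} (h : ContinuousAt v x)
    (hl : l ≤ 𝓝 x) : BoundedNear l v := by
  refine ⟨|v x| + 1, hl ?_⟩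
  exact (h.abs.eventually (gt_mem_nhds (lt_add_one |v x|))).mono fun y hy => hy.le

theorem jacobiWeight_nonneg {a b x : ℝ} (hx : x ∈ Ioo (-1 : ℝ) 1) : 0 ≤ jacobiWeight a b x :=
  mul_nonneg (Real.rpow_nonneg (by linarith [hx.2]) _) (Real.rpow_nonneg (by linarith [hx.1]) _)

theorem jacobiWeight_pos {a b x : ℝ} (hx : x ∈ Ioo (-1 : ℝ) 1) : 0 < jacobiWeight a b x :=
  mul_pos (Real.rpow_pos_of_pos (by linarith [hx.2]) _)
    (Real.rpow_pos_of_pos (by linarith [hx.1]) _)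

theorem jacobiWeight_mul {a b c d x : ℝ} (hx : x ∈ Ioo (-1 : ℝ) 1) :
    jacobiWeight a b x * jacobiWeight c d x = jacobiWeight (a + c) (b + d) x := by
  rw [jacobiWeight, jacobiWeight, jacobiWeight, Real.rpow_add (by linarith [hx.2]),
    Real.rpow_add (by linarith [hx.1])]
  ring

theorem measurable_jacobiWeight (a b : ℝ) : Measurable (jacobiWeight a b) :=
  ((measurable_const.sub measurable_id).pow_const a).mul
    ((measurable_const.add measurable_id).pow_const b)

theorem integrableOn_jacobiWeight {a b : ℝ} (ha : -1 < a) (hb : -1 < b) :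
    IntegrableOn (jacobiWeight a b) (Ioo (-1) 1) := by
  have := beta_intervalIntegrable (a := b + 1) (b := a + 1) (y := -1) (z := 1) (by linarith)
    (by linarith) (by norm_num)
  rw [intervalIntegrable_iff_integrableOn_Ioo_of_le (by norm_num)] at this
  refine this.congr_fun (fun x _ => ?_) measurableSet_Ioo
  simp only [jacobiWeight, add_sub_cancel_right, sub_neg_eq_add]
  rw [mul_comm, add_comm x]

theorem integrableOn_mul_continuous {f g : ℝ → ℝ} (hf : IntegrableOn f (Ioo (-1) 1))
    (hg : Continuous g) : IntegrableOn (fun x => f x * g x) (Ioo (-1) 1) := by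
  rw [← integrableOn_Icc_iff_integrableOn_Ioo] at hf ⊢
  exact hf.mul_continuousOn hg.continuousOn isCompact_Icc

theorem MemWeightedL2.linear {p q : ℝ} {v w : ℝ → ℝ} (hv : MemWeightedL2 α β v)
    (hw : MemWeightedL2 α β w) : MemWeightedL2 α β (fun x => p * v x + q * w x) := by
  have hm : AEStronglyMeasurable (fun x => p * v x + q * w x) (volume.restrict (Ioo (-1) 1)) :=
    (hv.1.const_mul p).add (hw.1.const_mul q)
  refine ⟨hm, ?_⟩
  have hi := (hv.2.const_mul (2 * p ^ 2)).add (hw.2.const_mul (2 * q ^ 2))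
  refine Integrable.mono' hi
    ((hm.pow 2).mul (measurable_jacobiWeight (-α) β).aestronglyMeasurable) ?_
  refine (ae_restrict_mem measurableSet_Ioo).mono fun x hx => ?_
  have h0 := jacobiWeight_nonneg (a := -α) (b := β) hx
  simp only [Pi.add_apply, Real.norm_eq_abs]
  rw [abs_of_nonneg (mul_nonneg (sq_nonneg _) h0)]
  -- `(X + Y)² ≤ 2X² + 2Y²`, the difference being `(X - Y)²`.
  nlinarith [mul_nonneg (sq_nonneg (p * v x - q * w x)) h0]

theorem flux_linear {p q : ℝ} {v w : ℝ → ℝ} (hs1 : s < 1) (hv : HasRightRL s v)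
    (hw : HasRightRL s w) {x : ℝ} (hx : x ∈ Ioo (-1 : ℝ) 1) :
    flux s α β (fun x => p * v x + q * w x) x = p * flux s α β v x + q * flux s α β w x := by
  rw [flux, (hv.linear hs1 hw).2 x hx, flux, flux]
  ring

theorem fracJacobiOp_linear {p q : ℝ} {v w : ℝ → ℝ} (hs1 : s < 1) (hv : HasRightRL s v)
    (hw : HasRightRL s w) (hv' : HasLeftRL s (flux s α β v)) (hw' : HasLeftRL s (flux s α β w)) :
    HasLeftRL s (flux s α β fun x => p * v x + q * w x) ∧ ∀ x ∈ Ioo (-1 : ℝ) 1,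
      fracJacobiOp s α β (fun x => p * v x + q * w x) x =
        p * fracJacobiOp s α β v x + q * fracJacobiOp s α β w x := by
  have h := hv'.linear (p := p) (q := q) hs1 hw'
  have e : ∀ x ∈ Ioo (-1 : ℝ) 1, p * flux s α β v x + q * flux s α β w x =
    flux s α β (fun x => p * v x + q * w x) x := fun x hx => (flux_linear hs1 hv hw hx).symm
  refine ⟨h.1.congr e, fun x hx => ?_⟩
  rw [fracJacobiOp, ← leftRL_congr e hx, h.2 x hx, fracJacobiOp, fracJacobiOp]
  ring

theorem Ioo_mem_nhdsLT_one : Ioo (-1 : ℝ) 1 ∈ 𝓝[<] (1 : ℝ) := Ioo_mem_nhdsLT (by norm_num)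

theorem Ioo_mem_nhdsGT_neg_one : Ioo (-1 : ℝ) 1 ∈ 𝓝[>] (-1 : ℝ) := Ioo_mem_nhdsGT (by norm_num)

theorem IsBVPSolution.linear {μ p q : ℝ} {F G v w : ℝ → ℝ} (hs1 : s < 1)
    (hv : IsBVPSolution s α β μ F v) (hw : IsBVPSolution s α β μ G w) :
    IsBVPSolution s α β μ (fun x => p * F x + q * G x) (fun x => p * v x + q * w x) where
  memL2 := hv.memL2.linear hw.memL2
  hasRight := (hv.hasRight.linear hs1 hw.hasRight).1
  hasLeft := (fracJacobiOp_linear hs1 hv.hasRight hw.hasRight hv.hasLeft hw.hasLeft).1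
  equation x hx := by
    rw [(fracJacobiOp_linear hs1 hv.hasRight hw.hasRight hv.hasLeft hw.hasLeft).2 x hx,
      ← hv.equation x hx, ← hw.equation x hx]
    ring
  bc_left := hv.bc_left.linear hw.bc_left
  bc_right_pos h := by
    simpa using ((hv.bc_right_pos h).const_mul p).add ((hw.bc_right_pos h).const_mul q)
  bc_right_zero h := (hv.bc_right_zero h).linear (hw.bc_right_zero h)
  bc_right_neg h := ((hv.bc_right_neg h).linear (hw.bc_right_neg h)).congr (by
    filter_upwards [Ioo_mem_nhdsLT_one] with x hx
    exact (flux_linear hs1 hv.hasRight hw.hasRight hx).symm)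

theorem IsBVPSolution.congr_rhs {μ : ℝ} {F G v : ℝ → ℝ} (hv : IsBVPSolution s α β μ F v)
    (h : ∀ x ∈ Ioo (-1 : ℝ) 1, F x = G x) : IsBVPSolution s α β μ G v :=
  { hv with equation := fun x hx => (hv.equation x hx).trans (h x hx) }

/-! ### The generalized Jacobi functions are eigenfunctions -/

theorem hasRightRL_jacobiJ (hs0 : 0 < s) (hs1 : s < 1) (hα : s - 1 < α) (n : ℕ) :
    HasRightRL s (jacobiJ α β n) := fun _ hx =>
  ⟨(rightKernel_jacobiJ (by linarith) hs1 n hx.2).1,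
    (hasDerivAt_rightKernelIntegral_jacobiJ hs1 hα (by linarith) n hx.2).differentiableAt⟩

theorem rightRL_jacobiJ (hs0 : 0 < s) (hs1 : s < 1) (hα : s - 1 < α) (n : ℕ) {x : ℝ} (hx : x < 1) :
    rightRL s (jacobiJ α β n) x = Real.Gamma (n + α + 1) / Real.Gamma (n + α - s + 1) *
      jacobiJ (α - s) (β + s) n x :=
  rightRL_eq_of_hasDerivAt hs1
    (hasDerivAt_rightKernelIntegral_jacobiJ hs1 hα (by linarith) n hx)

/-- The weight cancels `(1-x)^(α-s)` and supplies `(1+x)^(β+s)`. It thereby converts a function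
adapted to the right derivative into one adapted to the left derivative. -/
theorem flux_jacobiJ (hs0 : 0 < s) (hs1 : s < 1) (hα : s - 1 < α) (n : ℕ) {x : ℝ} (hx : x < 1) :
    flux s α β (jacobiJ α β n) x = Real.Gamma (n + α + 1) / Real.Gamma (n + α - s + 1) *
      jacobiK (α - s) (β + s) n x := by
  rw [flux, rightRL_jacobiJ hs0 hs1 hα n hx, jacobiJ, jacobiK, jacobiWeight,
    show -α + s = -(α - s) by ring, Real.rpow_neg (by linarith)]
  have := (Real.rpow_pos_of_pos (sub_pos.2 hx) (α - s)).ne'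
  field_simp

theorem hasLeftRL_flux_jacobiJ (hs0 : 0 < s) (hs1 : s < 1) (hα : s - 1 < α) (hβ : -1 < β) (n : ℕ) :
    HasLeftRL s (flux s α β (jacobiJ α β n)) := by
  have h : HasLeftRL s (jacobiK (α - s) (β + s) n) := fun x hx =>
    ⟨(leftKernel_jacobiK (by linarith) (by linarith) hs1 n hx.1).1,
      (hasDerivAt_leftKernelIntegral_jacobiK hs1 (by linarith) (by linarith) (by linarith) n
        hx.1).differentiableAt⟩
  -- A scalar multiple, obtained as a linear combination with second coefficient zero.
  exact (h.linear (p := Real.Gamma (n + α + 1) / Real.Gamma (n + α - s + 1)) (q := 0) hs1 h).1.congr fun x hx => by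
    rw [flux_jacobiJ hs0 hs1 hα n hx.2]; ring

/-- The right derivative contributes `Γ(n+α+1)/Γ(n+α-s+1)`, the left one `Γ(n+β+s+1)/Γ(n+β+1)`; all
powers of `1 - x` and `1 + x` recombine to those of `⁺J_n`. -/
theorem fracJacobiOp_jacobiJ (hs0 : 0 < s) (hs1 : s < 1) (hα : s - 1 < α) (hβ : -1 < β) (n : ℕ)
    {x : ℝ} (hx : x ∈ Ioo (-1 : ℝ) 1) :
    fracJacobiOp s α β (jacobiJ α β n) x = baseEigenvalue s α β n * jacobiJ α β n x := by
  have h : HasLeftRL s (jacobiK (α - s) (β + s) n) := fun x hx =>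
    ⟨(leftKernel_jacobiK (by linarith) (by linarith) hs1 n hx.1).1,
      (hasDerivAt_leftKernelIntegral_jacobiK hs1 (by linarith) (by linarith) (by linarith) n
        hx.1).differentiableAt⟩
  have e : ∀ y ∈ Ioo (-1 : ℝ) 1, flux s α β (jacobiJ α β n) y =
      Real.Gamma (n + α + 1) / Real.Gamma (n + α - s + 1) * jacobiK (α - s) (β + s) n y +
        0 * jacobiK (α - s) (β + s) n y := fun y hy => by
    rw [flux_jacobiJ hs0 hs1 hα n hy.2]; ring
  have hd := leftRL_eq_of_hasDerivAt hs1
    (hasDerivAt_leftKernelIntegral_jacobiK (a := α - s) (b := β + s) hs1 (by linarith)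
      (by linarith) (by linarith) n hx.1)
  rw [fracJacobiOp, leftRL_congr e hx, (h.linear hs1 h).2 x hx, hd, baseEigenvalue, jacobiWeight,
    jacobiJ, jacobiK, show α - s + s = α by ring, show β + s - s = β by ring,
    show (n : ℝ) + (β + s) + 1 = n + β + s + 1 by ring,
    show (n : ℝ) + (β + s) - s + 1 = n + β + 1 by ring, Real.rpow_neg (by linarith [hx.1])]
  have := (Real.rpow_pos_of_pos (show 0 < 1 + x by linarith [hx.1]) β).ne'
  field_simp
  ring

theorem jacobiJ_mul_weight (n : ℕ) {x : ℝ} (hx : x ∈ Ioo (-1 : ℝ) 1) :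
    jacobiJ α β n x * jacobiWeight (-α) β x = jacobiK α β n x := by
  rw [jacobiJ, jacobiWeight, jacobiK, Real.rpow_neg (by linarith [hx.2])]
  have := (Real.rpow_pos_of_pos (sub_pos.2 hx.2) α).ne'
  field_simp

theorem integrableOn_jacobiJ_mul_jacobiJ (hα : -1 < α) (hβ : -1 < β) (m n : ℕ) :
    IntegrableOn (fun x => jacobiJ α β m x * jacobiJ α β n x * jacobiWeight (-α) β x)
      (Ioo (-1) 1) := by
  refine (integrableOn_mul_continuous (integrableOn_jacobiWeight hα hβ)
    ((continuous_jacobiP α β m).mul (continuous_jacobiP α β n))).congr_fun (fun x hx => ?_)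
    measurableSet_Ioo
  simp only
  rw [mul_assoc (jacobiJ α β m x), jacobiJ_mul_weight n hx, jacobiWeight, jacobiJ, jacobiK,
    Pi.mul_apply]
  ring

theorem measurable_jacobiJ (n : ℕ) : Measurable (jacobiJ α β n) :=
  ((measurable_const.sub measurable_id).pow_const α).mul (continuous_jacobiP α β n).measurable

/-- The number `μ` is kept arbitrary so that functions of different index can be added within one
problem. For `α < 0` the boundary condition at `1` holds because the flux extends continuously
there, the factor `(1-x)^(α-s)` having been cancelled. -/
theorem isBVPSolution_jacobiJ (hs0 : 0 < s) (hs1 : s < 1) (hα : s - 1 < α) (hβ : -1 < β)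
    (μ : ℝ) (k : ℕ) : IsBVPSolution s α β μ
      (fun x => (baseEigenvalue s α β k - μ) * jacobiJ α β k x) (jacobiJ α β k) where
  memL2 := ⟨(measurable_jacobiJ k).aestronglyMeasurable,
    (integrableOn_jacobiJ_mul_jacobiJ (α := α) (by linarith) hβ k k).congr_fun
      (fun x _ => by simp only [sq]) measurableSet_Ioo⟩
  hasRight := hasRightRL_jacobiJ hs0 hs1 hα k
  hasLeft := hasLeftRL_flux_jacobiJ hs0 hs1 hα hβ k
  equation x hx := by rw [fracJacobiOp_jacobiJ hs0 hs1 hα hβ k hx]; ring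
  bc_left := by
    have h : ContinuousAt (jacobiJ α β k) (-1) :=
      ((continuousAt_const.sub continuousAt_id).rpow_const (Or.inl (by norm_num))).mul
        (continuous_jacobiP α β k).continuousAt
    exact h.boundedNear nhdsWithin_le_nhds
  bc_right_pos h := by
    have h : ContinuousAt (jacobiJ α β k) 1 :=
      ((continuousAt_const.sub continuousAt_id).rpow_const (Or.inr h.le)).mul
        (continuous_jacobiP α β k).continuousAt
    have h2 := h.tendsto
    rw [jacobiJ, sub_self, Real.zero_rpow (by linarith), zero_mul] at h2
    exact h2.mono_left nhdsWithin_le_nhds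
  bc_right_zero h := by
    have h : ContinuousAt (jacobiJ α β k) 1 :=
      ((continuousAt_const.sub continuousAt_id).rpow_const (Or.inr h.ge)).mul
        (continuous_jacobiP α β k).continuousAt
    exact h.boundedNear nhdsWithin_le_nhds
  bc_right_neg h := by
    have h : ContinuousAt (fun x => Real.Gamma (k + α + 1) / Real.Gamma (k + α - s + 1) *
        jacobiK (α - s) (β + s) k x) 1 :=
      continuousAt_const.mul (((continuousAt_const.add continuousAt_id).rpow_const
        (Or.inl (by norm_num))).mul (continuous_jacobiP _ _ k).continuousAt)
    refine (h.boundedNear (l := 𝓝[<] 1) nhdsWithin_le_nhds).congr ?_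
    filter_upwards [self_mem_nhdsWithin] with x hx using (flux_jacobiJ hs0 hs1 hα k hx).symm

/-- A finite combination of generalized Jacobi functions solves the problem with the
corresponding right-hand side. -/
theorem isBVPSolution_sum (hs0 : 0 < s) (hs1 : s < 1) (hα : s - 1 < α) (hβ : -1 < β)
    (μ : ℝ) (S : Finset ℕ) (a : ℕ → ℝ) : IsBVPSolution s α β μ
      (fun x => ∑ k ∈ S, (baseEigenvalue s α β k - μ) * a k * jacobiJ α β k x)
      (fun x => ∑ k ∈ S, a k * jacobiJ α β k x) := by
  induction S using Finset.induction_on with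
  | empty =>
    have h := isBVPSolution_jacobiJ hs0 hs1 hα hβ μ 0
    simpa using h.linear (p := 0) (q := 0) hs1 h
  | insert k S hk ih =>
    have h := (isBVPSolution_jacobiJ hs0 hs1 hα hβ μ k).linear (p := a k) (q := 1) hs1 ih
    simp only [Finset.sum_insert hk]
    refine (by simpa using h : IsBVPSolution s α β μ _ fun x => a k * jacobiJ α β k x +
      ∑ k ∈ S, a k * jacobiJ α β k x).congr_rhs fun x _ => ?_
    ring

end Basic

end

/-! ### Integrability and Abel representations of solutions -/

section

/-- Continuous factors are bounded on `[a, b]`. This inserts Jacobi polynomials into estimates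
proved for pure powers. -/
theorem TriangleIntegrable.mul_continuous_fst {a b t : ℝ} {f k : ℝ → ℝ}
    (h : TriangleIntegrable a b t f k) {P : ℝ → ℝ} (hP : Continuous P) :
    TriangleIntegrable a b t f (fun x => k x * P x) := by
  obtain ⟨C, hC⟩ := (isCompact_Icc (a := a) (b := b)).exists_bound_of_continuousOn hP.continuousOn
  have h2 : ∀ᵐ p : ℝ × ℝ ∂((volume.restrict (Ioo a b)).prod (volume.restrict (Ioo a b))),
      ‖P p.1‖ ≤ C := by
    rw [Measure.prod_restrict]
    refine (ae_restrict_mem (measurableSet_Ioo.prod measurableSet_Ioo)).mono fun p hp => ?_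
    exact hC _ (Ioo_subset_Icc_self hp.1)
  refine (Integrable.mul_bdd (c := C) h (hP.comp continuous_fst).aestronglyMeasurable h2).congr
    (Eventually.of_forall fun p => ?_)
  simp only [indicator]
  split_ifs
  · simp only [Function.comp]; ring
  · simp

theorem TriangleIntegrable.mul_continuous_snd {a b t : ℝ} {f k : ℝ → ℝ}
    (h : TriangleIntegrable a b t f k) {P : ℝ → ℝ} (hP : Continuous P) :
    TriangleIntegrable a b t (fun x => f x * P x) k := by
  obtain ⟨C, hC⟩ := (isCompact_Icc (a := a) (b := b)).exists_bound_of_continuousOn hP.continuousOn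
  have h2 : ∀ᵐ p : ℝ × ℝ ∂((volume.restrict (Ioo a b)).prod (volume.restrict (Ioo a b))),
      ‖P p.2‖ ≤ C := by
    rw [Measure.prod_restrict]
    refine (ae_restrict_mem (measurableSet_Ioo.prod measurableSet_Ioo)).mono fun p hp => ?_
    exact hC _ (Ioo_subset_Icc_self hp.2)
  refine (Integrable.mul_bdd (c := C) h (hP.comp continuous_snd).aestronglyMeasurable h2).congr
    (Eventually.of_forall fun p => ?_)
  simp only [indicator]
  split_ifs
  · simp only [Function.comp]; ring
  · simp

theorem intervalIntegrable_of_div_rpow_right {t b x : ℝ} (ht : 0 ≤ t) (hxb : x ≤ b) {v : ℝ → ℝ}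
    (hv : IntervalIntegrable (fun y => v y / (y - x) ^ t) volume x b) :
    IntervalIntegrable v volume x b := by
  have h1 : Continuous fun y : ℝ => (y - x) ^ t :=
    (continuous_id.sub continuous_const).rpow_const fun _ => Or.inr ht
  have h2 := hv.mul_continuousOn h1.continuousOn
  rw [intervalIntegrable_iff_integrableOn_Ioo_of_le hxb] at h2 ⊢
  refine h2.congr_fun (fun y hy => ?_) measurableSet_Ioo
  have : (y - x) ^ t ≠ 0 := (Real.rpow_pos_of_pos (sub_pos.2 hy.1) _).ne'
  field_simp

theorem measurable_one_sub_rpow (p : ℝ) : Measurable fun x : ℝ => (1 - x) ^ p :=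
  (measurable_const.sub measurable_id).pow_const p

theorem measurable_one_add_rpow (p : ℝ) : Measurable fun x : ℝ => (1 + x) ^ p :=
  (measurable_const.add measurable_id).pow_const p

theorem continuousAt_one_sub_rpow (p : ℝ) {x : ℝ} (hx : x < 1) :
    ContinuousAt (fun y : ℝ => (1 - y) ^ p) x :=
  (continuousAt_const.sub continuousAt_id).rpow_const (Or.inl (sub_pos.2 hx).ne')

theorem continuousAt_one_add_rpow (p : ℝ) {x : ℝ} (hx : -1 < x) :
    ContinuousAt (fun y : ℝ => (1 + y) ^ p) x :=
  (continuousAt_const.add continuousAt_id).rpow_const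
    (Or.inl (show 0 < 1 + x by linarith).ne')

theorem beta_self_one_sub (s : ℝ) :
    ProbabilityTheory.beta s (1 - s) = Real.Gamma s * Real.Gamma (1 - s) := by
  rw [ProbabilityTheory.beta, add_sub_cancel, Real.Gamma_one, div_one]

theorem leftKernel_rpow {c t x : ℝ} (hc : -1 < c) (ht : t < 1) (hx : -1 < x) :
    IntervalIntegrable (fun y => (1 + y) ^ c / (x - y) ^ t) volume (-1) x ∧
      leftKernelIntegral t (fun y => (1 + y) ^ c) x =
        ProbabilityTheory.beta (1 - t) (c + 1) * (1 + x) ^ (c + 1 - t) := by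
  have h := rightKernel_rpow hc ht (show -x < 1 by linarith)
  constructor
  · simpa using intervalIntegrable_div_rpow_neg.2 h.1
  · have e := leftKernelIntegral_comp_neg t (fun y => (1 - y) ^ c) x
    simp only [sub_neg_eq_add] at e h
    rw [e, h.2]

/-- The grouping is deliberate: `(1-x)^(α-s) * flux` is the product that turns out to be integrable
on all of `(-1,1)`. -/
theorem rightRL_eq_flux {s α β : ℝ} {u : ℝ → ℝ} {x : ℝ} (hx : x ∈ Ioo (-1 : ℝ) 1) :
    rightRL s u x = (1 + x) ^ (-β - s) * ((1 - x) ^ (α - s) * flux s α β u x) := by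
  have h2 := jacobiWeight_mul (a := α - s) (b := -β - s) (c := -α + s) (d := β + s) hx
  have h3 : jacobiWeight (α - s + (-α + s)) (-β - s + (β + s)) x = 1 := by
    rw [show α - s + (-α + s) = 0 by ring, show -β - s + (β + s) = 0 by ring]
    simp [jacobiWeight]
  rw [h3, jacobiWeight] at h2
  rw [flux]
  linear_combination (-rightRL s u x) * h2

namespace IsBVPSolution

variable {s α β μ : ℝ} {F u : ℝ → ℝ}

/-- Boundedness of `u` handles the end `-1`, absolute convergence of the right Abel integral the end
`1`. From the `L²` condition only measurability enters. -/
theorem integrableOn_Ioo (hs0 : 0 < s) (hu : IsBVPSolution s α β μ F u) :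
    IntegrableOn u (Ioo (-1) 1) ∧
      (-1 < β → IntegrableOn (fun x => (1 + x) ^ β * u x) (Ioo (-1) 1)) := by
  obtain ⟨M, hM⟩ := hu.bc_left
  obtain ⟨b, hb1, hb⟩ : ∃ b ∈ Ioo (-1 : ℝ) 1, ∀ x ∈ Ioo (-1) b, |u x| ≤ M := by
    obtain ⟨b, hb1, hb2⟩ := (mem_nhdsGT_iff_exists_mem_Ioc_Ioo_subset
      (show (-1 : ℝ) < 0 by norm_num)).1 hM
    exact ⟨b, ⟨hb1.1, by linarith [hb1.2]⟩, hb2⟩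
  have hsub : Ioo (-1) b ⊆ Ioo (-1 : ℝ) 1 := Ioo_subset_Ioo_right hb1.2.le
  have hun : Ioo (-1 : ℝ) 1 = Ioo (-1) b ∪ Ico b 1 := (Ioo_union_Ico_eq_Ioo hb1.1 hb1.2.le).symm
  have hr : IntegrableOn u (Ico b 1) := by
    have := intervalIntegrable_of_div_rpow_right hs0.le hb1.2.le (hu.hasRight b hb1).1
    rwa [intervalIntegrable_iff_integrableOn_Ico_of_le hb1.2.le] at this
  have hl : ∀ {f : ℝ → ℝ}, IntegrableOn f (Ioo (-1) b) →
      IntegrableOn (fun x => f x * u x) (Ioo (-1) b) := fun hf => by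
    refine Integrable.mul_bdd (c := M) hf (hu.memL2.1.mono_measure (Measure.restrict_mono hsub le_rfl)) ?_
    exact (ae_restrict_mem measurableSet_Ioo).mono fun x hx => hb x hx
  refine ⟨?_, fun hβ => ?_⟩
  · rw [hun]
    refine IntegrableOn.union ?_ hr
    have := hl (f := fun _ => 1) (by simp)
    simpa using this
  · rw [hun]
    refine IntegrableOn.union (hl ?_) ?_
    · have h1 := intervalIntegrable_rpow_sub_left (p := β + 1) (y := -1) (z := b) (by linarith)
      rw [intervalIntegrable_iff_integrableOn_Ioo_of_le hb1.1.le] at h1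
      simpa [add_comm] using h1
    · rw [integrableOn_Ico_iff_integrableOn_Ioo, ← integrableOn_Icc_iff_integrableOn_Ioo] at hr ⊢
      refine hr.continuousOn_mul (fun x hx => ?_) isCompact_Icc
      exact (continuousAt_one_add_rpow _ (by linarith [hx.1, hb1.1])).continuousWithinAt

section Homogeneous

variable (hs0 : 0 < s) (hs1 : s < 1) (hα : s - 1 < α) (hβ : -1 < β)
  (hu : IsBVPSolution s α β μ (fun _ => 0) u)
include hu

theorem leftRL_flux_eq {x : ℝ} (hx : x ∈ Ioo (-1 : ℝ) 1) :
    leftRL s (flux s α β u) x = μ * (u x * jacobiWeight (-α) β x) := by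
  have h1 := hu.equation x hx
  have h2 := jacobiWeight_mul (a := α) (b := -β) (c := -α) (d := β) hx
  rw [fracJacobiOp] at h1
  have h3 : jacobiWeight (α + -α) (-β + β) x = 1 := by simp [jacobiWeight]
  rw [h3] at h2
  linear_combination jacobiWeight (-α) β x * h1 - leftRL s (flux s α β u) x * h2

include hs0 hs1 hα hβ

omit hs1 in
-- By the equation, the left derivative of the flux is `μ (1-x)^(-α) (1+x)^β u`. The inner integral
-- of `(1-x)^(α-s)` is a constant times `(1-y)^α`, which exactly cancels the singular factor and
-- leaves the integrable `(1+y)^β u`.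
theorem triangle_leftRL :
    TriangleIntegrable (-1) 1 (1 - s) (leftRL s (flux s α β u)) (fun x => (1 - x) ^ (α - s)) := by
  have hI := (hu.integrableOn_Ioo hs0).2 hβ
  have e : ∀ x ∈ Ioo (-1 : ℝ) 1, leftRL s (flux s α β u) x =
      (1 - x) ^ (-α) * (μ * ((1 + x) ^ β * u x)) := fun x hx => by
    rw [hu.leftRL_flux_eq hx, jacobiWeight]; ring
  have hm : AEStronglyMeasurable (leftRL s (flux s α β u)) (volume.restrict (Ioo (-1) 1)) := by
    refine AEStronglyMeasurable.congr
      ((measurable_one_sub_rpow (-α)).aestronglyMeasurable.mul (hI.aestronglyMeasurable.const_mul μ)) ?_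
    exact (ae_restrict_mem measurableSet_Ioo).mono fun x hx => (e x hx).symm
  refine triangleIntegrable_of_right hm
    (measurable_one_sub_rpow (α - s)).aestronglyMeasurable
    (fun y hy => (rightKernel_rpow (by linarith) (by linarith) hy.2).1) ?_
  refine IntegrableOn.congr_fun ((hI.const_mul μ).abs.mul_const
    (ProbabilityTheory.beta s (α - s + 1))) (fun y hy => ?_) measurableSet_Ioo
  have h1 := (rightKernel_rpow (c := α - s) (t := 1 - s) (x := y) (by linarith) (by linarith)
    hy.2).2
  rw [rightKernelIntegral, sub_sub_cancel, show α - s + 1 - (1 - s) = α by ring] at h1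
  have h2 : ∫ x in y..1, |(1 - x) ^ (α - s) / (x - y) ^ (1 - s)| =
      ∫ x in y..1, (1 - x) ^ (α - s) / (x - y) ^ (1 - s) := by
    refine intervalIntegral.integral_congr fun x hx => ?_
    rw [uIcc_of_le hy.2.le] at hx
    exact abs_of_nonneg (div_nonneg (Real.rpow_nonneg (sub_nonneg.2 hx.2) _)
      (Real.rpow_nonneg (sub_nonneg.2 hx.1) _))
  rw [h2, h1, e y hy, abs_mul ((1 - y) ^ (-α)),
    abs_of_nonneg (Real.rpow_nonneg (sub_pos.2 hy.2).le (-α)), Real.rpow_neg (sub_pos.2 hy.2).le]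
  have := (Real.rpow_pos_of_pos (sub_pos.2 hy.2) α).ne'
  field_simp

omit hα in
/-- The flux is an Abel integral up to a multiple of `(1 + x) ^ (s - 1)`. -/
theorem exists_flux_representation :
    ∃ c : ℝ, Tendsto (leftKernelIntegral s (flux s α β u)) (𝓝[>] (-1)) (𝓝 c) ∧
      ∀ᵐ x, x ∈ Ioo (-1 : ℝ) 1 → Real.Gamma s * Real.Gamma (1 - s) * flux s α β u x =
        c * (1 + x) ^ (s - 1) +
          Real.Gamma (1 - s) * leftKernelIntegral (1 - s) (leftRL s (flux s α β u)) x := by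
  have hI := (hu.integrableOn_Ioo hs0).2 hβ
  have hκ : ∀ x ∈ Ioo (-1 : ℝ) 1, IntervalIntegrable
      (fun y => Real.Gamma (1 - s) * leftRL s (flux s α β u) y) volume (-1) x := by
    intro x hx
    refine IntervalIntegrable.const_mul ?_ _
    have h1 : IntervalIntegrable (fun x => (1 + x) ^ β * u x) volume (-1) x :=
      (intervalIntegrable_iff_integrableOn_Ioo_of_le hx.1.le).2
        (hI.mono_set (Ioo_subset_Ioo_right hx.2.le))
    have h2 := h1.continuousOn_mul (g := fun y => μ * (1 - y) ^ (-α)) (fun y hy => by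
      rw [uIcc_of_le hx.1.le] at hy
      exact (continuousAt_const.mul (continuousAt_one_sub_rpow _ (by linarith [hy.2, hx.2]))).continuousWithinAt)
    rw [intervalIntegrable_iff_integrableOn_Ioo_of_le hx.1.le] at h2 ⊢
    refine h2.congr_fun (fun y hy => ?_) measurableSet_Ioo
    simp only
    rw [hu.leftRL_flux_eq ⟨hy.1, hy.2.trans hx.2⟩, jacobiWeight]
    ring
  obtain ⟨c, hc1, hc2⟩ := abel_inversion hs0 hs1 (fun x hx => (hu.hasLeft x hx).1)
    (fun x hx => hu.hasLeft.hasDerivAt hs1 hx) hκ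
  refine ⟨c, hc1, ?_⟩
  rw [beta_self_one_sub] at hc2
  filter_upwards [hc2] with x h1 hx
  rw [h1 hx, leftKernelIntegral_const_mul]

/-- In the Abel representation of the flux, the singular term becomes a Jacobi weight with exponents
`α - s` and `s - 1`, both above `-1`; the other term is integrable by Fubini. -/
theorem integrableOn_rpow_mul_flux :
    IntegrableOn (fun x => (1 - x) ^ (α - s) * flux s α β u x) (Ioo (-1) 1) := by
  obtain ⟨c, -, hc⟩ := hu.exists_flux_representation hs0 hs1 hβ
  have h1 := (hu.triangle_leftRL hs0 hα hβ).integrableOn_left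
  have h2 := integrableOn_jacobiWeight (a := α - s) (b := s - 1) (by linarith) (by linarith)
  have g1 := Real.Gamma_pos_of_pos hs0
  have g2 := Real.Gamma_pos_of_pos (sub_pos.2 hs1)
  refine ((h1.div_const (Real.Gamma s)).add
    (h2.const_mul (c / (Real.Gamma s * Real.Gamma (1 - s))))).congr ?_
  filter_upwards [ae_restrict_of_ae hc, ae_restrict_mem measurableSet_Ioo] with x h hx
  have := h hx
  rw [leftKernelIntegral] at this
  simp only [Pi.add_apply, jacobiWeight]
  field_simp
  linear_combination (-(1 - x) ^ (α - s)) * this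

theorem intervalIntegrable_rightRL {x : ℝ} (hx : x ∈ Ioo (-1 : ℝ) 1) :
    IntervalIntegrable (rightRL s u) volume x 1 := by
  have h1 : IntervalIntegrable (fun x => (1 - x) ^ (α - s) * flux s α β u x) volume x 1 :=
    (intervalIntegrable_iff_integrableOn_Ioo_of_le hx.2.le).2
      ((hu.integrableOn_rpow_mul_flux hs0 hs1 hα hβ).mono_set (Ioo_subset_Ioo_left hx.1.le))
  have h2 := h1.continuousOn_mul (g := fun y => (1 + y) ^ (-β - s)) (fun y hy => by
    rw [uIcc_of_le hx.2.le] at hy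
    exact (continuousAt_one_add_rpow _ (by linarith [hy.1, hx.1])).continuousWithinAt)
  rw [intervalIntegrable_iff_integrableOn_Ioo_of_le hx.2.le] at h2 ⊢
  exact h2.congr_fun (fun y hy =>
    (rightRL_eq_flux ⟨hx.1.trans hy.1, hy.2⟩).symm) measurableSet_Ioo

/-- The solution is an Abel integral up to a multiple of `(1 - x) ^ (s - 1)`. -/
theorem exists_representation :
    ∃ c : ℝ, Tendsto (rightKernelIntegral s u) (𝓝[<] 1) (𝓝 c) ∧
      ∀ᵐ x, x ∈ Ioo (-1 : ℝ) 1 → Real.Gamma s * Real.Gamma (1 - s) * u x =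
        c * (1 - x) ^ (s - 1) +
          Real.Gamma (1 - s) * rightKernelIntegral (1 - s) (rightRL s u) x := by
  obtain ⟨c, hc1, hc2⟩ := abel_inversion_right hs0 hs1 (fun x hx => (hu.hasRight x hx).1)
    (fun x hx => hu.hasRight.hasDerivAt hs1 hx)
    (fun x hx => (hu.intervalIntegrable_rightRL hs0 hs1 hα hβ hx).const_mul _)
  refine ⟨c, hc1, ?_⟩
  rw [beta_self_one_sub] at hc2
  filter_upwards [hc2] with x h1 hx
  rw [h1 hx]
  simp only [rightKernelIntegral, mul_div_assoc, intervalIntegral.integral_const_mul]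

/-- The mirror image of `triangle_leftRL`: the inner integral of `(1+y)^β` is a constant times
`(1+x)^(β+s)`, cancelling the factor by which the right derivative differs from the integrable
`(1-x)^(α-s) * flux`. -/
theorem triangle_rightRL :
    TriangleIntegrable (-1) 1 (1 - s) (fun y => (1 + y) ^ β) (rightRL s u) := by
  have hI := hu.integrableOn_rpow_mul_flux hs0 hs1 hα hβ
  have hm : AEStronglyMeasurable (rightRL s u) (volume.restrict (Ioo (-1) 1)) := by
    refine AEStronglyMeasurable.congr
      ((measurable_one_add_rpow (-β - s)).aestronglyMeasurable.mul hI.aestronglyMeasurable) ?_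
    exact (ae_restrict_mem measurableSet_Ioo).mono fun x hx =>
      (rightRL_eq_flux hx).symm
  refine triangleIntegrable_of_left
    (measurable_one_add_rpow β).aestronglyMeasurable hm
    (fun x hx => (leftKernel_rpow hβ (by linarith) hx.1).1) ?_
  refine IntegrableOn.congr_fun (hI.abs.mul_const
    (ProbabilityTheory.beta s (β + 1))) (fun x hx => ?_) measurableSet_Ioo
  have h1 := (leftKernel_rpow (c := β) (t := 1 - s) (x := x) hβ (by linarith) hx.1).2
  rw [leftKernelIntegral, sub_sub_cancel, show β + 1 - (1 - s) = β + s by ring] at h1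
  have h2 : ∫ y in (-1)..x, |(1 + y) ^ β / (x - y) ^ (1 - s)| =
      ∫ y in (-1)..x, (1 + y) ^ β / (x - y) ^ (1 - s) := by
    refine intervalIntegral.integral_congr fun y hy => ?_
    rw [uIcc_of_le hx.1.le] at hy
    exact abs_of_nonneg (div_nonneg (Real.rpow_nonneg (by linarith [hy.1]) _)
      (Real.rpow_nonneg (sub_nonneg.2 hy.2) _))
  have hx1 : 0 < 1 + x := by linarith [hx.1]
  rw [h2, h1, rightRL_eq_flux (α := α) (β := β) hx, abs_mul ((1 + x) ^ (-β - s)),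
    abs_of_nonneg (Real.rpow_nonneg hx1.le (-β - s)), show -β - s = -(β + s) by ring,
    Real.rpow_neg hx1.le]
  have := (Real.rpow_pos_of_pos hx1 (β + s)).ne'
  field_simp

end Homogeneous

end IsBVPSolution

end

/-! ### Strict monotonicity of the eigenvalues and the moment identity -/

section

theorem integral_congr_ae_Ioo {f g : ℝ → ℝ} (h : ∀ᵐ x, x ∈ Ioo (-1 : ℝ) 1 → f x = g x) :
    ∫ x in (-1 : ℝ)..1, f x = ∫ x in (-1 : ℝ)..1, g x := by
  simp only [intervalIntegral.integral_of_le (show (-1 : ℝ) ≤ 1 by norm_num),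
    integral_Ioc_eq_integral_Ioo]
  exact setIntegral_congr_ae measurableSet_Ioo h

theorem baseEigenvalue_pos {s α β : ℝ} (hs0 : 0 < s) (hα : s - 1 < α) (hβ : -1 < β) (n : ℕ) :
    0 < baseEigenvalue s α β n := by
  have hn : (0 : ℝ) ≤ n := n.cast_nonneg
  have h1 := Real.Gamma_pos_of_pos (show 0 < n + α + 1 by linarith)
  have h2 := Real.Gamma_pos_of_pos (show 0 < n + β + s + 1 by linarith)
  have h3 := Real.Gamma_pos_of_pos (show 0 < n + α - s + 1 by linarith)
  have h4 := Real.Gamma_pos_of_pos (show 0 < n + β + 1 by linarith)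
  rw [baseEigenvalue]; positivity

/-- The quotient of consecutive eigenvalues is `(n+α+1)(n+β+s+1) / ((n+α-s+1)(n+β+1))`, which
exceeds `1` because `s > 0`. -/
theorem baseEigenvalue_strictMono {s α β : ℝ} (hs0 : 0 < s) (hα : s - 1 < α) (hβ : -1 < β) :
    StrictMono (baseEigenvalue s α β) := by
  refine strictMono_nat_of_lt_succ fun n => ?_
  have hn : (0 : ℝ) ≤ n := n.cast_nonneg
  have hpos := baseEigenvalue_pos hs0 hα hβ n
  have p1 : 0 < n + α + 1 := by linarith
  have p2 : 0 < n + β + s + 1 := by linarith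
  have p3 : 0 < n + α - s + 1 := by linarith
  have p4 : 0 < n + β + 1 := by linarith
  have e : baseEigenvalue s α β (n + 1) = baseEigenvalue s α β n *
      ((n + α + 1) * (n + β + s + 1) / ((n + α - s + 1) * (n + β + 1))) := by
    rw [baseEigenvalue, baseEigenvalue]
    push_cast
    rw [show (n : ℝ) + 1 + α + 1 = n + α + 1 + 1 by ring,
      show (n : ℝ) + 1 + β + s + 1 = n + β + s + 1 + 1 by ring,
      show (n : ℝ) + 1 + α - s + 1 = n + α - s + 1 + 1 by ring,
      show (n : ℝ) + 1 + β + 1 = n + β + 1 + 1 by ring,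
      Real.Gamma_add_one p1.ne', Real.Gamma_add_one p2.ne', Real.Gamma_add_one p3.ne',
      Real.Gamma_add_one p4.ne']
    have h3 := (Real.Gamma_pos_of_pos p3).ne'
    have h4 := (Real.Gamma_pos_of_pos p4).ne'
    field_simp
  rw [e]
  refine lt_mul_of_one_lt_right hpos ((one_lt_div (by positivity)).2 ?_)
  nlinarith

section

variable {s α β μ : ℝ} {u : ℝ → ℝ}

theorem integrableOn_mul_jacobiK (hs0 : 0 < s) (hβ : -1 < β) {F : ℝ → ℝ}
    (hu : IsBVPSolution s α β μ F u) (m : ℕ) :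
    IntegrableOn (fun x => u x * jacobiK α β m x) (Ioo (-1) 1) := by
  refine (integrableOn_mul_continuous ((hu.integrableOn_Ioo hs0).2 hβ)
    (continuous_jacobiP α β m)).congr_fun (fun x _ => ?_) measurableSet_Ioo
  simp only [jacobiK]; ring

/-- The moments of a solution of the homogeneous problem against the Jacobi polynomials are
determined by its two singular boundary values. -/
theorem IsBVPSolution.moment_identity (hs0 : 0 < s) (hs1 : s < 1) (hα : s - 1 < α) (hβ : -1 < β)
    (hu : IsBVPSolution s α β μ (fun _ => 0) u) {c₀ c₁ : ℝ}
    (h₀ : Tendsto (leftKernelIntegral s (flux s α β u)) (𝓝[>] (-1)) (𝓝 c₀))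
    (h₁ : Tendsto (rightKernelIntegral s u) (𝓝[<] 1) (𝓝 c₁)) (m : ℕ) :
    Real.Gamma (1 - s) * ((baseEigenvalue s α β m - μ) * ∫ x in (-1)..1, u x * jacobiK α β m x) =
      Real.Gamma (m + α + 1) / Real.Gamma (m + α - s + 1) * jacobiK (α - s) (β + s) m 1 * c₁ +
        jacobiJ α β m (-1) * c₀ := by
  obtain ⟨c, hc, e0⟩ := hu.exists_flux_representation hs0 hs1 hβ
  obtain rfl := tendsto_nhds_unique hc h₀
  obtain ⟨c', hc', e1⟩ := hu.exists_representation hs0 hs1 hα hβ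
  obtain rfl := tendsto_nhds_unique hc' h₁
  have hm : (0 : ℝ) ≤ m := m.cast_nonneg
  have gs := (Real.Gamma_pos_of_pos hs0).ne'
  have g1s := (Real.Gamma_pos_of_pos (sub_pos.2 hs1)).ne'
  have ga := (Real.Gamma_pos_of_pos (show 0 < m + α + 1 by linarith)).ne'
  have gas := (Real.Gamma_pos_of_pos (show 0 < m + α - s + 1 by linarith)).ne'
  have gb := (Real.Gamma_pos_of_pos (show 0 < m + β + 1 by linarith)).ne'
  have gbs := (Real.Gamma_pos_of_pos (show 0 < m + β + s + 1 by linarith)).ne'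
  -- Two integrations by parts are prepared: `T1` pairs the left derivative of the flux with
  -- `J_m^{(α-s,β+s)}`, and `T2` pairs the right derivative of `u` with `(1+x)^β P_m^{(α,β)}`.
  have T1 : TriangleIntegrable (-1) 1 (1 - s) (leftRL s (flux s α β u))
    (jacobiJ (α - s) (β + s) m) := (hu.triangle_leftRL hs0 hα hβ).mul_continuous_fst
      (continuous_jacobiP (α - s) (β + s) m)
  have T2 : TriangleIntegrable (-1) 1 (1 - s) (jacobiK α β m) (rightRL s u) :=
    (hu.triangle_rightRL hs0 hs1 hα hβ).mul_continuous_snd (continuous_jacobiP α β m)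
  have R : ∀ y < 1, ∫ x in y..1, jacobiJ (α - s) (β + s) m x / (x - y) ^ (1 - s) =
      Real.Gamma s * Real.Gamma (m + α - s + 1) / Real.Gamma (m + α + 1) * jacobiJ α β m y := by
    intro y hy
    have := (rightKernel_jacobiJ (a := α - s) (b := β + s) (t := 1 - s) (by linarith)
      (by linarith) m hy).2
    rw [rightKernelIntegral] at this
    rw [this]
    congr 2 <;> ring_nf
  have Lf : ∀ x, -1 < x → ∫ y in (-1)..x, jacobiK α β m y / (x - y) ^ (1 - s) =
      Real.Gamma s * Real.Gamma (m + β + 1) / Real.Gamma (m + β + s + 1) *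
        jacobiK (α - s) (β + s) m x := by
    intro x hx
    have := (leftKernel_jacobiK (a := α) (b := β) (t := 1 - s) (by linarith) hβ
      (by linarith) m hx).2
    rw [leftKernelIntegral] at this
    rw [this]
    congr 2 <;> ring_nf
  have h11 : (-1 : ℝ) ≤ 1 := by norm_num
  have I1 : IntervalIntegrable (fun x => jacobiJ (α - s) (β + s) m x / (x - -1) ^ (1 - s))
    volume (-1) 1 := (rightKernel_jacobiJ (by linarith) (by linarith) m (by norm_num)).1
  have I2 : IntervalIntegrable (fun y => jacobiK α β m y / (1 - y) ^ (1 - s)) volume (-1) 1 :=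
    (leftKernel_jacobiK (by linarith) hβ (by linarith) m (by norm_num)).1
  have F1 := T1.integral_eq h11
  have F2 := T2.integral_eq h11
  -- The fractional integral of order `s` restores `⁺J_m`, and the equation replaces the left
  -- derivative by `μ u` times the weight.
  have A1 : ∫ y in (-1)..1, leftRL s (flux s α β u) y *
      ∫ x in y..1, jacobiJ (α - s) (β + s) m x / (x - y) ^ (1 - s) =
      Real.Gamma s * Real.Gamma (m + α - s + 1) / Real.Gamma (m + α + 1) * μ *
        ∫ x in (-1)..1, u x * jacobiK α β m x := by
    rw [← intervalIntegral.integral_const_mul]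
    refine integral_congr_ae_Ioo (Eventually.of_forall fun y hy => ?_)
    rw [R y hy.2, hu.leftRL_flux_eq hy, ← jacobiJ_mul_weight m hy]
    ring
  -- The Abel integral equals the flux minus its singular part, up to constants. Paired with
  -- `J_m^{(α-s,β+s)}`, the singular part is a fractional integral evaluated at `-1`, which produces
  -- the boundary value `⁺J_m(-1)`.
  have A2 : Real.Gamma (1 - s) * ∫ x in (-1)..1, jacobiJ (α - s) (β + s) m x *
      ∫ y in (-1)..x, leftRL s (flux s α β u) y / (x - y) ^ (1 - s) =
      Real.Gamma s * Real.Gamma (1 - s) *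
        (∫ x in (-1)..1, rightRL s u x * jacobiK (α - s) (β + s) m x) -
      c * (Real.Gamma s * Real.Gamma (m + α - s + 1) / Real.Gamma (m + α + 1) *
        jacobiJ α β m (-1)) := by
    rw [← R (-1) (by norm_num), ← intervalIntegral.integral_const_mul,
      ← intervalIntegral.integral_const_mul, ← intervalIntegral.integral_const_mul,
      ← intervalIntegral.integral_sub]
    · refine integral_congr_ae_Ioo ?_
      filter_upwards [e0] with x hx0 hx
      have hx1 : 0 ≤ 1 + x := by linarith [hx.1]
      have h := hx0 hx
      have h2 : jacobiJ (α - s) (β + s) m x / (x - -1) ^ (1 - s) =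
          jacobiJ (α - s) (β + s) m x * (1 + x) ^ (s - 1) := by
        rw [mul_rpow_eq_div hx1 _ (show s - 1 = -(1 - s) by ring), sub_neg_eq_add, add_comm x]
      have h3 : rightRL s u x * jacobiK (α - s) (β + s) m x =
          jacobiJ (α - s) (β + s) m x * flux s α β u x := by
        have := (Real.rpow_pos_of_pos (show 0 < 1 + x by linarith [hx.1]) (β + s)).ne'
        rw [rightRL_eq_flux (α := α) (β := β) hx, jacobiJ, jacobiK,
          show -β - s = -(β + s) by ring, Real.rpow_neg hx1]
        field_simp
      rw [leftKernelIntegral] at h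
      rw [h2, h3]
      linear_combination (-jacobiJ (α - s) (β + s) m x) * h
    · refine IntervalIntegrable.const_mul ?_ _
      have hI := hu.integrableOn_rpow_mul_flux hs0 hs1 hα hβ
      rw [intervalIntegrable_iff_integrableOn_Ioo_of_le h11]
      refine (integrableOn_mul_continuous hI (continuous_jacobiP (α - s) (β + s) m)).congr_fun
        (fun x hx => ?_) measurableSet_Ioo
      have hx1 : 0 ≤ 1 + x := by linarith [hx.1]
      have := (Real.rpow_pos_of_pos (show 0 < 1 + x by linarith [hx.1]) (β + s)).ne'
      simp only
      rw [rightRL_eq_flux (α := α) (β := β) hx, jacobiK, show -β - s = -(β + s) by ring,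
        Real.rpow_neg hx1]
      field_simp
    · exact I1.const_mul c
  have A3 : ∫ x in (-1)..1, rightRL s u x *
      ∫ y in (-1)..x, jacobiK α β m y / (x - y) ^ (1 - s) =
      Real.Gamma s * Real.Gamma (m + β + 1) / Real.Gamma (m + β + s + 1) *
        ∫ x in (-1)..1, rightRL s u x * jacobiK (α - s) (β + s) m x := by
    rw [← intervalIntegral.integral_const_mul]
    refine integral_congr_ae_Ioo (Eventually.of_forall fun y hy => ?_)
    rw [Lf y hy.1]
    ring
  -- The same at the other end: the singular part of `u` produces the value at `1` of the fractional
  -- integral.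
  have A4 : Real.Gamma (1 - s) * ∫ y in (-1)..1, jacobiK α β m y *
      ∫ x in y..1, rightRL s u x / (x - y) ^ (1 - s) =
      Real.Gamma s * Real.Gamma (1 - s) * (∫ x in (-1)..1, u x * jacobiK α β m x) -
      c' * (Real.Gamma s * Real.Gamma (m + β + 1) / Real.Gamma (m + β + s + 1) *
        jacobiK (α - s) (β + s) m 1) := by
    rw [← Lf 1 (by norm_num), ← intervalIntegral.integral_const_mul,
      ← intervalIntegral.integral_const_mul, ← intervalIntegral.integral_const_mul,
      ← intervalIntegral.integral_sub]
    · refine integral_congr_ae_Ioo ?_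
      filter_upwards [e1] with x hx0 hx
      have h := hx0 hx
      have h2 : jacobiK α β m x / (1 - x) ^ (1 - s) = jacobiK α β m x * (1 - x) ^ (s - 1) := by
        rw [mul_rpow_eq_div (sub_pos.2 hx.2).le _ (show s - 1 = -(1 - s) by ring)]
      rw [rightKernelIntegral] at h
      rw [h2]
      linear_combination (-jacobiK α β m x) * h
    · exact ((intervalIntegrable_iff_integrableOn_Ioo_of_le h11).2
        (integrableOn_mul_jacobiK hs0 hβ hu m)).const_mul _
    · exact I2.const_mul c'
  rw [A1] at F1
  rw [← F1] at A2
  rw [F2, A3] at A4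
  generalize (∫ x in (-1)..1, u x * jacobiK α β m x) = I at *
  generalize (∫ x in (-1)..1, rightRL s u x * jacobiK (α - s) (β + s) m x) = W at *
  rw [baseEigenvalue]
  clear T1 T2 R Lf I1 I2 F1 F2 A1 A3 e0 e1
  field_simp at A2 A4 ⊢
  generalize Real.Gamma (m + α - s + 1) = g1 at *
  generalize Real.Gamma (m + α + 1) = g2 at *
  generalize Real.Gamma (m + β + s + 1) = g3 at *
  generalize Real.Gamma (m + β + 1) = g4 at *
  generalize Real.Gamma (1 - s) = g5 at *
  -- Eliminates the common mixed integral `W` from the two integrations by parts.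
  linear_combination (-g4) * A2 - g2 * A4

end

end

section

/-! ### Completeness and orthogonality -/

/-- An integrable function on `(-1,1)` all of whose moments vanish is zero almost everywhere. -/
theorem ae_eq_zero_of_moments_eq_zero {f : ℝ → ℝ} (hf : IntegrableOn f (Ioo (-1) 1))
    (h : ∀ l : ℕ, ∫ x in (-1 : ℝ)..1, f x * x ^ l = 0) : ∀ᵐ x, x ∈ Ioo (-1 : ℝ) 1 → f x = 0 := by
  have hpow : ∀ l : ℕ, IntegrableOn (fun x => f x * x ^ l) (Ioo (-1) 1) := fun l =>
    integrableOn_mul_continuous hf (continuous_pow l)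
  have h' : ∀ l : ℕ, ∫ x in Ioo (-1 : ℝ) 1, f x * x ^ l = 0 := fun l => by
    rw [← h l, intervalIntegral.integral_of_le (by norm_num), integral_Ioc_eq_integral_Ioo]
  have hpoly : ∀ p : Polynomial ℝ, ∫ x in Ioo (-1 : ℝ) 1, f x * p.eval x = 0 := by
    intro p
    have e : ∀ x, f x * p.eval x =
        ∑ l ∈ Finset.range (p.natDegree + 1), p.coeff l * (f x * x ^ l) := fun x => by
      rw [Polynomial.eval_eq_sum_range, Finset.mul_sum]
      exact Finset.sum_congr rfl fun _ _ => by ring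
    simp only [e]
    rw [integral_finsetSum _ fun l _ => (hpow l).const_mul _]
    refine Finset.sum_eq_zero fun l _ => ?_
    rw [integral_const_mul, h' l, mul_zero]
  -- Smooth test functions are approximated uniformly by polynomials, against which the integrals
  -- vanish.
  refine isOpen_Ioo.ae_eq_zero_of_integral_contDiff_smul_eq_zero hf.locallyIntegrableOn ?_
  intro g hg _ hsupp
  have hzero : ∀ x, x ∉ Ioo (-1 : ℝ) 1 → g x • f x = 0 := fun x hx => by
    rw [image_eq_zero_of_notMem_tsupport fun hh => hx (hsupp hh), zero_smul]
  rw [← setIntegral_eq_integral_of_forall_compl_eq_zero hzero]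
  have hbound : ∀ ε > 0, |∫ x in Ioo (-1 : ℝ) 1, g x • f x| ≤
      ε * ∫ x in Ioo (-1 : ℝ) 1, |f x| := by
    intro ε hε
    obtain ⟨p, hp⟩ := exists_polynomial_near_of_continuousOn (-1) 1 g hg.continuous.continuousOn
      ε hε
    have hi1 : IntegrableOn (fun x => f x * g x) (Ioo (-1) 1) :=
      integrableOn_mul_continuous hf hg.continuous
    have hi2 : IntegrableOn (fun x => f x * p.eval x) (Ioo (-1) 1) :=
      integrableOn_mul_continuous hf p.continuous
    have e : ∫ x in Ioo (-1 : ℝ) 1, g x • f x =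
        ∫ x in Ioo (-1 : ℝ) 1, (f x * g x - f x * p.eval x) := by
      rw [integral_sub hi1 hi2, hpoly p, sub_zero]
      simp only [smul_eq_mul, mul_comm]
    rw [e, ← integral_const_mul, ← Real.norm_eq_abs]
    refine (norm_integral_le_integral_norm _).trans
      (setIntegral_mono_on (hi1.sub hi2).norm (hf.abs.const_mul ε) measurableSet_Ioo ?_)
    intro x hx
    have := hp x (Ioo_subset_Icc_self hx)
    rw [Real.norm_eq_abs, ← mul_sub, abs_mul, mul_comm]
    rw [abs_sub_comm] at this
    exact mul_le_mul_of_nonneg_right this.le (abs_nonneg _)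
  have hlim : Tendsto (fun ε : ℝ => ε * ∫ x in Ioo (-1 : ℝ) 1, |f x|) (𝓝[>] 0) (𝓝 0) := by
    have : Tendsto (fun ε : ℝ => ε * ∫ x in Ioo (-1 : ℝ) 1, |f x|) (𝓝 0) (𝓝 0) := by
      have := (tendsto_id (x := 𝓝 (0 : ℝ))).mul_const (∫ x in Ioo (-1 : ℝ) 1, |f x|)
      rwa [zero_mul] at this
    exact this.mono_left nhdsWithin_le_nhds
  have := ge_of_tendsto hlim (eventually_nhdsWithin_of_forall fun ε hε => hbound ε hε)
  exact abs_eq_zero.1 (le_antisymm this (abs_nonneg _))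

section

variable {s α β μ : ℝ} {u : ℝ → ℝ}

theorem weightedInner_jacobiJ (u : ℝ → ℝ) (m : ℕ) :
    weightedInner α β u (jacobiJ α β m) = ∫ x in (-1 : ℝ)..1, u x * jacobiK α β m x :=
  integral_congr_ae_Ioo (Eventually.of_forall fun x hx => by
    rw [mul_assoc, jacobiJ_mul_weight m hx])

theorem isBVPSolution_jacobiJ_self (hs0 : 0 < s) (hs1 : s < 1) (hα : s - 1 < α) (hβ : -1 < β)
    (n : ℕ) : IsBVPSolution s α β (baseEigenvalue s α β n) (fun _ => 0) (jacobiJ α β n) :=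
  (isBVPSolution_jacobiJ hs0 hs1 hα hβ (baseEigenvalue s α β n) n).congr_rhs fun x _ => by simp

/-- Apply the moment identity to `⁺J_n` itself. Both singular boundary values vanish, because the
kernel integrals carry the positive powers `(1+x)^(β+1)` and `(1-x)^(α+1-s)`; what remains is `(Λ_m
- Λ_n) ⟨⁺J_n, ⁺J_m⟩ = 0`. -/
theorem weightedInner_jacobiJ_of_ne (hs0 : 0 < s) (hs1 : s < 1) (hα : s - 1 < α) (hβ : -1 < β)
    {m n : ℕ} (hmn : m ≠ n) : weightedInner α β (jacobiJ α β n) (jacobiJ α β m) = 0 := by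
  have h₀ : Tendsto (leftKernelIntegral s (flux s α β (jacobiJ α β n))) (𝓝[>] (-1)) (𝓝 0) := by
    have h : ContinuousAt (fun x => Real.Gamma (n + α + 1) / Real.Gamma (n + α - s + 1) *
        (Real.Gamma (1 - s) * Real.Gamma (n + (β + s) + 1) / Real.Gamma (n + (β + s) + 2 - s) *
          jacobiK (α - s - 1 + s) (β + s + 1 - s) n x)) (-1) :=
      continuousAt_const.mul (continuousAt_const.mul
        (((continuousAt_const.add continuousAt_id).rpow_const (Or.inr (by linarith))).mul
          (continuous_jacobiP _ _ n).continuousAt))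
    have h2 := h.tendsto.mono_left (nhdsWithin_le_nhds (s := Ioi (-1)))
    simp only [jacobiK, add_neg_cancel, Real.zero_rpow (show β + s + 1 - s ≠ 0 by linarith),
      zero_mul, mul_zero] at h2
    refine h2.congr' ?_
    filter_upwards [Ioo_mem_nhdsGT_neg_one] with x hx
    rw [leftKernelIntegral_congr (fun y hy => flux_jacobiJ hs0 hs1 hα n hy.2) hx,
      leftKernelIntegral_const_mul,
      (leftKernel_jacobiK (a := α - s) (b := β + s) (by linarith) (by linarith) hs1 n hx.1).2,
      jacobiK]
  have h₁ : Tendsto (rightKernelIntegral s (jacobiJ α β n)) (𝓝[<] 1) (𝓝 0) := by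
    have h : ContinuousAt (fun x => Real.Gamma (1 - s) * Real.Gamma (n + α + 1) /
        Real.Gamma (n + α + 2 - s) * jacobiJ (α + 1 - s) (β - 1 + s) n x) 1 :=
      continuousAt_const.mul
        (((continuousAt_const.sub continuousAt_id).rpow_const (Or.inr (by linarith))).mul
          (continuous_jacobiP _ _ n).continuousAt)
    have h2 := h.tendsto.mono_left (nhdsWithin_le_nhds (s := Iio 1))
    simp only [jacobiJ, sub_self, Real.zero_rpow (show α + 1 - s ≠ 0 by linarith),
      zero_mul, mul_zero] at h2
    refine h2.congr' ?_
    filter_upwards [Ioo_mem_nhdsLT_one] with x hx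
    rw [(rightKernel_jacobiJ (by linarith) hs1 n hx.2).2, jacobiJ]
  have h := (isBVPSolution_jacobiJ_self hs0 hs1 hα hβ n).moment_identity hs0 hs1 hα hβ h₀ h₁ m
  rw [mul_zero, mul_zero, add_zero, ← weightedInner_jacobiJ] at h
  have h1 := (Real.Gamma_pos_of_pos (sub_pos.2 hs1)).ne'
  have h2 : baseEigenvalue s α β m - baseEigenvalue s α β n ≠ 0 :=
    sub_ne_zero.2 ((baseEigenvalue_strictMono hs0 hα hβ).injective.ne hmn)
  simpa [h1, h2] using h

/-- The moments `∫ u P_m (1 + x) ^ β` determine `u` almost everywhere. -/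
theorem ae_eq_zero_of_weightedInner_eq_zero (hαβ : -2 < α + β)
    (hu : IntegrableOn (fun x => (1 + x) ^ β * u x) (Ioo (-1) 1))
    (h : ∀ m, weightedInner α β u (jacobiJ α β m) = 0) :
    ∀ᵐ x, x ∈ Ioo (-1 : ℝ) 1 → u x = 0 := by
  have hi : ∀ m, IntervalIntegrable (fun x => u x * jacobiK α β m x) volume (-1) 1 := fun m => by
    rw [intervalIntegrable_iff_integrableOn_Ioo_of_le (by norm_num)]
    refine (integrableOn_mul_continuous hu (continuous_jacobiP α β m)).congr_fun (fun x _ => ?_)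
      measurableSet_Ioo
    simp only [jacobiK]; ring
  have hmom : ∀ l : ℕ, ∫ x in (-1 : ℝ)..1, (1 + x) ^ β * u x * x ^ l = 0 := fun l => by
    -- The connection formula for `P_0 = 1` expands the monomial `x ^ l` in Jacobi polynomials.
    have e : ∀ x : ℝ, (1 + x) ^ β * u x * x ^ l =
        ∑ m ∈ Finset.Icc (0 - l) (0 + l), jacobiB α β l 0 (0 + l + 1 - m) *
          (u x * jacobiK α β m x) := fun x => by
      have := pow_mul_jacobiP hαβ l 0 x
      rw [jacobiP_zero, mul_one] at this
      rw [this, Finset.mul_sum]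
      refine Finset.sum_congr rfl fun m _ => ?_
      rw [jacobiK]; ring
    simp only [e]
    rw [intervalIntegral.integral_finsetSum fun m _ => (hi m).const_mul _]
    refine Finset.sum_eq_zero fun m _ => ?_
    rw [intervalIntegral.integral_const_mul, ← weightedInner_jacobiJ, h m, mul_zero]
  filter_upwards [ae_eq_zero_of_moments_eq_zero hu hmom] with x hx hxm
  have := (Real.rpow_pos_of_pos (show 0 < 1 + x by linarith [hxm.1]) β).ne'
  exact (mul_eq_zero.1 (hx hxm)).resolve_left this

theorem jacobiJ_neg_one_ne_zero (hαβ : -2 < α + β) (hβ : -1 < β) (n : ℕ) :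
    jacobiJ α β n (-1) ≠ 0 := by
  rw [jacobiJ]
  exact mul_ne_zero (Real.rpow_pos_of_pos (by norm_num) _).ne'
    (jacobiP_apply_neg_one_ne_zero hαβ hβ n)

/-- The generalized Jacobi functions do not vanish identically near `-1`. -/
theorem eventually_jacobiJ_ne_zero (hαβ : -2 < α + β) (hβ : -1 < β) (n : ℕ) :
    ∀ᶠ x in 𝓝[>] (-1), jacobiJ α β n x ≠ 0 := by
  have h : ContinuousAt (jacobiJ α β n) (-1) :=
    (continuousAt_one_sub_rpow α (by norm_num)).mul (continuous_jacobiP α β n).continuousAt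
  exact nhdsWithin_le_nhds (h.eventually_ne (jacobiJ_neg_one_ne_zero hαβ hβ n))

theorem not_ae_jacobiJ_eq_zero (hαβ : -2 < α + β) (hβ : -1 < β) (n : ℕ) :
    ¬ ∀ᵐ x, x ∈ Ioo (-1 : ℝ) 1 → jacobiJ α β n x = 0 := by
  intro h
  obtain ⟨b, hb, hsub⟩ := (mem_nhdsGT_iff_exists_mem_Ioc_Ioo_subset
    (show (-1 : ℝ) < 0 by norm_num)).1 (eventually_jacobiJ_ne_zero hαβ hβ n)
  have h2 : volume (Ioo (-1) b) = 0 := by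
    refine measure_mono_null (fun x hx => ?_) h
    exact fun hh => hsub hx (hh ⟨hx.1, by linarith [hx.2, hb.2]⟩)
  rw [Real.volume_Ioo, ENNReal.ofReal_eq_zero] at h2
  linarith [hb.1]

theorem weightedInner_jacobiJ_self_pos (hα : -1 < α) (hβ : -1 < β) (n : ℕ) :
    0 < weightedInner α β (jacobiJ α β n) (jacobiJ α β n) := by
  have hi := integrableOn_jacobiJ_mul_jacobiJ hα hβ n n
  have h0 : 0 ≤ᵐ[volume.restrict (Ioo (-1 : ℝ) 1)]
      fun x => jacobiJ α β n x * jacobiJ α β n x * jacobiWeight (-α) β x :=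
    (ae_restrict_mem measurableSet_Ioo).mono fun x hx =>
      mul_nonneg (mul_self_nonneg _) (jacobiWeight_nonneg hx)
  rw [weightedInner, intervalIntegral.integral_of_le (by norm_num), integral_Ioc_eq_integral_Ioo]
  refine lt_of_le_of_ne (integral_nonneg_of_ae h0) fun h => ?_
  rw [eq_comm, integral_eq_zero_iff_of_nonneg_ae h0 hi, EventuallyEq,
    ae_restrict_iff' measurableSet_Ioo] at h
  refine not_ae_jacobiJ_eq_zero (α := α) (by linarith) hβ n (h.mono fun x hx hxm => ?_)
  have := hx hxm
  simpa [(jacobiWeight_pos (a := -α) (b := β) hxm).ne'] using this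

/-! ### Vanishing of the singular boundary values -/

/-- If `|u| ≤ M` near `1`, the kernel integral is at most `M` times a constant times `(1-x)^(1-s)`.
-/
theorem tendsto_rightKernelIntegral_of_boundedNear (hs1 : s < 1)
    (hu : BoundedNear (𝓝[<] 1) u) : Tendsto (rightKernelIntegral s u) (𝓝[<] 1) (𝓝 0) := by
  obtain ⟨M, hM⟩ := hu
  obtain ⟨b, hb, hsub⟩ := (mem_nhdsLT_iff_exists_mem_Ico_Ioo_subset
    (show (-1 : ℝ) < 1 by norm_num)).1 hM
  have hlim : Tendsto (fun x : ℝ => M * (ProbabilityTheory.beta (1 - s) (0 + 1) *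
      (1 - x) ^ (0 + 1 - s))) (𝓝[<] 1) (𝓝 0) := by
    have h : ContinuousAt (fun x : ℝ => M * (ProbabilityTheory.beta (1 - s) (0 + 1) *
      (1 - x) ^ (0 + 1 - s))) 1 := continuousAt_const.mul (continuousAt_const.mul
        ((continuousAt_const.sub continuousAt_id).rpow_const (Or.inr (by linarith))))
    have h2 := h.tendsto.mono_left (nhdsWithin_le_nhds (s := Iio 1))
    rwa [sub_self, Real.zero_rpow (by linarith), mul_zero, mul_zero] at h2
  refine squeeze_zero_norm' ?_ hlim
  filter_upwards [Ioo_mem_nhdsLT hb.2] with x hx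
  obtain ⟨h1, h2⟩ := rightKernel_rpow (c := 0) (by norm_num) hs1 hx.2
  rw [← h2, rightKernelIntegral, rightKernelIntegral, ← intervalIntegral.integral_const_mul]
  refine intervalIntegral.norm_integral_le_of_norm_le hx.2.le ?_ (h1.const_mul M)
  have hne : ∀ᵐ y : ℝ, y ≠ 1 := by simp [ae_iff, measure_singleton]
  filter_upwards [hne] with y hy1 hy
  have hy' : y < 1 := lt_of_le_of_ne hy.2 hy1
  rw [Real.rpow_zero, norm_div, Real.norm_eq_abs, Real.norm_eq_abs,
    abs_of_nonneg (Real.rpow_nonneg (sub_pos.2 hy.1).le s), mul_one_div]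
  exact div_le_div_of_nonneg_right (hsub ⟨hx.1.trans hy.1, hy'⟩)
    (Real.rpow_nonneg (sub_pos.2 hy.1).le s)

end

end

/-! ### Exclusion of singular solutions and uniqueness for the homogeneous problem -/

section

/-- Fubini gives integrability of almost every slice; where `f y ≠ 0` this factor can be divided
out. -/
theorem TriangleIntegrable.ae_intervalIntegrable_right {a b t : ℝ} {f k : ℝ → ℝ}
    (h : TriangleIntegrable a b t f k) :
    ∀ᵐ y, y ∈ Ioo a b → f y ≠ 0 →
      IntervalIntegrable (fun x => k x / (x - y) ^ t) volume y b := by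
  have h1 := Integrable.prod_left_ae h
  rw [ae_restrict_iff' measurableSet_Ioo] at h1
  filter_upwards [h1] with y hy hyab hf
  have h2 := ((integrableOn_triangle_fst hyab _).1 (hy hyab)).const_mul (f y)⁻¹
  refine h2.congr fun x _ => ?_
  simp only
  field_simp

section

variable {s α β μ : ℝ} {F u : ℝ → ℝ}

/-- Average the kernel integral over `(x,1)` and put `d = 1 - x`. If the limit is `c`, the result is
close to `c d`. By Fubini it is also at most `d^(1-s)/(1-s) * ∫_x^1 |u|`, and a weighted
Cauchy–Schwarz estimate bounds the last integral by `o(1) d^((α+1)/2)`. Since `1 - s + (α+1)/2 ≥ 1`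
precisely when `α ≥ 2s-1`, the total is `o(d)`. The factor `o(1)`, the tail of the weighted `L²`
norm, covers the borderline case. -/
theorem eq_zero_of_tendsto_rightKernelIntegral (hs0 : 0 < s) (hs1 : s < 1)
    (hαs : 2 * s - 1 ≤ α) (hu : IsBVPSolution s α β μ F u) {c : ℝ}
    (h₁ : Tendsto (rightKernelIntegral s u) (𝓝[<] 1) (𝓝 c)) : c = 0 := by
  by_contra hc
  have hc0 : 0 < |c| := abs_pos.2 hc
  have hui := (hu.integrableOn_Ioo hs0).1
  have hu2 : IntervalIntegrable (fun y => u y ^ 2 * (1 - y) ^ (-α)) volume 0 1 := by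
    have h1 : IntervalIntegrable (fun x => u x ^ 2 * jacobiWeight (-α) β x) volume 0 1 :=
      (intervalIntegrable_iff_integrableOn_Ioo_of_le zero_le_one).2
        (hu.memL2.2.mono_set (Ioo_subset_Ioo_left (by norm_num)))
    have h2 := h1.mul_continuousOn (g := fun y => (1 + y) ^ (-β)) (fun y hy => by
      rw [uIcc_of_le zero_le_one] at hy
      exact (continuousAt_one_add_rpow _ (by linarith [hy.1])).continuousWithinAt)
    refine h2.congr fun y hy => ?_
    rw [uIoc_of_le zero_le_one] at hy
    have h3 : (0 : ℝ) < 1 + y := by linarith [hy.1]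
    have := (Real.rpow_pos_of_pos h3 β).ne'
    simp only [jacobiWeight]
    rw [Real.rpow_neg h3.le]
    field_simp
  have hE : Tendsto (fun x => ∫ y in x..1, u y ^ 2 * (1 - y) ^ (-α)) (𝓝[<] 1) (𝓝 0) := by
    have h1 := intervalIntegral.continuousOn_primitive_interval_left
      (f := fun y => u y ^ 2 * (1 - y) ^ (-α)) (μ := volume) (a := 0) (b := 1)
      (by
        rw [uIcc_of_le zero_le_one, integrableOn_Icc_iff_integrableOn_Ioo]
        exact (intervalIntegrable_iff_integrableOn_Ioo_of_le zero_le_one).1 hu2)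
    have h2 := h1 1 right_mem_uIcc
    rw [ContinuousWithinAt, intervalIntegral.integral_same] at h2
    refine h2.mono_left ?_
    rw [← nhdsWithin_Ioo_eq_nhdsLT (show (0 : ℝ) < 1 by norm_num), uIcc_of_le zero_le_one]
    exact nhdsWithin_mono _ Ioo_subset_Icc_self
  -- `C` collects the constants of the upper bound, and `ε` is chosen so that `C ε = |c|/4`.
  obtain ⟨C, hCdef⟩ : ∃ C, C = (1 + 1 / (α + 1)) / (2 * (1 - s)) := ⟨_, rfl⟩
  have hα1 : 0 < α + 1 := by linarith
  have hs1' : 0 < 1 - s := by linarith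
  have hC : 0 < C := by rw [hCdef]; positivity
  obtain ⟨ε, hεdef⟩ : ∃ ε, ε = |c| / (4 * C) := ⟨_, rfl⟩
  have hε : 0 < ε := by rw [hεdef]; positivity
  have hnear : ∀ᶠ x in 𝓝[<] (1 : ℝ), |rightKernelIntegral s u x - c| ≤ |c| / 2 := by
    have := (h₁.sub_const c).abs
    rw [sub_self, abs_zero] at this
    exact (this.eventually (gt_mem_nhds (half_pos hc0))).mono fun _ h => h.le
  obtain ⟨b, hb, hsub⟩ := (mem_nhdsLT_iff_exists_mem_Ico_Ioo_subset
    (show (0 : ℝ) < 1 by norm_num)).1 hnear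
  obtain ⟨x, hxE, hxb⟩ := ((hE.eventually (gt_mem_nhds (show 0 < ε ^ 2 by positivity))).and
    (Ioo_mem_nhdsLT hb.2)).exists
  have hx0 : 0 < x := hb.1.trans_lt hxb.1
  have hx1 : x < 1 := hxb.2
  obtain ⟨d, hd⟩ : ∃ d, d = 1 - x := ⟨_, rfl⟩
  have hd0 : 0 < d := by linarith
  have hux : IntervalIntegrable u volume x 1 :=
    (intervalIntegrable_iff_integrableOn_Ioo_of_le hx1.le).2
      (hui.mono_set (Ioo_subset_Ioo_left (by linarith)))
  have hux' := (intervalIntegrable_iff_integrableOn_Ioo_of_le hx1.le).1 hux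
  have hker : ∀ z, x < z → ∫ y in x..z, 1 / (z - y) ^ s = (z - x) ^ (1 - s) / (1 - s) := by
    intro z hz
    rw [← integral_rpow_sub_right hs1']
    refine intervalIntegral.integral_congr fun y hy => ?_
    rw [uIcc_of_le hz.le] at hy
    rw [← mul_rpow_eq_div (sub_nonneg.2 hy.2) 1 (show 1 - s - 1 = -s by ring), one_mul]
  have T : TriangleIntegrable x 1 s (fun _ => 1) u := by
    refine triangleIntegrable_of_left aestronglyMeasurable_const hux'.aestronglyMeasurable
      (fun z hz => ?_) ?_
    · refine (intervalIntegrable_rpow_sub_right hs1').congr fun y hy => ?_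
      rw [uIoc_of_le hz.1.le] at hy
      rw [← mul_rpow_eq_div (sub_nonneg.2 hy.2) 1 (show 1 - s - 1 = -s by ring), one_mul]
    · have hcont : Continuous (fun z => (z - x) ^ (1 - s) / (1 - s)) :=
        ((continuous_id.sub continuous_const).rpow_const fun _ => Or.inr hs1'.le).div_const _
      have h1 := hux.abs.mul_continuousOn hcont.continuousOn
      refine ((intervalIntegrable_iff_integrableOn_Ioo_of_le hx1.le).1 h1).congr_fun
        (fun z hz => ?_) measurableSet_Ioo
      simp only
      rw [← hker z hz.1]
      congr 1
      refine intervalIntegral.integral_congr fun y hy => ?_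
      rw [uIcc_of_le hz.1.le] at hy
      exact (abs_of_nonneg (div_nonneg zero_le_one
        (Real.rpow_nonneg (sub_nonneg.2 hy.2) _))).symm
  have hK : IntervalIntegrable (rightKernelIntegral s u) volume x 1 := by
    rw [intervalIntegrable_iff_integrableOn_Ioo_of_le hx1.le]
    refine T.integrableOn_right.congr_fun (fun y _ => ?_) measurableSet_Ioo
    simp [rightKernelIntegral]
  have hKeq : ∫ y in x..1, rightKernelIntegral s u y =
      ∫ z in x..1, u z * ((z - x) ^ (1 - s) / (1 - s)) := by
    have h1 := T.integral_eq hx1.le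
    simp only [one_mul] at h1
    refine Eq.trans h1 (intervalIntegral.integral_congr_Ioo_of_le hx1.le fun z hz => ?_)
    rw [hker z hz.1]
  have hK1 : |∫ y in x..1, rightKernelIntegral s u y| ≤
      d ^ (1 - s) / (1 - s) * ∫ z in x..1, |u z| := by
    rw [hKeq, ← intervalIntegral.integral_const_mul, ← Real.norm_eq_abs]
    refine intervalIntegral.norm_integral_le_of_norm_le hx1.le
      (Eventually.of_forall fun z hz => ?_) (hux.abs.const_mul _)
    rw [norm_mul, Real.norm_eq_abs, mul_comm, Real.norm_eq_abs, abs_of_nonneg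
      (div_nonneg (Real.rpow_nonneg (sub_nonneg.2 hz.1.le) _) hs1'.le), hd]
    have : (z - x) ^ (1 - s) ≤ (1 - x) ^ (1 - s) :=
      Real.rpow_le_rpow (sub_nonneg.2 hz.1.le) (by linarith [hz.2]) hs1'.le
    gcongr
  have hL1 : ∫ z in x..1, |u z| ≤ (1 + 1 / (α + 1)) / 2 * ε * d ^ ((α + 1) / 2) := by
    obtain ⟨q, hq⟩ : ∃ q, q = d ^ ((α + 1) / 2) := ⟨_, rfl⟩
    have hq0 : 0 < q := by rw [hq]; positivity
    have hq2 : d ^ (α + 1) = q ^ 2 := by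
      rw [hq, ← Real.rpow_natCast, ← Real.rpow_mul hd0.le]; congr 1; push_cast; ring
    have i1 : IntervalIntegrable (fun y => u y ^ 2 * (1 - y) ^ (-α)) volume x 1 :=
      hu2.mono_set (by rw [uIcc_of_le hx1.le, uIcc_of_le zero_le_one]
                       exact Icc_subset_Icc_left hx0.le)
    have i2 : IntervalIntegrable (fun y => (1 - y) ^ α) volume x 1 := by
      simpa using intervalIntegrable_rpow_sub_right (y := x) (z := 1) hα1
    have e2 : ∫ y in x..1, (1 - y) ^ α = q ^ 2 / (α + 1) := by
      have := integral_rpow_sub_right (y := x) (z := 1) hα1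
      rwa [add_sub_cancel_right, ← hd, hq2] at this
    -- Cauchy–Schwarz in the form `|u| ≤ q/(2ε) u² p⁻¹ + ε/(2q) p` with `p = (1-y)^α`. The parameter
    -- `q/ε` makes both integrals of order `ε q`.
    have hmono : ∫ z in x..1, |u z| ≤ ∫ y in x..1,
        (q / (2 * ε) * (u y ^ 2 * (1 - y) ^ (-α)) + ε / (2 * q) * (1 - y) ^ α) := by
      refine intervalIntegral.integral_mono_on_of_le_Ioo hx1.le hux.abs
        ((i1.const_mul _).add (i2.const_mul _)) fun y hy => ?_
      have hy1 : 0 < 1 - y := sub_pos.2 hy.2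
      rw [Real.rpow_neg hy1.le]
      have hp : 0 < (1 - y) ^ α := Real.rpow_pos_of_pos hy1 _
      generalize (1 - y) ^ α = p at hp
      have h3 : q / (2 * ε) * (u y ^ 2 * p⁻¹) + ε / (2 * q) * p - |u y| =
          (q * |u y| - ε * p) ^ 2 / (2 * ε * q * p) := by
        rw [← sq_abs (u y)]; field_simp; ring
      have h4 : 0 ≤ (q * |u y| - ε * p) ^ 2 / (2 * ε * q * p) := by positivity
      linarith
    refine hmono.trans ?_
    rw [intervalIntegral.integral_add (i1.const_mul _) (i2.const_mul _),
      intervalIntegral.integral_const_mul, intervalIntegral.integral_const_mul, e2, ← hq]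
    have h5 : q / (2 * ε) * (∫ y in x..1, u y ^ 2 * (1 - y) ^ (-α)) ≤ q / (2 * ε) * ε ^ 2 := by
      have := hxE.le
      gcongr
    calc _ ≤ q / (2 * ε) * ε ^ 2 + ε / (2 * q) * (q ^ 2 / (α + 1)) := by gcongr
      _ = _ := by field_simp
  have hK2 : |∫ y in x..1, rightKernelIntegral s u y| ≤ |c| / 4 * d := by
    have h1 : d ^ (1 - s) * d ^ ((α + 1) / 2) ≤ d := by
      rw [← Real.rpow_add hd0]
      calc d ^ (1 - s + (α + 1) / 2) ≤ d ^ (1 : ℝ) :=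
            Real.rpow_le_rpow_of_exponent_ge hd0 (by linarith) (by linarith)
        _ = d := Real.rpow_one d
    calc _ ≤ d ^ (1 - s) / (1 - s) * ((1 + 1 / (α + 1)) / 2 * ε * d ^ ((α + 1) / 2)) :=
          hK1.trans (by gcongr)
      _ = C * ε * (d ^ (1 - s) * d ^ ((α + 1) / 2)) := by rw [hCdef]; field_simp
      _ ≤ C * ε * d := by gcongr
      _ = |c| / 4 * d := by rw [hεdef]; field_simp
  have hK3 : |(∫ y in x..1, rightKernelIntegral s u y) - c * d| ≤ |c| / 2 * d := by
    have e : (∫ y in x..1, rightKernelIntegral s u y) - c * d =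
        ∫ y in x..1, (rightKernelIntegral s u y - c) := by
      rw [intervalIntegral.integral_sub hK intervalIntegrable_const]
      simp [hd, mul_comm]
    have := intervalIntegral.norm_integral_le_of_norm_le hx1.le
      (f := fun y => rightKernelIntegral s u y - c) (g := fun _ => |c| / 2) (μ := volume) (by
        filter_upwards [show ∀ᵐ y : ℝ, y ≠ 1 by simp [ae_iff, measure_singleton]] with y hy1 hy
        exact hsub ⟨hxb.1.trans hy.1, lt_of_le_of_ne hy.2 hy1⟩) intervalIntegrable_const
    rw [e, ← Real.norm_eq_abs]
    refine this.trans (le_of_eq ?_)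
    rw [intervalIntegral.integral_const, smul_eq_mul, hd, mul_comm]
  -- The two estimates would give `|c| d ≤ (3/4) |c| d`.
  have h6 : |c| * d ≤ |c| / 4 * d + |c| / 2 * d := by
    calc |c| * d = |c * d| := by rw [abs_mul, abs_of_pos hd0]
      _ = |(∫ y in x..1, rightKernelIntegral s u y) -
          ((∫ y in x..1, rightKernelIntegral s u y) - c * d)| := by rw [sub_sub_cancel]
      _ ≤ _ := (abs_sub _ _).trans (add_le_add hK2 hK3)
  nlinarith [mul_pos hc0 hd0]

/-- Suppose `c ≠ 0`. Since `u` is bounded near `-1`, the regular part of the flux is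
`O((1+x)^(β+s))`, which is dominated by the singular part of order `(1+x)^(s-1)`. Hence the right
derivative of `u` has a fixed sign near `-1` and is at least a multiple of `(1+x)^(-β-1)` in
modulus. Its Abel integral, and therefore `u`, then grows at least like `∫ dy/(1+y)` when `β ≥ s-1`,
contradicting boundedness. -/
theorem eq_zero_of_tendsto_leftKernelIntegral (hs0 : 0 < s) (hs1 : s < 1) (hα : s - 1 < α)
    (hβ : -1 < β) (hβs : s - 1 ≤ β) (hu : IsBVPSolution s α β μ (fun _ => 0) u) {c : ℝ}
    (h₀ : Tendsto (leftKernelIntegral s (flux s α β u)) (𝓝[>] (-1)) (𝓝 c)) : c = 0 := by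
  by_contra hc
  obtain ⟨c', hc', e0⟩ := hu.exists_flux_representation hs0 hs1 hβ
  obtain rfl := tendsto_nhds_unique hc' h₀
  obtain ⟨c₁, -, e1⟩ := hu.exists_representation hs0 hs1 hα hβ
  -- Needed to split the Abel integral of the right derivative at `b₁` for almost every `x`.
  have hT := (hu.triangle_rightRL hs0 hs1 hα hβ).ae_intervalIntegrable_right
  have gs := Real.Gamma_pos_of_pos hs0
  have g1s := Real.Gamma_pos_of_pos (sub_pos.2 hs1)
  obtain ⟨B, hB⟩ : ∃ B, B = Real.Gamma s * Real.Gamma (1 - s) := ⟨_, rfl⟩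
  have hB0 : 0 < B := by rw [hB]; positivity
  rw [← hB] at e0 e1
  obtain ⟨M, hM⟩ := hu.bc_left
  obtain ⟨b₀, hb₀, hsub⟩ := (mem_nhdsGT_iff_exists_mem_Ioc_Ioo_subset
    (show (-1 : ℝ) < 0 by norm_num)).1 hM
  have hM0 : 0 ≤ M := by
    obtain ⟨z, hz⟩ := exists_between hb₀.1
    exact (abs_nonneg _).trans (hsub hz)
  -- bounds for the factors `(1 - x) ^ p` on `[-1, 0]`
  obtain ⟨N, hN⟩ := (isCompact_Icc (a := (-1 : ℝ)) (b := 0)).exists_bound_of_continuousOn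
    (f := fun y : ℝ => (1 - y) ^ (-α)) fun y hy =>
      (continuousAt_one_sub_rpow _ (by linarith [hy.2])).continuousWithinAt
  have hN0 : 0 ≤ N := (norm_nonneg _).trans (hN 0 (by constructor <;> norm_num))
  obtain ⟨y₀, hy₀, hmin⟩ := (isCompact_Icc (a := (-1 : ℝ)) (b := 0)).exists_isMinOn
    (f := fun y : ℝ => (1 - y) ^ (α - s)) ⟨0, by constructor <;> norm_num⟩ fun y hy =>
      (continuousAt_one_sub_rpow _ (by linarith [hy.2])).continuousWithinAt
  obtain ⟨N₂, hN₂⟩ : ∃ N₂, N₂ = (1 - y₀) ^ (α - s) := ⟨_, rfl⟩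
  have hN₂0 : 0 < N₂ := by rw [hN₂]; exact Real.rpow_pos_of_pos (by linarith [hy₀.2]) _
  -- On `(-1, b₀)` the equation bounds the left derivative of the flux by `H (1+y)^β`.
  obtain ⟨H, hH⟩ : ∃ H, H = |μ| * M * N := ⟨_, rfl⟩
  have hlk : ∀ x ∈ Ioo (-1) b₀, |leftKernelIntegral (1 - s) (leftRL s (flux s α β u)) x| ≤
      H * (ProbabilityTheory.beta s (β + 1) * (1 + x) ^ (β + s)) := by
    intro x hx
    obtain ⟨i1, i2⟩ := leftKernel_rpow (c := β) (t := 1 - s) hβ (by linarith) hx.1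
    rw [sub_sub_cancel, show β + 1 - (1 - s) = β + s by ring] at i2
    rw [← i2, leftKernelIntegral, leftKernelIntegral, ← intervalIntegral.integral_const_mul,
      ← Real.norm_eq_abs]
    refine intervalIntegral.norm_integral_le_of_norm_le hx.1.le
      (Eventually.of_forall fun y hy => ?_) (i1.const_mul H)
    have hyb : y ∈ Ioo (-1) b₀ := ⟨hy.1, hy.2.trans_lt hx.2⟩
    have hy1 : y ∈ Ioo (-1 : ℝ) 1 := ⟨hy.1, by linarith [hyb.2, hb₀.2]⟩
    have hyc : y ∈ Icc (-1 : ℝ) 0 := ⟨hy.1.le, by linarith [hyb.2, hb₀.2]⟩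
    have p1 : 0 ≤ (1 + y) ^ β := Real.rpow_nonneg (by linarith [hy.1]) _
    rw [hu.leftRL_flux_eq hy1, jacobiWeight, norm_div, Real.norm_eq_abs, Real.norm_eq_abs,
      abs_of_nonneg (Real.rpow_nonneg (sub_nonneg.2 hy.2) _), ← mul_div_assoc]
    refine div_le_div_of_nonneg_right ?_ (Real.rpow_nonneg (sub_nonneg.2 hy.2) _)
    rw [abs_mul, abs_mul, abs_mul, abs_of_nonneg p1, hH]
    have q1 := hN y hyc
    rw [Real.norm_eq_abs] at q1
    have q2 : |u y| ≤ M := hsub hyb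
    calc _ = |μ| * |u y| * |(1 - y) ^ (-α)| * (1 + y) ^ β := by ring
      _ ≤ _ := by gcongr
  obtain ⟨C₁, hC₁⟩ : ∃ C₁, C₁ = |c'| * (Real.Gamma (1 - s) *
    (H * ProbabilityTheory.beta s (β + 1))) := ⟨_, rfl⟩
  -- close to `-1` the flux is dominated by its singular part
  have hsmall : ∀ᶠ x in 𝓝[>] (-1 : ℝ), C₁ * (1 + x) ^ (β + 1) ≤ c' ^ 2 / 2 := by
    have h : ContinuousAt (fun x : ℝ => C₁ * (1 + x) ^ (β + 1)) (-1) :=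
      continuousAt_const.mul ((continuousAt_const.add continuousAt_id).rpow_const
        (Or.inr (by linarith)))
    have h2 := h.tendsto.mono_left (nhdsWithin_le_nhds (s := Ioi (-1)))
    simp only [add_neg_cancel] at h2
    rw [Real.zero_rpow (by linarith), mul_zero] at h2
    exact (h2.eventually (gt_mem_nhds (show 0 < c' ^ 2 / 2 by positivity))).mono fun _ h => h.le
  obtain ⟨b₁, hb₁, hsub₁⟩ := (mem_nhdsGT_iff_exists_mem_Ioc_Ioo_subset hb₀.1).1 hsmall
  have hb₁0 : b₁ ≤ 0 := hb₁.2.trans hb₀.2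
  obtain ⟨κ, hκ⟩ : ∃ κ, κ = c' ^ 2 / 2 * N₂ := ⟨_, rfl⟩
  have hκ0 : 0 < κ := by rw [hκ]; positivity
  -- Multiplication by `c'` makes the dominant term positive whatever the sign of `c'`.
  have hw : ∀ᵐ x, x ∈ Ioo (-1) b₁ → κ * (1 + x) ^ (-β - 1) ≤ c' * B * rightRL s u x := by
    filter_upwards [e0] with x hx0 hx
    have hx1 : x ∈ Ioo (-1 : ℝ) 1 := ⟨hx.1, by linarith [hx.2]⟩
    have hp : 0 < 1 + x := by linarith [hx.1]
    have h1 := hx0 hx1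
    have h2 := hlk x ⟨hx.1, hx.2.trans_le hb₁.2⟩
    have h3 : C₁ * (1 + x) ^ (β + 1) ≤ c' ^ 2 / 2 := hsub₁ hx
    have h4 : c' ^ 2 / 2 * (1 + x) ^ (s - 1) ≤ c' * (B * flux s α β u x) := by
      rw [h1]
      have h5 : |c' * (Real.Gamma (1 - s) *
          leftKernelIntegral (1 - s) (leftRL s (flux s α β u)) x)| ≤
          c' ^ 2 / 2 * (1 + x) ^ (s - 1) := by
        rw [abs_mul, abs_mul, abs_of_pos g1s]
        calc _ ≤ |c'| * (Real.Gamma (1 - s) *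
              (H * (ProbabilityTheory.beta s (β + 1) * (1 + x) ^ (β + s)))) := by gcongr
          _ = C₁ * (1 + x) ^ (β + 1) * (1 + x) ^ (s - 1) := by
            rw [show β + s = β + 1 + (s - 1) by ring, Real.rpow_add hp, hC₁]; ring
          _ ≤ _ := by gcongr
      have := neg_le_of_abs_le h5
      nlinarith
    have h6 : N₂ ≤ (1 - x) ^ (α - s) := by
      rw [hN₂]; exact hmin ⟨hx.1.le, by linarith [hx.2]⟩
    rw [rightRL_eq_flux (α := α) (β := β) hx1]
    have h8 : 0 ≤ (1 - x) ^ (α - s) := hN₂0.le.trans h6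
    have h7 : 0 < (1 + x) ^ (-β - s) := Real.rpow_pos_of_pos hp _
    calc κ * (1 + x) ^ (-β - 1) =
          (1 + x) ^ (-β - s) * (N₂ * (c' ^ 2 / 2 * (1 + x) ^ (s - 1))) := by
            rw [show -β - 1 = -β - s + (s - 1) by ring, Real.rpow_add hp, hκ]; ring
      _ ≤ (1 + x) ^ (-β - s) * ((1 - x) ^ (α - s) * (c' * (B * flux s α β u x))) := by gcongr
      _ = _ := by ring
  -- hence the solution grows logarithmically
  obtain ⟨b₂, hb₂⟩ : ∃ b₂, b₂ = (b₁ - 1) / 2 := ⟨_, rfl⟩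
  have hb₁1 : b₁ ∈ Ioo (-1 : ℝ) 1 := ⟨hb₁.1, by linarith⟩
  have hwi := hu.intervalIntegrable_rightRL hs0 hs1 hα hβ hb₁1
  obtain ⟨W, hW⟩ : ∃ W, W = |c' * B| / (b₁ - b₂) ^ (1 - s) * ∫ y in b₁..1, |rightRL s u y| :=
    ⟨_, rfl⟩
  have hη : 0 < b₁ - b₂ := by rw [hb₂]; linarith [hb₁.1]
  obtain ⟨Z, hZ⟩ : ∃ Z, Z = |c' * B| * (B * M) + |c' * B * c₁| + Real.Gamma (1 - s) * W :=
    ⟨_, rfl⟩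
  have hlog : ∀ᵐ x, x ∈ Ioo (-1) b₂ →
      Real.Gamma (1 - s) * (κ * (Real.log (1 + b₁) - Real.log (1 + x))) ≤ Z := by
    filter_upwards [e1, hT] with x hx1 hxT hx
    have hxb : x < b₁ := by linarith [hx.2]
    have hx' : x ∈ Ioo (-1 : ℝ) 1 := ⟨hx.1, by linarith⟩
    have hp : 0 < 1 + x := by linarith [hx.1]
    have hI := hxT hx' (Real.rpow_pos_of_pos hp β).ne'
    have hIl : IntervalIntegrable (fun y => rightRL s u y / (y - x) ^ (1 - s)) volume x b₁ :=
      hI.mono_set (by rw [uIcc_of_le hxb.le, uIcc_of_le hx'.2.le]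
                      exact Icc_subset_Icc_right hb₁1.2.le)
    have hIr : IntervalIntegrable (fun y => rightRL s u y / (y - x) ^ (1 - s)) volume b₁ 1 :=
      hI.mono_set (by rw [uIcc_of_le hb₁1.2.le, uIcc_of_le hx'.2.le]
                      exact Icc_subset_Icc_left hxb.le)
    have hsplit := intervalIntegral.integral_add_adjacent_intervals hIl hIr
    have hfirst : κ * (Real.log (1 + b₁) - Real.log (1 + x)) ≤
        c' * B * ∫ y in x..b₁, rightRL s u y / (y - x) ^ (1 - s) := by
      have hinv : IntervalIntegrable (fun y : ℝ => (1 + y)⁻¹) volume x b₁ := by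
        refine ContinuousOn.intervalIntegrable fun y hy => ?_
        rw [uIcc_of_le hxb.le] at hy
        exact ((continuousAt_const.add continuousAt_id).inv₀
          (show 0 < 1 + y by linarith [hy.1]).ne').continuousWithinAt
      have hval : ∫ y in x..b₁, (1 + y)⁻¹ = Real.log (1 + b₁) - Real.log (1 + x) := by
        rw [intervalIntegral.integral_comp_add_left (fun y => y⁻¹) 1,
          integral_inv_of_pos hp (by linarith), Real.log_div (by linarith) (by linarith)]
      rw [← hval, ← intervalIntegral.integral_const_mul, ← intervalIntegral.integral_const_mul]
      refine intervalIntegral.integral_mono_ae_restrict hxb.le (hinv.const_mul κ)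
        (hIl.const_mul (c' * B)) ?_
      rw [← restrict_Ioo_eq_restrict_Icc]
      filter_upwards [ae_restrict_of_ae hw, ae_restrict_mem measurableSet_Ioo] with y hy0 hy
      have hy1 := hy0 ⟨hx.1.trans hy.1, hy.2⟩
      have hyp : 0 < 1 + y := by linarith [hy.1]
      have hk : 0 < (y - x) ^ (1 - s) := Real.rpow_pos_of_pos (sub_pos.2 hy.1) _
      have hk2 : (y - x) ^ (1 - s) ≤ (1 + y) ^ (1 - s) :=
        Real.rpow_le_rpow (sub_pos.2 hy.1).le (by linarith) (by linarith)
      -- Here `β ≥ s - 1` enters: `-β - 1 ≤ -s` and `0 < 1 + y ≤ 1`.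
      have hk3 : (1 + y)⁻¹ * (1 + y) ^ (1 - s) ≤ (1 + y) ^ (-β - 1) := by
        rw [← Real.rpow_neg_one, ← Real.rpow_add hyp]
        exact Real.rpow_le_rpow_of_exponent_ge hyp (by linarith [hy.2]) (by linarith)
      have hyi : 0 ≤ (1 + y)⁻¹ := inv_nonneg.2 hyp.le
      rw [← mul_div_assoc, le_div_iff₀ hk]
      calc κ * (1 + y)⁻¹ * (y - x) ^ (1 - s) ≤ κ * ((1 + y)⁻¹ * (1 + y) ^ (1 - s)) := by
            rw [mul_assoc]; gcongr
        _ ≤ κ * (1 + y) ^ (-β - 1) := by gcongr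
        _ ≤ _ := hy1
    have hsecond : |c' * B * ∫ y in b₁..1, rightRL s u y / (y - x) ^ (1 - s)| ≤ W := by
      rw [hW, abs_mul, div_mul_eq_mul_div, mul_div_assoc]
      refine mul_le_mul_of_nonneg_left ?_ (abs_nonneg _)
      rw [← intervalIntegral.integral_div, ← Real.norm_eq_abs]
      refine intervalIntegral.norm_integral_le_of_norm_le hb₁1.2.le
        (Eventually.of_forall fun y hy => ?_) (hwi.abs.div_const _)
      have hk : 0 < (b₁ - b₂) ^ (1 - s) := Real.rpow_pos_of_pos hη _
      have hk2 : (b₁ - b₂) ^ (1 - s) ≤ (y - x) ^ (1 - s) :=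
        Real.rpow_le_rpow hη.le (by linarith [hy.1, hx.2]) (by linarith)
      rw [norm_div, Real.norm_eq_abs, Real.norm_eq_abs,
        abs_of_pos (hk.trans_le hk2)]
      gcongr
    have hmain := hx1 hx'
    rw [rightKernelIntegral, ← hsplit] at hmain
    have hub : |u x| ≤ M := hsub ⟨hx.1, by linarith [hb₁.2]⟩
    have hone : |c' * B * (c₁ * (1 - x) ^ (s - 1))| ≤ |c' * B * c₁| := by
      rw [← mul_assoc, abs_mul]
      have hr : 0 < 1 - x := sub_pos.2 hx'.2
      have : |(1 - x) ^ (s - 1)| ≤ 1 := by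
        rw [abs_of_nonneg (Real.rpow_nonneg hr.le _)]
        exact Real.rpow_le_one_of_one_le_of_nonpos (by linarith) (by linarith)
      exact mul_le_of_le_one_right (abs_nonneg _) this
    have hBu : |c' * B * (B * u x)| ≤ |c' * B| * (B * M) := by
      rw [abs_mul, abs_mul B, abs_of_pos hB0]; gcongr
    have e := congrArg (fun z => c' * B * z) hmain
    have n1 := le_of_abs_le hBu
    have n2 := neg_le_of_abs_le hone
    have n3 := neg_le_of_abs_le hsecond
    have n4 := mul_le_mul_of_nonneg_left hfirst g1s.le
    have n5 := mul_le_mul_of_nonneg_left n3 g1s.le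
    rw [hZ]
    linarith
  have hdiv : Tendsto (fun x : ℝ => Real.log (1 + x)) (𝓝[>] (-1)) atBot := by
    refine Real.tendsto_log_nhdsGT_zero.comp ?_
    refine tendsto_nhdsWithin_iff.2 ⟨?_, ?_⟩
    · have : Tendsto (fun x : ℝ => 1 + x) (𝓝 (-1)) (𝓝 (1 + -1)) :=
        (continuous_const.add continuous_id).tendsto _
      rw [add_neg_cancel] at this
      exact this.mono_left nhdsWithin_le_nhds
    · filter_upwards [self_mem_nhdsWithin] with x hx
      have : -1 < x := hx
      exact show 0 < 1 + x by linarith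
  have hev := hdiv.eventually (eventually_lt_atBot
    (Real.log (1 + b₁) - Z / (Real.Gamma (1 - s) * κ)))
  have hb₂1 : -1 < b₂ := by rw [hb₂]; linarith [hb₁.1]
  obtain ⟨b₃, hb₃, hsub₃⟩ := (mem_nhdsGT_iff_exists_mem_Ioc_Ioo_subset hb₂1).1 hev
  -- The logarithmic bound holds only almost everywhere, so the contradiction is drawn from an
  -- interval of positive measure.
  have hnull : volume (Ioo (-1) b₃) = 0 := by
    refine measure_mono_null (fun x hx => ?_) hlog
    intro hh
    have h1 := hh ⟨hx.1, hx.2.trans_le hb₃.2⟩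
    have h2 : Real.log (1 + x) < Real.log (1 + b₁) - Z / (Real.Gamma (1 - s) * κ) := hsub₃ hx
    have h3 : 0 < Real.Gamma (1 - s) * κ := by positivity
    have h4 : Z / (Real.Gamma (1 - s) * κ) < Real.log (1 + b₁) - Real.log (1 + x) := by linarith
    rw [div_lt_iff₀ h3] at h4
    linarith
  rw [Real.volume_Ioo, ENNReal.ofReal_eq_zero] at hnull
  linarith [hb₃.1]

/-- Every solution of the homogeneous problem for the `n`-th eigenvalue is a multiple of the
`n`-th generalized Jacobi function. -/
theorem IsBVPSolution.exists_eq_const_mul_jacobiJ (hs0 : 0 < s) (hs1 : s < 1) (hα : s - 1 < α)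
    (hβ : -1 < β) (hcond : 0 ≤ α ∨ 2 * s - 1 ≤ α ∨ s - 1 ≤ β) {n : ℕ}
    (hu : IsBVPSolution s α β (baseEigenvalue s α β n) (fun _ => 0) u) :
    ∃ a : ℝ, ∀ x ∈ Ioo (-1 : ℝ) 1, u x = a * jacobiJ α β n x := by
  obtain ⟨c₀, h₀, -⟩ := hu.exists_flux_representation hs0 hs1 hβ
  obtain ⟨c₁, h₁, -⟩ := hu.exists_representation hs0 hs1 hα hβ
  have hmom := hu.moment_identity hs0 hs1 hα hβ h₀ h₁
  have hn : (0 : ℝ) ≤ n := n.cast_nonneg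
  have hA : Real.Gamma (n + α + 1) / Real.Gamma (n + α - s + 1) *
      jacobiK (α - s) (β + s) n 1 ≠ 0 := by
    have g1 := (Real.Gamma_pos_of_pos (show 0 < n + α + 1 by linarith)).ne'
    have g2 := (Real.Gamma_pos_of_pos (show 0 < n + α - s + 1 by linarith)).ne'
    refine mul_ne_zero (div_ne_zero g1 g2) (mul_ne_zero
      (Real.rpow_pos_of_pos (by norm_num) _).ne' (jacobiP_apply_one_ne_zero (by linarith) _ n))
  have hJ := jacobiJ_neg_one_ne_zero (α := α) (β := β) (by linarith) hβ n
  have hn0 := hmom n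
  rw [sub_self, zero_mul, mul_zero] at hn0
  -- The identity for `m = n` is one linear relation between `c₁` and `c₀` with nonzero
  -- coefficients; each alternative of `hcond` supplies the vanishing of one of them.
  have hzero : c₁ = 0 ∧ c₀ = 0 := by
    have hc₁ : c₁ = 0 → c₁ = 0 ∧ c₀ = 0 := fun h => by
      rw [h, mul_zero, zero_add] at hn0
      exact ⟨h, (mul_eq_zero.1 hn0.symm).resolve_left hJ⟩
    have hc₀ : c₀ = 0 → c₁ = 0 ∧ c₀ = 0 := fun h => by
      rw [h, mul_zero, add_zero] at hn0
      exact ⟨(mul_eq_zero.1 hn0.symm).resolve_left hA, h⟩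
    rcases hcond with h | h | h
    · have hb : BoundedNear (𝓝[<] 1) u := by
        rcases h.eq_or_lt with h | h
        · exact hu.bc_right_zero h.symm
        · have := ((hu.bc_right_pos h).abs).eventually (gt_mem_nhds (show |(0 : ℝ)| < 1 by simp))
          exact ⟨1, this.mono fun _ h => h.le⟩
      exact hc₁ (tendsto_nhds_unique h₁ (tendsto_rightKernelIntegral_of_boundedNear hs1 hb))
    · exact hc₁ (eq_zero_of_tendsto_rightKernelIntegral hs0 hs1 h hu h₁)
    · exact hc₀ (eq_zero_of_tendsto_leftKernelIntegral hs0 hs1 hα hβ h hu h₀)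
  have hmom0 : ∀ m, m ≠ n → weightedInner α β u (jacobiJ α β m) = 0 := fun m hm => by
    have h := hmom m
    rw [hzero.1, hzero.2, mul_zero, mul_zero, add_zero, ← weightedInner_jacobiJ] at h
    have h1 := (Real.Gamma_pos_of_pos (sub_pos.2 hs1)).ne'
    have h2 : baseEigenvalue s α β m - baseEigenvalue s α β n ≠ 0 :=
      sub_ne_zero.2 ((baseEigenvalue_strictMono hs0 hα hβ).injective.ne hm)
    simpa [h1, h2] using h
  have hN := weightedInner_jacobiJ_self_pos (α := α) (by linarith) hβ n
  obtain ⟨a, ha⟩ : ∃ a, a = weightedInner α β u (jacobiJ α β n) /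
    weightedInner α β (jacobiJ α β n) (jacobiJ α β n) := ⟨_, rfl⟩
  have hJsol := isBVPSolution_jacobiJ_self hs0 hs1 hα hβ n
  -- With `a` the Fourier coefficient, `u - a ⁺J_n` is orthogonal to every `⁺J_m`, including `m =
  -- n`.
  have hv := (hu.linear (p := 1) (q := -a) hs1 hJsol)
  have hae : ∀ᵐ x, x ∈ Ioo (-1 : ℝ) 1 → 1 * u x + -a * jacobiJ α β n x = 0 := by
    refine ae_eq_zero_of_weightedInner_eq_zero (α := α) (by linarith) ((hv.integrableOn_Ioo hs0).2 hβ)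
      fun m => ?_
    have i1 := (intervalIntegrable_iff_integrableOn_Ioo_of_le (show (-1 : ℝ) ≤ 1 by norm_num)).2
      (integrableOn_mul_jacobiK hs0 hβ hu m)
    have i2 := (intervalIntegrable_iff_integrableOn_Ioo_of_le (show (-1 : ℝ) ≤ 1 by norm_num)).2
      (integrableOn_mul_jacobiK hs0 hβ hJsol m)
    have e : weightedInner α β (fun x => 1 * u x + -a * jacobiJ α β n x) (jacobiJ α β m) =
        weightedInner α β u (jacobiJ α β m) -
          a * weightedInner α β (jacobiJ α β n) (jacobiJ α β m) := by
      simp only [weightedInner_jacobiJ]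
      rw [← intervalIntegral.integral_const_mul, ← intervalIntegral.integral_sub i1
        (i2.const_mul a)]
      exact intervalIntegral.integral_congr fun x _ => by ring
    rw [e]
    by_cases hm : m = n
    · rw [hm, ha]; field_simp; simp
    · rw [hmom0 m hm, weightedInner_jacobiJ_of_ne hs0 hs1 hα hβ hm]; simp
  refine ⟨a, fun x hx => ?_⟩
  -- pass from almost everywhere to everywhere through the equation
  have hker : ∀ y ∈ Ioo (-1 : ℝ) 1, rightKernelIntegral s u y =
      rightKernelIntegral s (fun x => a * jacobiJ α β n x) y := by
    intro y hy
    refine intervalIntegral.integral_congr_ae ?_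
    filter_upwards [hae, show ∀ᵐ z : ℝ, z ≠ 1 by simp [ae_iff, measure_singleton]]
      with z hz hz1 hzy
    rw [uIoc_of_le hy.2.le] at hzy
    have := hz ⟨hy.1.trans hzy.1, lt_of_le_of_ne hzy.2 hz1⟩
    rw [show u z = a * jacobiJ α β n z by linarith]
  have hflux : ∀ y ∈ Ioo (-1 : ℝ) 1, flux s α β u y =
      flux s α β (fun x => a * jacobiJ α β n x) y := by
    intro y hy
    rw [flux, flux, rightRL, rightRL]
    congr 2
    refine EventuallyEq.deriv_eq ?_
    filter_upwards [Ioo_mem_nhds hy.1 hy.2] with z hz using hker z hz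
  have hop : fracJacobiOp s α β u x = fracJacobiOp s α β (fun x => a * jacobiJ α β n x) x := by
    rw [fracJacobiOp, fracJacobiOp, leftRL_congr hflux hx]
  have haJ := (hJsol.linear (p := a) (q := 0) hs1 hJsol).equation x hx
  have hux := hu.equation x hx
  simp only [zero_mul, add_zero, mul_zero] at haJ
  rw [hop] at hux
  -- The operator does not see null sets, so both functions have the same image at every point; as
  -- `Λ_n ≠ 0`, the equation recovers their values from it.
  have hpos := baseEigenvalue_pos hs0 hα hβ n
  have : baseEigenvalue s α β n * u x = baseEigenvalue s α β n * (a * jacobiJ α β n x) := by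
    linarith
  exact mul_left_cancel₀ hpos.ne' this

end

end

section

/-! ### The recursive system for the coefficients -/

section Algebra

variable {s α β : ℝ} {r n : ℕ} {c : ℕ → ℝ}

/-- The next eigenvalue correction computed from the coefficients of the last step. -/
noncomputable def nextLam (α β : ℝ) (r : ℕ) (c : ℕ → ℝ) (n : ℕ) (a₀ : ℝ) (b : ℕ → ℝ) : ℝ :=
  a₀⁻¹ * ∑ t ∈ Finset.Icc (n - r) (n + r), b t *
    ∑ l ∈ Finset.Icc (max (n - t) (t - n)) r, c l * jacobiB α β l t (t + l + 1 - n)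

/-- The next coefficients computed from all previous ones. -/
noncomputable def nextCoeff (s α β : ℝ) (r : ℕ) (c : ℕ → ℝ) (n : ℕ) (lam : ℕ → ℝ)
    (a : ℕ → ℕ → ℝ) (j m : ℕ) : ℝ :=
  if n - r * (j + 1) ≤ m ∧ m ≤ n + r * (j + 1) ∧ m ≠ n then
    (baseEigenvalue s α β m - baseEigenvalue s α β n)⁻¹ *
      (∑ p ∈ Finset.range (j + 1), lam (j + 1 - p) * a p m - potentialCoeff α β r c n j (a j) m)
  else 0

theorem nextCoeff_congr {lam lam' : ℕ → ℝ} {a a' : ℕ → ℕ → ℝ} {j : ℕ}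
    (hlam : ∀ p ≤ j + 1, lam p = lam' p) (ha : ∀ p ≤ j, a p = a' p) (m : ℕ) :
    nextCoeff s α β r c n lam a j m = nextCoeff s α β r c n lam' a' j m := by
  have e : ∑ p ∈ Finset.range (j + 1), lam (j + 1 - p) * a p m =
      ∑ p ∈ Finset.range (j + 1), lam' (j + 1 - p) * a' p m :=
    Finset.sum_congr rfl fun p hp => by
      rw [hlam _ (by omega), ha p (Nat.lt_succ_iff.1 (Finset.mem_range.1 hp))]
  rw [nextCoeff, nextCoeff, e, ha j le_rfl]

/-- The lower limit is `⌈|m-n|/r⌉`, the first `p` whose support range contains `m`, so the omitted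
terms are zero. The case `r = 0` is void because `m ≠ n`, and for `r ≥ 1` the upper limit is simply
`j`. -/
theorem sum_lam_mul_eq {lam : ℕ → ℝ} {a : ℕ → ℕ → ℝ}
    (hsupp : ∀ j m, m < n - r * j ∨ n + r * j < m → a j m = 0) {j m : ℕ}
    (h1 : n - r * j ≤ m) (h2 : m ≤ n + r * j) (hmn : m ≠ n) :
    ∑ p ∈ Finset.Icc ((((m : ℤ) - n).natAbs + r - 1) / r) (min j (n + r * j)),
      lam (j + 1 - p) * a p m = ∑ p ∈ Finset.range (j + 1), lam (j + 1 - p) * a p m := by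
  have hr : 0 < r := by
    rcases Nat.eq_zero_or_pos r with rfl | h
    · simp only [zero_mul] at h1 h2; omega
    · exact h
  have hj : j ≤ r * j := Nat.le_mul_of_pos_left j hr
  refine Finset.sum_subset (fun p hp => ?_) fun p hp hp' => ?_
  · rw [Finset.mem_Icc] at hp
    rw [Finset.mem_range]
    omega
  · rw [Finset.mem_range] at hp
    rw [Finset.mem_Icc, not_and_or] at hp'
    have h3 : p + 1 ≤ (((m : ℤ) - n).natAbs + r - 1) / r := by omega
    rw [Nat.le_div_iff_mul_le hr, add_mul, one_mul, mul_comm] at h3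
    rw [hsupp p m (by omega), mul_zero]

/-- Lets the outer ranges be written with the formula of the middle range, so that one recursion
describes all three. -/
theorem sum_lam_mul_eq_zero {lam : ℕ → ℝ} {a : ℕ → ℕ → ℝ}
    (hsupp : ∀ j m, m < n - r * j ∨ n + r * j < m → a j m = 0) {j m : ℕ}
    (h : m < n - r * j ∨ n + r * j < m) :
    ∑ p ∈ Finset.range (j + 1), lam (j + 1 - p) * a p m = 0 := by
  refine Finset.sum_eq_zero fun p hp => ?_
  have h1 : r * p ≤ r * j :=
    Nat.mul_le_mul_left r (Nat.lt_succ_iff.1 (Finset.mem_range.1 hp))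
  rw [hsupp p m (by omega), mul_zero]

/-- A uniform description of the system. -/
theorem isFDCoeff_iff {lam : ℕ → ℝ} {a : ℕ → ℕ → ℝ} : IsFDCoeff s α β r c n lam a ↔
    lam 0 = baseEigenvalue s α β n ∧ a 0 n ≠ 0 ∧ (∀ m, m ≠ n → a 0 m = 0) ∧
      (∀ j, lam (j + 1) = nextLam α β r c n (a 0 n) (a j)) ∧
      ∀ j m, a (j + 1) m = nextCoeff s α β r c n lam a j m := by
  constructor
  · intro h
    refine ⟨h.lam_zero, h.start_ne, fun m hm => h.support 0 m (by omega), h.lam_succ,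
      fun j m => ?_⟩
    have hrj : r * (j + 1) = r * j + r := by ring
    rw [nextCoeff]
    split_ifs with hm
    · rcases lt_or_ge (n + r * j) m with h1 | h1
      · rw [h.upper j m h1 hm.2.1, sum_lam_mul_eq_zero h.support (Or.inr h1)]
        ring
      · rcases lt_or_ge m (n - r * j) with h2 | h2
        · rw [h.lower j m hm.1 (by omega), sum_lam_mul_eq_zero h.support (Or.inl h2)]
          ring
        · rw [h.middle j m h2 h1 hm.2.2, sum_lam_mul_eq h.support h2 h1 hm.2.2]
    · by_cases hmn : m = n
      · rw [hmn, h.diag j]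
      · exact h.support (j + 1) m (by omega)
  · rintro ⟨h1, h2, h3, h4, h5⟩
    have hsupp : ∀ j m, m < n - r * j ∨ n + r * j < m → a j m = 0 := by
      intro j m hm
      rcases j with _ | j
      · exact h3 m (by omega)
      · rw [h5, nextCoeff, if_neg (by omega)]
    refine ⟨h1, h4, h2, fun j => ?_, hsupp, fun j m ha hb => ?_, fun j m ha hb hc => ?_,
      fun j m ha hb => ?_⟩
    · rw [h5, nextCoeff, if_neg (by simp)]
    · rw [h5, nextCoeff, if_pos (by omega), sum_lam_mul_eq_zero hsupp (Or.inr ha)]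
      ring
    · have hrj : r * (j + 1) = r * j + r := by ring
      rw [h5, nextCoeff, if_pos (by omega), sum_lam_mul_eq hsupp ha hb hc]
    · rw [h5, nextCoeff, if_pos (by omega), sum_lam_mul_eq_zero hsupp (Or.inl (by omega))]
      ring

/-- The solution of the system, by recursion. -/
noncomputable def fdState (s α β : ℝ) (r : ℕ) (c : ℕ → ℝ) (n : ℕ) (a₀ : ℝ) :
    ℕ → ℝ × (ℕ → ℝ)
  | 0 => (baseEigenvalue s α β n, fun m => if m = n then a₀ else 0)
  | j + 1 =>
    -- The cut-off `p < j + 1` makes the recursive calls visibly decreasing; values beyond it are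
    -- not used by `nextCoeff`.
    let a : ℕ → ℕ → ℝ := fun p =>
      if _h : p < j + 1 then (fdState s α β r c n a₀ p).2 else 0
    let lam : ℕ → ℝ := fun p =>
      if _h : p < j + 1 then (fdState s α β r c n a₀ p).1 else nextLam α β r c n a₀ (a j)
    (lam (j + 1), nextCoeff s α β r c n lam a j)
termination_by j => j

theorem fdState_succ_fst (a₀ : ℝ) (j : ℕ) : (fdState s α β r c n a₀ (j + 1)).1 =
    nextLam α β r c n a₀ (fdState s α β r c n a₀ j).2 := by
  rw [fdState]; simp

theorem fdState_succ_snd (a₀ : ℝ) (j m : ℕ) : (fdState s α β r c n a₀ (j + 1)).2 m =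
    nextCoeff s α β r c n (fun p => (fdState s α β r c n a₀ p).1)
      (fun p => (fdState s α β r c n a₀ p).2) j m := by
  have e := fdState_succ_fst (s := s) (α := α) (β := β) (r := r) (c := c) (n := n) a₀ j
  rw [fdState]
  dsimp only
  refine nextCoeff_congr (fun p hp => ?_) (fun p hp => ?_) m
  · rcases Nat.lt_or_ge p (j + 1) with h | h
    · simp [h]
    · obtain rfl : p = j + 1 := le_antisymm hp h
      simp [e]
  · simp [Nat.lt_succ_iff.2 hp]

theorem existsUnique_isFDCoeff {a₀ : ℝ} (ha₀ : a₀ ≠ 0) :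
    ∃! p : (ℕ → ℝ) × (ℕ → ℕ → ℝ), p.2 0 n = a₀ ∧ IsFDCoeff s α β r c n p.1 p.2 := by
  have h0 : (fdState s α β r c n a₀ 0).2 n = a₀ := by rw [fdState]; simp
  refine ⟨(fun j => (fdState s α β r c n a₀ j).1, fun j => (fdState s α β r c n a₀ j).2),
    ⟨h0, isFDCoeff_iff.2 ⟨?_, ?_, ?_, ?_, ?_⟩⟩, ?_⟩
  · simp only; rw [fdState]
  · simpa only [h0] using ha₀
  · intro m hm; simp only; rw [fdState]; simp [hm]
  · intro j; simp only [h0]; exact fdState_succ_fst a₀ j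
  · intro j m; exact fdState_succ_snd a₀ j m
  · rintro ⟨lam, a⟩ ⟨ha, h⟩
    simp only at ha h
    obtain ⟨g1, g2, g3, g4, g5⟩ := isFDCoeff_iff.1 h
    have key : ∀ j, lam j = (fdState s α β r c n a₀ j).1 ∧
        a j = (fdState s α β r c n a₀ j).2 := by
      intro j
      induction j using Nat.strong_induction_on with
      | _ j ih =>
        rcases j with _ | j
        · refine ⟨by rw [g1, fdState], funext fun m => ?_⟩
          rw [fdState]
          by_cases hm : m = n
          · simp [hm, ha]
          · simp [hm, g3 m hm]
        -- The eigenvalue correction comes first, since the formula for the coefficients contains it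
        -- through the term `p = 0`.
        · have hl : lam (j + 1) = (fdState s α β r c n a₀ (j + 1)).1 := by
            rw [g4, fdState_succ_fst, ha, (ih j (by omega)).2]
          refine ⟨hl, funext fun m => ?_⟩
          rw [g5, fdState_succ_snd]
          refine nextCoeff_congr (fun p hp => ?_) (fun p hp => (ih p (by omega)).2) m
          rcases Nat.lt_or_ge p (j + 1) with h | h
          · exact (ih p h).1
          · obtain rfl : p = j + 1 := le_antisymm hp h
            exact hl
    exact Prod.ext (funext fun j => (key j).1) (funext fun j => (key j).2)

/-! ### Finite expansions -/

/-- The factor `(1-x)^α` commutes with multiplication by `x ^ l`, so the connection coefficients of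
the polynomials apply to `⁺J_k`. Exchanging the sums collects the coefficient of each `⁺J_m` and
widens the index range by `r`. -/
theorem potential_mul_fdExpansion (hαβ : -2 < α + β) (a : ℕ → ℕ → ℝ) (j : ℕ) (x : ℝ) :
    potential r c x * fdExpansion α β r n a j x =
      ∑ m ∈ Finset.Icc (n - r * (j + 1)) (n + r * (j + 1)),
        potentialCoeff α β r c n j (a j) m * jacobiJ α β m x := by
  have hrj : r * (j + 1) = r * j + r := by ring
  have e : ∀ l k, x ^ l * jacobiJ α β k x = ∑ m ∈ Finset.Icc (k - l) (k + l),
      jacobiB α β l k (k + l + 1 - m) * jacobiJ α β m x := fun l k => by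
    rw [jacobiJ, mul_left_comm, pow_mul_jacobiP hαβ, Finset.mul_sum]
    refine Finset.sum_congr rfl fun m _ => ?_
    rw [jacobiJ]; ring
  simp only [potential, potentialCoeff, Finset.sum_mul]
  rw [Finset.sum_comm]
  refine Finset.sum_congr rfl fun l hl => ?_
  rw [Finset.mem_range] at hl
  rw [fdExpansion, Finset.mul_sum]
  have e2 : ∀ k, c l * x ^ l * (a j k * jacobiJ α β k x) = ∑ m ∈ Finset.Icc (k - l) (k + l),
      c l * (a j k * jacobiB α β l k (k + l + 1 - m)) * jacobiJ α β m x := fun k => by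
    rw [show c l * x ^ l * (a j k * jacobiJ α β k x) =
      c l * a j k * (x ^ l * jacobiJ α β k x) by ring, e, Finset.mul_sum]
    exact Finset.sum_congr rfl fun m _ => by ring
  simp only [e2, Finset.mul_sum, Finset.sum_mul]
  refine Finset.sum_comm' fun k m => ?_
  simp only [Finset.mem_Icc]
  omega

theorem fdExpansion_eq_sum_of_le {a : ℕ → ℕ → ℝ}
    (hsupp : ∀ j m, m < n - r * j ∨ n + r * j < m → a j m = 0) {p j : ℕ} (hpj : p ≤ j) (x : ℝ) :
    fdExpansion α β r n a p x =
      ∑ m ∈ Finset.Icc (n - r * j) (n + r * j), a p m * jacobiJ α β m x := by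
  have h : r * p ≤ r * j := Nat.mul_le_mul_left r hpj
  refine Finset.sum_subset (Finset.Icc_subset_Icc (by omega) (by omega)) fun m _ hm => ?_
  rw [Finset.mem_Icc, not_and_or] at hm
  rw [hsupp p m (by omega), zero_mul]

theorem fdRhs_fdExpansion (hαβ : -2 < α + β) {lam : ℕ → ℝ} {a : ℕ → ℕ → ℝ}
    (hsupp : ∀ j m, m < n - r * j ∨ n + r * j < m → a j m = 0) (j : ℕ) (x : ℝ) :
    fdRhs r c lam (fdExpansion α β r n a) j x =
      ∑ m ∈ Finset.Icc (n - r * (j + 1)) (n + r * (j + 1)),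
        (∑ p ∈ Finset.range (j + 1), lam (j + 1 - p) * a p m -
          potentialCoeff α β r c n j (a j) m) * jacobiJ α β m x := by
  rw [fdRhs, potential_mul_fdExpansion hαβ]
  simp only [sub_mul, Finset.sum_sub_distrib, Finset.sum_mul]
  congr 1
  rw [Finset.sum_comm]
  refine Finset.sum_congr rfl fun p hp => ?_
  rw [fdExpansion_eq_sum_of_le hsupp (show p ≤ j + 1 by
    have := Finset.mem_range.1 hp; omega), Finset.mul_sum]
  exact Finset.sum_congr rfl fun m _ => by ring

/-- The coefficient equation of index `n`, that is, the solvability condition. The two double sums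
differ in the order of summation and in terms outside the support of `a j`. -/
theorem IsFDCoeff.lam_succ_mul {lam : ℕ → ℝ} {a : ℕ → ℕ → ℝ} (h : IsFDCoeff s α β r c n lam a)
    (j : ℕ) : lam (j + 1) * a 0 n = potentialCoeff α β r c n j (a j) n := by
  have h0 := h.start_ne
  rw [h.lam_succ, potentialCoeff, mul_comm, mul_inv_cancel_left₀ h0]
  simp only [Finset.mul_sum]
  rw [Finset.sum_comm' (t' := Finset.range (r + 1)) (s' := fun l => Finset.Icc (n - l) (n + l))]
  · refine Finset.sum_congr rfl fun l hl => ?_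
    symm
    refine (Finset.sum_subset (Finset.Icc_subset_Icc (le_max_right _ _) (min_le_right _ _))
      fun k hk hk' => ?_).trans (Finset.sum_congr rfl fun k _ => by ring)
    rw [Finset.mem_Icc] at hk hk'
    rw [h.support j k (by omega)]; ring
  · intro t l
    simp only [Finset.mem_Icc, Finset.mem_range]
    omega

/-- The coefficient equations, in the form in which they enter the boundary value problems. -/
theorem IsFDCoeff.eigenvalue_sub_mul (hs0 : 0 < s) (hα : s - 1 < α) (hβ : -1 < β)
    {lam : ℕ → ℝ} {a : ℕ → ℕ → ℝ} (h : IsFDCoeff s α β r c n lam a) {j m : ℕ}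
    (hm : m ∈ Finset.Icc (n - r * (j + 1)) (n + r * (j + 1))) :
    (baseEigenvalue s α β m - baseEigenvalue s α β n) * a (j + 1) m =
      ∑ p ∈ Finset.range (j + 1), lam (j + 1 - p) * a p m -
        potentialCoeff α β r c n j (a j) m := by
  by_cases hmn : m = n
  -- At `m = n` only `p = 0` survives, because the later coefficients of index `n` vanish.
  · rw [hmn, sub_self, zero_mul, ← h.lam_succ_mul, Finset.sum_range_succ', Nat.sub_zero,
      Finset.sum_eq_zero fun p _ => by rw [h.diag, mul_zero]]
    ring
  · rw [Finset.mem_Icc] at hm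
    have h2 : baseEigenvalue s α β m - baseEigenvalue s α β n ≠ 0 :=
      sub_ne_zero.2 ((baseEigenvalue_strictMono hs0 hα hβ).injective.ne hmn)
    rw [(isFDCoeff_iff.1 h).2.2.2.2, nextCoeff, if_pos ⟨hm.1, hm.2, hmn⟩,
      mul_inv_cancel_left₀ h2]

theorem fdExpansion_zero (a : ℕ → ℕ → ℝ) (x : ℝ) :
    fdExpansion α β r n a 0 x = a 0 n * jacobiJ α β n x := by
  simp [fdExpansion]

/-! ### The scalar product of finite expansions -/

theorem weightedInner_comm (f g : ℝ → ℝ) : weightedInner α β f g = weightedInner α β g f := by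
  simp only [weightedInner, mul_comm (f _)]

theorem weightedInner_const_mul_right (f g : ℝ → ℝ) (k : ℝ) :
    weightedInner α β f (fun x => k * g x) = k * weightedInner α β f g := by
  rw [weightedInner, weightedInner, ← intervalIntegral.integral_const_mul]
  exact intervalIntegral.integral_congr fun x _ => by ring

theorem weightedInner_congr {f f' g g' : ℝ → ℝ} (hf : ∀ x ∈ Ioo (-1 : ℝ) 1, f x = f' x)
    (hg : ∀ x ∈ Ioo (-1 : ℝ) 1, g x = g' x) :
    weightedInner α β f g = weightedInner α β f' g' :=
  integral_congr_ae_Ioo (Eventually.of_forall fun x hx => by rw [hf x hx, hg x hx])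

theorem intervalIntegrable_jacobiJ_mul_jacobiJ (hα : -1 < α) (hβ : -1 < β) (m n : ℕ) :
    IntervalIntegrable (fun x => jacobiJ α β m x * jacobiJ α β n x * jacobiWeight (-α) β x)
      volume (-1) 1 :=
  (intervalIntegrable_iff_integrableOn_Ioo_of_le (by norm_num)).2
    (integrableOn_jacobiJ_mul_jacobiJ hα hβ m n)

theorem intervalIntegrable_sum_jacobiJ_mul (hα : -1 < α) (hβ : -1 < β) (S : Finset ℕ)
    (g : ℕ → ℝ) (n : ℕ) : IntervalIntegrable
      (fun x => (∑ k ∈ S, g k * jacobiJ α β k x) * jacobiJ α β n x * jacobiWeight (-α) β x)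
      volume (-1) 1 := by
  have := IntervalIntegrable.sum S fun k _ =>
    (intervalIntegrable_jacobiJ_mul_jacobiJ hα hβ k n).const_mul (g k)
  refine this.congr fun x _ => ?_
  rw [Finset.sum_apply, Finset.sum_mul, Finset.sum_mul]
  exact Finset.sum_congr rfl fun k _ => by ring

theorem weightedInner_sum_jacobiJ (hs0 : 0 < s) (hs1 : s < 1) (hα : s - 1 < α) (hβ : -1 < β)
    (S : Finset ℕ) (g : ℕ → ℝ) (hg : g n = 0) :
    weightedInner α β (fun x => ∑ k ∈ S, g k * jacobiJ α β k x) (jacobiJ α β n) = 0 := by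
  have e : ∀ x, (∑ k ∈ S, g k * jacobiJ α β k x) * jacobiJ α β n x * jacobiWeight (-α) β x =
      ∑ k ∈ S, g k * (jacobiJ α β k x * jacobiJ α β n x * jacobiWeight (-α) β x) := fun x => by
    rw [Finset.sum_mul, Finset.sum_mul]
    exact Finset.sum_congr rfl fun k _ => by ring
  simp only [weightedInner, e]
  rw [intervalIntegral.integral_finsetSum fun k _ =>
    (intervalIntegrable_jacobiJ_mul_jacobiJ (by linarith) hβ k n).const_mul (g k)]
  refine Finset.sum_eq_zero fun k _ => ?_
  rw [intervalIntegral.integral_const_mul]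
  by_cases hk : k = n
  · rw [hk, hg, zero_mul]
  · have := weightedInner_jacobiJ_of_ne hs0 hs1 hα hβ (Ne.symm hk)
    rw [weightedInner] at this
    rw [this, mul_zero]

/-! ### The corrections -/

/-- The numbers produced by the recursions yield FD-corrections. -/
theorem IsFDCoeff.isFDSequence (hs0 : 0 < s) (hs1 : s < 1) (hα : s - 1 < α) (hβ : -1 < β)
    {lam : ℕ → ℝ} {a : ℕ → ℕ → ℝ} (h : IsFDCoeff s α β r c n lam a) :
    IsFDSequence s α β r c n lam (fdExpansion α β r n a) where
  lam_zero := h.lam_zero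
  base := by
    rw [h.lam_zero]
    refine (isBVPSolution_sum hs0 hs1 hα hβ (baseEigenvalue s α β n)
      (Finset.Icc (n - r * 0) (n + r * 0)) (a 0)).congr_rhs fun x _ => ?_
    simp
  base_ne := by
    obtain ⟨x, h1, h2⟩ := ((eventually_jacobiJ_ne_zero (α := α) (β := β) (by linarith) hβ n).and
      Ioo_mem_nhdsGT_neg_one).exists
    exact ⟨x, h2, by rw [fdExpansion_zero]; exact mul_ne_zero h.start_ne h1⟩
  step j := by
    rw [h.lam_zero]
    refine (isBVPSolution_sum hs0 hs1 hα hβ (baseEigenvalue s α β n)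
      (Finset.Icc (n - r * (j + 1)) (n + r * (j + 1))) (a (j + 1))).congr_rhs fun x _ => ?_
    rw [fdRhs_fdExpansion (by linarith) h.support]
    exact Finset.sum_congr rfl fun m hm => by rw [h.eigenvalue_sub_mul hs0 hα hβ hm]
  solvable j := by
    rw [weightedInner_congr (fun x _ => fdRhs_fdExpansion (by linarith) h.support j x)
      (fun x _ => fdExpansion_zero a x), weightedInner_const_mul_right,
      weightedInner_sum_jacobiJ hs0 hs1 hα hβ, mul_zero]
    -- The coefficient of index `n` in the right-hand side is `(Λ_n - Λ_n)` times something.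
    rw [← h.eigenvalue_sub_mul hs0 hα hβ (by rw [Finset.mem_Icc]; omega), sub_self, zero_mul]
  orthogonal j := by
    rw [weightedInner_comm, weightedInner_congr (fun x _ => rfl)
      (fun x _ => fdExpansion_zero a x), weightedInner_const_mul_right]
    have e : weightedInner α β (fdExpansion α β r n a (j + 1)) (jacobiJ α β n) = 0 :=
      weightedInner_sum_jacobiJ hs0 hs1 hα hβ _ _ (h.diag j)
    rw [e, mul_zero]

/-- All FD-corrections are finite expansions in generalized Jacobi functions. -/
theorem IsFDSequence.exists_isFDCoeff (hs0 : 0 < s) (hs1 : s < 1) (hα : s - 1 < α) (hβ : -1 < β)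
    (hcond : 0 ≤ α ∨ 2 * s - 1 ≤ α ∨ s - 1 ≤ β) {lam : ℕ → ℝ} {u : ℕ → ℝ → ℝ}
    (h : IsFDSequence s α β r c n lam u) :
    ∃ a : ℕ → ℕ → ℝ, IsFDCoeff s α β r c n lam a ∧
      ∀ j, ∀ x ∈ Ioo (-1 : ℝ) 1, u j x = fdExpansion α β r n a j x := by
  have hbase := h.base
  rw [h.lam_zero] at hbase
  obtain ⟨a₀, ha₀⟩ := hbase.exists_eq_const_mul_jacobiJ hs0 hs1 hα hβ hcond
  have ha₀0 : a₀ ≠ 0 := by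
    obtain ⟨x, hx, hne⟩ := h.base_ne
    rintro rfl
    exact hne (by rw [ha₀ x hx, zero_mul])
  -- The recursion started from the same `a₀` provides the sequence for comparison.
  obtain ⟨⟨lam', a⟩, ⟨ha, hc⟩, -⟩ :=
    existsUnique_isFDCoeff (s := s) (α := α) (β := β) (r := r) (c := c) (n := n) ha₀0
  simp only at ha hc
  have h' := hc.isFDSequence hs0 hs1 hα hβ
  have hN := weightedInner_jacobiJ_self_pos (α := α) (by linarith) hβ n
  have key : ∀ j, lam j = lam' j ∧
      ∀ x ∈ Ioo (-1 : ℝ) 1, u j x = fdExpansion α β r n a j x := by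
    intro j
    induction j using Nat.strong_induction_on with
    | _ j ih =>
      rcases j with _ | j
      · exact ⟨h.lam_zero.trans hc.lam_zero.symm,
          fun x hx => by rw [ha₀ x hx, fdExpansion_zero, ha]⟩
      obtain ⟨δ, hδ⟩ : ∃ δ, δ = lam (j + 1) - lam' (j + 1) := ⟨_, rfl⟩
      have hu0 : ∀ x ∈ Ioo (-1 : ℝ) 1, u 0 x = a₀ * jacobiJ α β n x := ha₀
      -- By the induction hypothesis the right-hand sides can differ only in the newest eigenvalue
      -- correction, which multiplies `u 0`.
      have hF : ∀ x ∈ Ioo (-1 : ℝ) 1, fdRhs r c lam u j x =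
          fdRhs r c lam' (fdExpansion α β r n a) j x + δ * (a₀ * jacobiJ α β n x) := by
        intro x hx
        have e : ∑ p ∈ Finset.range (j + 1), lam (j + 1 - p) * u p x =
            ∑ p ∈ Finset.range (j + 1), lam' (j + 1 - p) * fdExpansion α β r n a p x +
              δ * (a₀ * jacobiJ α β n x) := by
          rw [Finset.sum_range_succ', Finset.sum_range_succ', Nat.sub_zero,
            (ih 0 (by omega)).2 x hx, fdExpansion_zero, ha, hδ,
            Finset.sum_congr rfl fun p hp => by
              have := Finset.mem_range.1 hp
              rw [(ih (j + 1 - (p + 1)) (by omega)).1, (ih (p + 1) (by omega)).2 x hx]]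
          ring
        rw [fdRhs, fdRhs, e, (ih j (by omega)).2 x hx]
        ring
      -- Both right-hand sides are orthogonal to `⁺J_n`, so `δ a₀ ⟨⁺J_n, ⁺J_n⟩ = 0`.
      have hδ0 : δ = 0 := by
        have h1 := h.solvable j
        have h2 := h'.solvable j
        have e1 := weightedInner_congr (α := α) (β := β) hF hu0
        have e2 : weightedInner α β (fdRhs r c lam' (fdExpansion α β r n a) j)
            (fdExpansion α β r n a 0) = a₀ * weightedInner α β
              (fdRhs r c lam' (fdExpansion α β r n a) j) (jacobiJ α β n) := by
          rw [← weightedInner_const_mul_right]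
          exact weightedInner_congr (fun _ _ => rfl) fun x _ => by rw [fdExpansion_zero, ha]
        rw [e2] at h2
        rw [h1, weightedInner_const_mul_right] at e1
        have e3 : weightedInner α β (fun x => fdRhs r c lam' (fdExpansion α β r n a) j x +
            δ * (a₀ * jacobiJ α β n x)) (jacobiJ α β n) =
            weightedInner α β (fdRhs r c lam' (fdExpansion α β r n a) j) (jacobiJ α β n) +
              δ * a₀ * weightedInner α β (jacobiJ α β n) (jacobiJ α β n) := by
          have i1 := intervalIntegrable_sum_jacobiJ_mul (α := α) (β := β) (by linarith) hβ
            (Finset.Icc (n - r * (j + 1)) (n + r * (j + 1)))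
            (fun m => ∑ p ∈ Finset.range (j + 1), lam' (j + 1 - p) * a p m -
              potentialCoeff α β r c n j (a j) m) n
          have i2 := (intervalIntegrable_jacobiJ_mul_jacobiJ (α := α) (β := β) (by linarith) hβ
            n n).const_mul (δ * a₀)
          simp only [weightedInner, fdRhs_fdExpansion (lam := lam') (c := c)
            (show -2 < α + β by linarith) hc.support j]
          rw [← intervalIntegral.integral_const_mul, ← intervalIntegral.integral_add i1 i2]
          exact intervalIntegral.integral_congr fun x _ => by ring
        rw [e3, mul_add, h2, zero_add] at e1
        have := hN.ne'
        simpa [ha₀0, this] using e1.symm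
      have hlam : lam (j + 1) = lam' (j + 1) := by linarith
      refine ⟨hlam, ?_⟩
      -- the difference solves the homogeneous problem and is orthogonal to `u 0`
      have hs := h.step j
      have hs' := h'.step j
      rw [h.lam_zero] at hs
      rw [hc.lam_zero] at hs'
      obtain ⟨d, hd⟩ := ((hs.linear (p := 1) (q := -1) hs1 hs').congr_rhs (G := fun _ => 0)
        fun x hx => by rw [hF x hx, hδ0]; ring).exists_eq_const_mul_jacobiJ hs0 hs1 hα hβ hcond
      have hd' : ∀ x ∈ Ioo (-1 : ℝ) 1, u (j + 1) x =
          fdExpansion α β r n a (j + 1) x + d * jacobiJ α β n x := fun x hx => by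
        linarith [hd x hx]
      -- The expansion has no component along `⁺J_n`, so orthogonality of `u (j + 1)` to `u 0`
      -- leaves `a₀ d ⟨⁺J_n, ⁺J_n⟩ = 0`.
      have hd0 : d = 0 := by
        have h1 := h.orthogonal j
        rw [weightedInner_comm, weightedInner_congr hd' hu0, weightedInner_const_mul_right] at h1
        have i1 := intervalIntegrable_sum_jacobiJ_mul (α := α) (β := β) (by linarith) hβ
          (Finset.Icc (n - r * (j + 1)) (n + r * (j + 1))) (a (j + 1)) n
        have i2 := (intervalIntegrable_jacobiJ_mul_jacobiJ (α := α) (β := β) (by linarith) hβ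
          n n).const_mul d
        have e3 : weightedInner α β (fun x => fdExpansion α β r n a (j + 1) x +
            d * jacobiJ α β n x) (jacobiJ α β n) =
            weightedInner α β (fdExpansion α β r n a (j + 1)) (jacobiJ α β n) +
              d * weightedInner α β (jacobiJ α β n) (jacobiJ α β n) := by
          simp only [weightedInner, fdExpansion]
          rw [← intervalIntegral.integral_const_mul, ← intervalIntegral.integral_add i1 i2]
          exact intervalIntegral.integral_congr fun x _ => by ring
        have e4 : weightedInner α β (fdExpansion α β r n a (j + 1)) (jacobiJ α β n) = 0 :=
          weightedInner_sum_jacobiJ hs0 hs1 hα hβ _ _ (hc.diag j)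
        rw [e3, e4, zero_add] at h1
        have := hN.ne'
        simpa [ha₀0, this] using h1
      intro x hx
      rw [hd' x hx, hd0]; ring
  have hlam : lam = lam' := funext fun j => (key j).1
  exact ⟨a, hlam ▸ hc, fun j => (key j).2⟩

end Algebra

end

end FDMethod

theorem lemma4p1 (s α β : ℝ) (hs0 : 0 < s) (hs1 : s < 1) (hα : s - 1 < α) (hβ : -1 < β)
    (r : ℕ) (c : ℕ → ℝ) (n : ℕ) :
    -- the numbers `b` are the connection coefficients
    (∀ (l k : ℕ) (x : ℝ), x ^ l * jacobiP α β k x =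
      ∑ m ∈ Finset.Icc (k - l) (k + l), jacobiB α β l k (k + l + 1 - m) * jacobiP α β m x) ∧
    -- the recursions determine all numbers from any nonzero starting coefficient
    (∀ a₀ : ℝ, a₀ ≠ 0 → ∃! p : (ℕ → ℝ) × (ℕ → ℕ → ℝ),
      p.2 0 n = a₀ ∧ IsFDCoeff s α β r c n p.1 p.2) ∧
    -- these numbers yield FD-corrections
    (∀ (lam : ℕ → ℝ) (a : ℕ → ℕ → ℝ), IsFDCoeff s α β r c n lam a →
      IsFDSequence s α β r c n lam (fdExpansion α β r n a)) ∧
    -- all FD-corrections are of this form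
    ((0 ≤ α ∨ 2 * s - 1 ≤ α ∨ s - 1 ≤ β) →
      ∀ (lam : ℕ → ℝ) (u : ℕ → ℝ → ℝ), IsFDSequence s α β r c n lam u →
        ∃ a : ℕ → ℕ → ℝ, IsFDCoeff s α β r c n lam a ∧
          ∀ j, ∀ x ∈ Ioo (-1 : ℝ) 1, u j x = fdExpansion α β r n a j x) := by
  exact ⟨fun l k x => pow_mul_jacobiP (by linarith) l k x, fun _ ha₀ => existsUnique_isFDCoeff ha₀,
    fun _ _ h => h.isFDSequence hs0 hs1 hα hβ,
    fun hcond _ _ h => h.exists_isFDCoeff hs0 hs1 hα hβ hcond⟩
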